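/- Let $M$ be a connected smooth manifold (Hausdorff, second countable, without boundary) of dimension $d\ge 4$, with a smooth Riemannian conformal structure $c=[g]$. All sections are smooth. Conventions. For $g\in c$ let $\nabla$ be the Levi-Civita connection, $P_{ab}$ the Schouten tensor, determined by $\mathrm{Ric}=(d-2)P+Jg$ with $J=g^{ab}P_{ab}$, and $\Delta=-g^{ab}\nabla_a\nabla_b$. The density bundle $\mathcal E[w]$ is trivialised by each $g\in c$, and a density $\sigma$ of weight $w$ is represented by functions $\sigma_g$ with $\sigma_{e^{2\omega}g}=e^{w\omega}\sigma_g$. The weighted standard tractor bundle $\mathcal T[w]$ is identified by each $g\in c$ with the bundle of triples $(\sigma,\mu_a,\rho)$ (in $\mathcal E[w+1]\oplus\mathcal E_a[w+1]\oplus\mathcal E[w-1]$), and for $\hat g=e^{2\omega}g$, $\Upsilon=d\omega$, the components are related by $$(\hat\sigma,\hat\mu_a,\hat\rho)=\Big(e^{(w+1)\omega}\sigma,\; e^{(w+1)\omega}(\mu_a+\sigma\Upsilon_a),\; e^{(w-1)\omega}\big(\rho-\Upsilon^a\mu_a-\tfrac12\Upsilon^a\Upsilon_a\,\sigma\big)\Big),$$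 indices being raised with $g$. The standard tractor bundle is $\mathcal T=\mathcal T[0]$; the canonical tractor $X\in\Gamma(\mathcal T[1])$ has components $(0,0,1)$; the tractor metric $h$ is the polarisation of $2\rho\sigma+\mu^a\mu_a$; the tractor connection on $\mathcal T$ is $$\nabla_a(\sigma,\mu_b,\rho)=(\nabla_a\sigma-\mu_a,\ \nabla_a\mu_b+g_{ab}\rho+P_{ab}\sigma,\ \nabla_a\rho-P_{ac}\mu^c);$$ and the tractor-D operator on a density of weight $w$ is $D\sigma=\big((d+2w-2)w\,\sigma,\ (d+2w-2)\nabla_a\sigma,\ (\Delta-wJ)\sigma\big)$. The metric $g$ is called almost Einstein if there is $x\in C^\infty(M)$, not identically zero, such that the trace-free part of $\nabla_a\nabla_b x+P_{ab}x$ vanishes. On $\sigma\in\Gamma(\mathcal E[1])$ the (conformally invariant) conformal-to-Einstein equation says that, in a scale $g\in c$, the trace-free part of $\nabla_a\nabla_b\sigma+P_{ab}\sigma$ vanishes. A section of $\mathcal T$ is parallel if its covariant derivative, computed in every scale $g\in c$, vanishes. Theorem 4.1. (1) For every $g\in c$: $g$ is almost Einstein if and only if $\mathcal T$ has a parallel section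 $I\neq 0$. (2) There is a bijection from the set of solutions $\sigma\in\Gamma(\mathcal E[1])$, $\sigma\not\equiv0$, of the conformal-to-Einstein equation onto the set of parallel sections $I\ne0$ of $\mathcal T$, given by $\sigma\mapsto\frac1d D\sigma$, with inverse $I\mapsto\sigma=h(I,X)$. (3) If $\sigma\not\equiv0$ is a solution of the conformal-to-Einstein equation, then $\{p\in M:\sigma(p)\ne0\}$ is open and dense, and on it the metric $g_+=\sigma^{-2}\boldsymbol g$ (equal to $\sigma_g^{-2}g$ in each scale $g\in c$) is Einstein: there is a constant $\lambda\in\mathbb R$ with $\mathrm{Ric}(g_+)=\lambda g_+$ on this set. -/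

import Mathlib

open scoped Manifold ContDiff Bundle

noncomputable section

namespace AlmostEinstein

/-! ## Tensor calculus in a coordinate domain of `ℝ^d`

`G : E d → (E d →L[ℝ] E d →L[ℝ] ℝ)` is the coordinate expression of a metric.  Only the germ of
`G` at the point under consideration matters.  If `G y` is nondegenerate, then `(G y).inverse` is
the index-raising map `T* → T`. -/

/-- The model space `ℝ^d`. -/
abbrev E (d : ℕ) : Type := EuclideanSpace ℝ (Fin d)

namespace Coord

variable {d : ℕ}

/-- The coordinate vector field `∂_i`. -/
def e (i : Fin d) : E d := EuclideanSpace.single i 1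

/-- The metric trace `g^{ij} T_{ij}`; here `g^{ij}` is the `i`-th component of the vector obtained
by raising the index of `dx^j`. -/
def metricTrace (B : E d →L[ℝ] E d →L[ℝ] ℝ) (T : E d → E d → ℝ) : ℝ :=
  ∑ i, ∑ j, (B.inverse (EuclideanSpace.proj j : E d →L[ℝ] ℝ)) i * T (e i) (e j)

/-- The trace-free part `T - (1/d) (tr_g T) g`. -/
def traceFree (B : E d →L[ℝ] E d →L[ℝ] ℝ) (T : E d → E d → ℝ) (u v : E d) : ℝ :=
  T u v - (1 / (d : ℝ)) * metricTrace B T * B u v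

/-- Christoffel symbols of the first kind, lowered in the last argument:
`(u, v, w) ↦ 1/2 (∂_u g(v,w) + ∂_v g(u,w) - ∂_w g(u,v))`, see `christoffelLow_apply`. -/
def christoffelLow (G : E d → (E d →L[ℝ] E d →L[ℝ] ℝ)) (y u v : E d) : E d →L[ℝ] ℝ :=
  (1 / 2 : ℝ) • (fderiv ℝ G y u v + fderiv ℝ G y v u - ((fderiv ℝ G y).flip u).flip v)

theorem christoffelLow_apply (G : E d → (E d →L[ℝ] E d →L[ℝ] ℝ)) (y u v w : E d) :
    christoffelLow G y u v w =
      (1 / 2 : ℝ) * (fderiv ℝ G y u v w + fderiv ℝ G y v u w - fderiv ℝ G y w u v) := by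
  simp [christoffelLow]

/-- Christoffel symbols of the Levi-Civita connection, `Γ(u,v) = Γ^k_{ij} u^i v^j ∂_k`. -/
def christoffel (G : E d → (E d →L[ℝ] E d →L[ℝ] ℝ)) (y u v : E d) : E d :=
  (G y).inverse (christoffelLow G y u v)

/-- The Riemann curvature `R(u,v)w = (∇_u ∇_v - ∇_v ∇_u) w`, i.e. `u^a v^b R_{ab}{}^c{}_d w^d`. -/
def riemann (G : E d → (E d →L[ℝ] E d →L[ℝ] ℝ)) (y u v w : E d) : E d :=
  fderiv ℝ (fun z => christoffel G z v w) y u - fderiv ℝ (fun z => christoffel G z u w) y v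
    + christoffel G y u (christoffel G y v w) - christoffel G y v (christoffel G y u w)

/-- The Ricci tensor `Ric_{ab} = R_{ca}{}^c{}_b`. -/
def ricci (G : E d → (E d →L[ℝ] E d →L[ℝ] ℝ)) (y v w : E d) : ℝ :=
  ∑ i, (riemann G y (e i) v w) i

/-- The metric trace `J` of the Schouten tensor: `J = Scal / (2 (d - 1))`. -/
def J (G : E d → (E d →L[ℝ] E d →L[ℝ] ℝ)) (y : E d) : ℝ :=
  metricTrace (G y) (ricci G y) / (2 * ((d : ℝ) - 1))

/-- The Schouten tensor `P`, determined by `Ric = (d - 2) P + J g`. -/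
def schouten (G : E d → (E d →L[ℝ] E d →L[ℝ] ℝ)) (y u v : E d) : ℝ :=
  (ricci G y u v - J G y * G y u v) / ((d : ℝ) - 2)

/-- The covariant derivative `(∇_u α)(v)` of a one-form `α`. -/
def covDeriv (G : E d → (E d →L[ℝ] E d →L[ℝ] ℝ)) (α : E d → (E d →L[ℝ] ℝ)) (y u v : E d) : ℝ :=
  fderiv ℝ α y u v - α y (christoffel G y u v)

/-- The Hessian `(∇∇F)(u,v)` of a function, the covariant derivative of `dF`. -/
def hessian (G : E d → (E d →L[ℝ] E d →L[ℝ] ℝ)) (F : E d → ℝ) (y u v : E d) : ℝ :=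
  covDeriv G (fderiv ℝ F) y u v

/-- The Laplacian with the sign convention `Δ = - g^{ab} ∇_a ∇_b`. -/
def laplacian (G : E d → (E d →L[ℝ] E d →L[ℝ] ℝ)) (F : E d → ℝ) (y : E d) : ℝ :=
  - metricTrace (G y) (hessian G F y)

/-- The trace-free part of `∇∇F + P F`, for a function `F`. -/
def traceFreeHessSchouten (G : E d → (E d →L[ℝ] E d →L[ℝ] ℝ)) (F : E d → ℝ) (y u v : E d) : ℝ :=
  traceFree (G y) (fun a b => hessian G F y a b + schouten G y a b * F y) u v

end Coord

/-! ## Tensors on a manifold -/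

section Manifold

variable {d : ℕ} {M : Type*} [TopologicalSpace M] [ChartedSpace (E d) M]

/-- A field of bilinear forms on the tangent spaces, without regularity. -/
abbrev BilinField (d : ℕ) (M : Type*) [TopologicalSpace M] [ChartedSpace (E d) M] : Type _ :=
  (p : M) → TangentSpace (𝓡 d) p →L[ℝ] TangentSpace (𝓡 d) p →L[ℝ] ℝ

/-- A field of covectors, without regularity. -/
abbrev CovectorField (d : ℕ) (M : Type*) [TopologicalSpace M] [ChartedSpace (E d) M] : Type _ :=
  (p : M) → TangentSpace (𝓡 d) p →L[ℝ] ℝ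

/-- The coordinates of `p` in the preferred chart around `p`. -/
def coordAt (p : M) : E d := extChartAt (𝓡 d) p p

/-- The coordinates of a tangent vector at `p` in the preferred chart around `p`. -/
def vecAt (p : M) : TangentSpace (𝓡 d) p →L[ℝ] E d :=
  mfderiv (𝓡 d) 𝓘(ℝ, E d) (extChartAt (𝓡 d) p) p

/-- The derivative at `y` of the inverse of the preferred chart around `p`. -/
def frameAt (p : M) (y : E d) : E d →L[ℝ] TangentSpace (𝓡 d) ((extChartAt (𝓡 d) p).symm y) :=
  mfderiv 𝓘(ℝ, E d) (𝓡 d) (extChartAt (𝓡 d) p).symm y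

/-- Coordinate expression of a function in the preferred chart around `p`. -/
def funIn (p : M) (f : M → ℝ) (y : E d) : ℝ := f ((extChartAt (𝓡 d) p).symm y)

/-- Coordinate expression of a covector field in the preferred chart around `p`. -/
def covIn (p : M) (α : CovectorField d M) (y : E d) : E d →L[ℝ] ℝ :=
  (α ((extChartAt (𝓡 d) p).symm y)) ∘L (frameAt p y)

/-- Coordinate expression of a field of bilinear forms in the preferred chart around `p`. -/
def bilIn (p : M) (g : BilinField d M) (y : E d) : E d →L[ℝ] E d →L[ℝ] ℝ :=
  (ContinuousLinearMap.precomp ℝ (frameAt p y)) ∘L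
    ((g ((extChartAt (𝓡 d) p).symm y)) ∘L (frameAt p y))

theorem bilIn_apply (p : M) (g : BilinField d M) (y u v : E d) :
    bilIn p g y u v = g ((extChartAt (𝓡 d) p).symm y) (frameAt p y u) (frameAt p y v) := rfl

/-- The Ricci tensor at `p` of a field of bilinear forms that is a smooth metric near `p`. -/
def ricci (g : BilinField d M) (p : M) (u v : TangentSpace (𝓡 d) p) : ℝ :=
  Coord.ricci (bilIn p g) (coordAt p) (vecAt p u) (vecAt p v)

/-- The Schouten tensor `P` of `g`. -/
def schouten (g : BilinField d M) (p : M) (u v : TangentSpace (𝓡 d) p) : ℝ :=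
  Coord.schouten (bilIn p g) (coordAt p) (vecAt p u) (vecAt p v)

/-- The metric trace `J` of the Schouten tensor of `g`. -/
def traceSchouten (g : BilinField d M) (p : M) : ℝ := Coord.J (bilIn p g) (coordAt p)

/-- The Levi-Civita covariant derivative `(∇_u α)(v)` of a covector field. -/
def covDeriv (g : BilinField d M) (α : CovectorField d M) (p : M)
    (u v : TangentSpace (𝓡 d) p) : ℝ :=
  Coord.covDeriv (bilIn p g) (covIn p α) (coordAt p) (vecAt p u) (vecAt p v)

/-- The Laplacian `Δ = - g^{ab} ∇_a ∇_b` on functions. -/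
def laplacian (g : BilinField d M) (f : M → ℝ) (p : M) : ℝ :=
  Coord.laplacian (bilIn p g) (funIn p f) (coordAt p)

/-- The trace-free part of `∇∇x + P x`, for a function `x`. -/
def traceFreeHessSchouten (g : BilinField d M) (x : M → ℝ) (p : M)
    (u v : TangentSpace (𝓡 d) p) : ℝ :=
  Coord.traceFreeHessSchouten (bilIn p g) (funIn p x) (coordAt p) (vecAt p u) (vecAt p v)

/-- The conformal-to-Einstein equation `trace-free (∇∇x + P x) = 0` for a function `x`. -/
def SolvesEinsteinEq (g : BilinField d M) (x : M → ℝ) : Prop :=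
  ∀ (p : M) (u v : TangentSpace (𝓡 d) p), traceFreeHessSchouten g x p u v = 0

variable [IsManifold (𝓡 d) ∞ M]

variable (d M) in
/-- Smooth Riemannian metrics on `M`. -/
abbrev Metric : Type _ :=
  Bundle.ContMDiffRiemannianMetric (𝓡 d) ∞ (E d) (fun p : M => TangentSpace (𝓡 d) p)

/-- `(M, g)` is almost Einstein if the conformal-to-Einstein equation has a smooth solution that
is not identically zero. -/
def IsAlmostEinstein (g : Metric d M) : Prop :=
  ∃ x : M → ℝ, ContMDiff (𝓡 d) 𝓘(ℝ, ℝ) ∞ x ∧ x ≠ 0 ∧ SolvesEinsteinEq g.inner x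

/-- The inner product `g^{ab} α_a β_b` of covectors at `p`. -/
def cometric (g : Metric d M) (p : M) (α β : TangentSpace (𝓡 d) p →L[ℝ] ℝ) : ℝ :=
  β ((g.inner p).inverse α)

theorem cometric_comm (g : Metric d M) (p : M) (α β : TangentSpace (𝓡 d) p →L[ℝ] ℝ) :
    cometric g p α β = cometric g p β α := by
  unfold cometric
  by_cases h : (g.inner p).IsInvertible
  · obtain ⟨L, hL⟩ := h
    have key : ∀ γ δ, γ ((g.inner p).inverse δ)
        = g.inner p ((g.inner p).inverse γ) ((g.inner p).inverse δ) := by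
      intro γ δ
      rw [← hL, ContinuousLinearMap.inverse_equiv]
      simp
    rw [key β α, key α β, g.symm]
  · simp [ContinuousLinearMap.inverse_of_not_isInvertible h]

/-! ## Conformal structures, densities and tractors -/

/-- `g' = e^{2φ} g` with `φ` smooth. -/
def IsRescaling (g g' : Metric d M) (φ : M → ℝ) : Prop :=
  ContMDiff (𝓡 d) 𝓘(ℝ, ℝ) ∞ φ ∧
    ∀ p : M, g'.inner p = Real.exp (2 * φ p) • g.inner p

variable (d M) in
/-- A conformal structure on `M`: an equivalence class of conformally related metrics. -/
structure ConformalStructure where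
  /-- the metrics in the conformal class -/
  metrics : Set (Metric d M)
  nonempty : metrics.Nonempty
  mem_iff : ∀ g ∈ metrics, ∀ g' : Metric d M, g' ∈ metrics ↔ ∃ φ : M → ℝ, IsRescaling g g' φ

theorem cometric_rescaling {g g' : Metric d M} {φ : M → ℝ} (h : IsRescaling g g' φ) (p : M)
    (α β : TangentSpace (𝓡 d) p →L[ℝ] ℝ) :
    cometric g' p α β = Real.exp (-(2 * φ p)) * cometric g p α β := by
  have ha : Real.exp (2 * φ p) ≠ 0 := (Real.exp_pos _).ne'
  have hs : g'.inner p
      = g.inner p ∘L ((ContinuousLinearEquiv.smulLeft (R₁ := ℝ) (Units.mk0 _ ha) :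
          TangentSpace (𝓡 d) p ≃L[ℝ] TangentSpace (𝓡 d) p) :
          TangentSpace (𝓡 d) p →L[ℝ] TangentSpace (𝓡 d) p) := by
    rw [h.2 p]
    ext u v
    simp [Units.smul_def]
  have hinv : (ContinuousLinearEquiv.smulLeft (R₁ := ℝ) (Units.mk0 _ ha) :
      TangentSpace (𝓡 d) p ≃L[ℝ] TangentSpace (𝓡 d) p).symm ((g.inner p).inverse α)
      = Real.exp (-(2 * φ p)) • (g.inner p).inverse α := by
    rw [ContinuousLinearEquiv.symm_apply_eq]
    simp [Units.smul_def, smul_smul, ← Real.exp_add]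
  unfold cometric
  rw [hs, ContinuousLinearMap.inverse_comp_equiv, ContinuousLinearMap.comp_apply,
    ContinuousLinearEquiv.coe_coe, hinv, map_smul, smul_eq_mul]

/-- The fibre at `p` of the density bundle `ℰ[w]`.  A density is given by its value with respect
to each metric of the conformal class, with value `e^{wφ} s` for `e^{2φ} g` if the value for `g`
is `s`; equivalently it is a function on the ray of metrics at `p`, homogeneous of degree `w`
under `g ↦ t² g`. -/
def Density (c : ConformalStructure d M) (w : ℝ) (p : M) : Submodule ℝ (c.metrics → ℝ) where
  carrier := {s | ∀ (g g' : c.metrics) (φ : M → ℝ), IsRescaling g.1 g'.1 φ →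
    s g' = Real.exp (w * φ p) * s g}
  add_mem' := by
    intro a b ha hb g g' φ h
    simp only [Pi.add_apply, ha g g' φ h, hb g g' φ h]
    ring
  zero_mem' := by
    intro g g' φ h
    simp
  smul_mem' := by
    intro t a ha g g' φ h
    simp only [Pi.smul_apply, ha g g' φ h, smul_eq_mul]
    ring

/-- Triples `(σ, μ_a, ρ)` at `p`. -/
abbrev Slots (d : ℕ) {M : Type*} [TopologicalSpace M] [ChartedSpace (E d) M] (p : M) : Type :=
  ℝ × (TangentSpace (𝓡 d) p →L[ℝ] ℝ) × ℝ

/-- The conformal transformation of the components of a tractor of weight `w` at `p`, when `g` is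
replaced by `e^{2φ} g`.  With `Υ = dφ`,
`(σ, μ, ρ) ↦ (e^{(w+1)φ} σ, e^{(w+1)φ} (μ + σ Υ), e^{(w-1)φ} (ρ - Υ·μ - (1/2) |Υ|² σ))`;
the exponentials come from trivialising `ℰ[w+1] ⊕ ℰ_a[w+1] ⊕ ℰ[w-1]` by the metric. -/
def transform (g : Metric d M) (w : ℝ) (φ : M → ℝ) (p : M) (U : Slots d p) : Slots d p :=
  (Real.exp ((w + 1) * φ p) * U.1,
   Real.exp ((w + 1) * φ p) • (U.2.1 + U.1 • mvfderiv (𝓡 d) φ p),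
   Real.exp ((w - 1) * φ p) * (U.2.2 - cometric g p (mvfderiv (𝓡 d) φ p) U.2.1
      - 1 / 2 * cometric g p (mvfderiv (𝓡 d) φ p) (mvfderiv (𝓡 d) φ p) * U.1))

/-- The fibre at `p` of the weighted standard tractor bundle `𝒯[w]`; the standard tractor bundle
`𝒯` is the case `w = 0`.  A tractor is given by its components with respect to each metric of the
conformal class, related by `transform`. -/
def Tractor (c : ConformalStructure d M) (w : ℝ) (p : M) :
    Submodule ℝ (c.metrics → Slots d p) where
  carrier := {U | ∀ (g g' : c.metrics) (φ : M → ℝ), IsRescaling g.1 g'.1 φ →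
    U g' = transform g.1 w φ p (U g)}
  add_mem' := by
    intro a b ha hb g g' φ h
    simp only [Pi.add_apply, ha g g' φ h, hb g g' φ h, transform, cometric]
    refine Prod.ext ?_ (Prod.ext ?_ ?_)
    · simp only [Prod.fst_add]; ring
    · simp only [Prod.fst_add, Prod.snd_add]; module
    · simp only [Prod.fst_add, Prod.snd_add, add_apply]; ring
  zero_mem' := by
    intro g g' φ h
    refine Prod.ext ?_ (Prod.ext ?_ ?_) <;> simp [transform, cometric]
  smul_mem' := by
    intro t a ha g g' φ h
    simp only [Pi.smul_apply, ha g g' φ h, transform, cometric]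
    refine Prod.ext ?_ (Prod.ext ?_ ?_)
    · simp only [Prod.smul_fst, smul_eq_mul]; ring
    · simp only [Prod.smul_fst, Prod.smul_snd, smul_eq_mul]; module
    · simp only [Prod.smul_fst, Prod.smul_snd, smul_apply, smul_eq_mul]; ring

variable {c : ConformalStructure d M}

/-- The function representing a section of `ℰ[w]` in the scale `g`. -/
def densIn (g : c.metrics) {w : ℝ} (σ : (p : M) → Density c w p) (p : M) : ℝ := (σ p).1 g

/-- The components in the scale `g` of a section of `𝒯[w]`. -/
def slotsIn (g : c.metrics) {w : ℝ} (U : (p : M) → Tractor c w p) (p : M) : Slots d p := (U p).1 g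

/-- Smoothness of a section of `ℰ[w]`. -/
def SmoothDensity {w : ℝ} (σ : (p : M) → Density c w p) : Prop :=
  ∀ g : c.metrics, ContMDiff (𝓡 d) 𝓘(ℝ, ℝ) ∞ (densIn g σ)

/-- Smoothness of a covector field, as a section of the cotangent bundle. -/
def SmoothCovector (α : CovectorField d M) : Prop :=
  ContMDiff (𝓡 d) ((𝓡 d).prod 𝓘(ℝ, E d →L[ℝ] ℝ)) ∞
    (fun p => Bundle.TotalSpace.mk' (E d →L[ℝ] ℝ)
      (E := fun p : M => TangentSpace (𝓡 d) p →L[ℝ] Bundle.Trivial M ℝ p) p (α p))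

/-- Smoothness of a section of `𝒯[w]`. -/
def SmoothTractor {w : ℝ} (U : (p : M) → Tractor c w p) : Prop :=
  ∀ g : c.metrics,
    ContMDiff (𝓡 d) 𝓘(ℝ, ℝ) ∞ (fun p => (slotsIn g U p).1) ∧
    SmoothCovector (fun p => (slotsIn g U p).2.1) ∧
    ContMDiff (𝓡 d) 𝓘(ℝ, ℝ) ∞ (fun p => (slotsIn g U p).2.2)

/-- The tractor metric in the scale `g`, polarised from `2ρσ + μ^a μ_a`. -/
def tractorForm (g : Metric d M) (p : M) (U V : Slots d p) : ℝ :=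
  U.1 * V.2.2 + U.2.2 * V.1 + cometric g p U.2.1 V.2.1

/-- The canonical tractor `X ∈ 𝒯[1]`, with components `(0, 0, 1)` in every scale. -/
def canonicalX (c : ConformalStructure d M) (p : M) : Tractor c 1 p :=
  ⟨fun _ => (0, 0, 1), by
    intro g g' φ h
    simp [transform, cometric]⟩

/-- The tractor metric as a pairing `𝒯[w] × 𝒯[w'] → ℰ[w + w']`. -/
def tractorMetric {w w' : ℝ} {p : M} (U : Tractor c w p) (V : Tractor c w' p) :
    Density c (w + w') p :=
  ⟨fun g => tractorForm g.1 p (U.1 g) (V.1 g), by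
    intro g g' φ h
    have hU := U.2 g g' φ h
    have hV := V.2 g g' φ h
    have h1 := cometric_rescaling h p
    have h2 := cometric_comm g.1 p (U.1 g).2.1 (mvfderiv (𝓡 d) φ p)
    simp only [hU, hV, tractorForm, h1, transform]
    simp only [cometric, map_add, map_smul, add_apply, smul_apply, smul_eq_mul] at h2 ⊢
    rw [h2]
    have e0 : Real.exp ((w + w') * φ p)
        = Real.exp ((w + 1) * φ p) * Real.exp ((w' - 1) * φ p) := by
      rw [← Real.exp_add]; ring_nf
    have e1 : Real.exp ((w + w') * φ p)
        = Real.exp ((w - 1) * φ p) * Real.exp ((w' + 1) * φ p) := by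
      rw [← Real.exp_add]; ring_nf
    have e2 : Real.exp ((w + w') * φ p) = Real.exp (-(2 * φ p)) *
        (Real.exp ((w + 1) * φ p) * Real.exp ((w' + 1) * φ p)) := by
      rw [← Real.exp_add, ← Real.exp_add]; ring_nf
    linear_combination
      (-((U.1 g).1 * ((V.1 g).2.2 - (V.1 g).2.1 ((g.1.inner p).inverse (mvfderiv (𝓡 d) φ p))
        - 1 / 2 * mvfderiv (𝓡 d) φ p ((g.1.inner p).inverse (mvfderiv (𝓡 d) φ p)) * (V.1 g).1))) * e0
      - ((V.1 g).1 * ((U.1 g).2.2 - (U.1 g).2.1 ((g.1.inner p).inverse (mvfderiv (𝓡 d) φ p))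
        - 1 / 2 * mvfderiv (𝓡 d) φ p ((g.1.inner p).inverse (mvfderiv (𝓡 d) φ p)) * (U.1 g).1)) * e1
      - ((V.1 g).2.1 ((g.1.inner p).inverse (U.1 g).2.1)
        + (V.1 g).1 * (U.1 g).2.1 ((g.1.inner p).inverse (mvfderiv (𝓡 d) φ p))
        + (U.1 g).1 * ((V.1 g).2.1 ((g.1.inner p).inverse (mvfderiv (𝓡 d) φ p))
          + (V.1 g).1 * mvfderiv (𝓡 d) φ p ((g.1.inner p).inverse (mvfderiv (𝓡 d) φ p)))) * e2⟩

/-- The tractor connection in the scale `g`: the three components of `∇_v (σ, μ, ρ)`,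
`(∇_v σ - μ(v), ∇_v μ + ρ g(v,·) + σ P(v,·), ∇_v ρ - P(v, μ^♯))`. -/
def tractorConnection (g : Metric d M) (U : (p : M) → Slots d p) (p : M)
    (v : TangentSpace (𝓡 d) p) : ℝ × (TangentSpace (𝓡 d) p → ℝ) × ℝ :=
  (mvfderiv (𝓡 d) (fun q => (U q).1) p v - (U p).2.1 v,
   fun u => covDeriv g.inner (fun q => (U q).2.1) p v u + (U p).2.2 * g.inner p v u
      + (U p).1 * schouten g.inner p v u,
   mvfderiv (𝓡 d) (fun q => (U q).2.2) p v
      - schouten g.inner p v ((g.inner p).inverse (U p).2.1))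

/-- A section of the standard tractor bundle is parallel if its covariant derivative vanishes,
when computed in every scale. -/
def IsParallel (U : (p : M) → Tractor c 0 p) : Prop :=
  ∀ (g : c.metrics) (p : M) (v : TangentSpace (𝓡 d) p),
    tractorConnection g.1 (slotsIn g U) p v = 0

/-- Nontrivial (smooth) solutions of the conformal-to-Einstein equation on densities of
weight one.  The equation is conformally invariant, so it is asked for in one scale only. -/
def IsEinsteinScale (σ : (p : M) → Density c 1 p) : Prop :=
  SmoothDensity σ ∧ σ ≠ 0 ∧ ∃ g : c.metrics, SolvesEinsteinEq g.1.inner (densIn g σ)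

/-- Nonzero (smooth) parallel sections of the standard tractor bundle. -/
def IsParallelTractor (U : (p : M) → Tractor c 0 p) : Prop :=
  SmoothTractor U ∧ U ≠ 0 ∧ IsParallel U

/-- The components in the scale `g` of the tractor-D operator applied to a density of weight `w`:
`((d+2w-2) w f, (d+2w-2) ∇f, (Δ - w J) f)`. -/
def tractorD (g : c.metrics) {w : ℝ} (σ : (p : M) → Density c w p) (p : M) : Slots d p :=
  (((d : ℝ) + 2 * w - 2) * w * densIn g σ p,
   ((d : ℝ) + 2 * w - 2) • mvfderiv (𝓡 d) (densIn g σ) p,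
   laplacian g.1.inner (densIn g σ) p - w * traceSchouten g.1.inner p * densIn g σ p)

/-- The field of bilinear forms `σ^{-2} 𝐠`, computed in the scale `g`.  It is a metric where `σ`
does not vanish. -/
def einsteinMetric (g : c.metrics) (σ : (p : M) → Density c 1 p) : BilinField d M :=
  fun p => ((densIn g σ p) ^ 2)⁻¹ • g.1.inner p

end Manifold

end AlmostEinstein

end

/-! Fix a scale `g`. Writing `-ρ g` for the pure trace part of `∇∇σ + Pσ`, the conformal-to-Einstein
equation becomes `∇∇σ + Pσ + ρg = 0`, and tracing forces `ρ = (Δσ - Jσ)/d`. So `σ` solves the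
equation exactly when `(σ, dσ, ρ) = (1/d) Dσ` satisfies the first two slots of `∇I = 0`.

The third slot, `dρ = P(·, grad σ)`, comes for free by prolongation (`fderiv_bottomSlot`):
differentiate the equation, skew, apply the Ricci identity and trace; the terms in `dJ` cancel by
the contracted Bianchi identity. Conversely, if `I` is parallel, its first slot gives `μ = dσ` and
its second, traced, gives `ρ`, so `I` is recovered from `σ = h(I, X)` (`eq_slotsOf_of_parallel`).
This is the bijection. That `(σ, dσ, ρ)` transforms as a tractor is the conformal change of the
Hessian and of `P` (`slotsOf_rescaling`). Part (1) follows because a function in one scale extends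
uniquely to a density of weight one.

For part (3), `(σ, dσ, ρ)` solves a closed linear first order system, so by Grönwall it vanishes
along a coordinate segment once it vanishes at one end (`eq_zero_of_segment`). Hence the interior of
the zero set is closed, and empty by connectedness. The square `h(I, I) = 2σρ + |dσ|²` has zero
derivative and is constant. In the scale `σ⁻²g` the density is locally `±1`, its Hessian vanishes,
and the transformation law gives `P = -½ h(I, I) g₊`, so `Ric = -(d - 1) h(I, I) g₊`.

All calculus is done in open subsets of `ℝ^d`. Tensors on `M` are evaluated at each point in that
point's own preferred chart, so differentiating them needs naturality under transition maps
(`IsPullback`). -/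

noncomputable section

namespace AlmostEinstein

set_option synthInstance.maxHeartbeats 200000

namespace Coord

variable {d : ℕ}

/-! ### Linear algebra of a positive definite bilinear form -/

section LinearAlgebra

variable {B : E d →L[ℝ] E d →L[ℝ] ℝ}

/-- Positivity makes `B` injective, and `T` and `T*` have equal dimension. This is what gives
`B.inverse` its meaning as the raising of an index. -/
theorem isInvertible_of_pos (hB : ∀ u, u ≠ 0 → 0 < B u u) : B.IsInvertible := by
  have hinj : Function.Injective (B : E d →ₗ[ℝ] E d →L[ℝ] ℝ) := by
    rw [← LinearMap.ker_eq_bot, LinearMap.ker_eq_bot']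
    intro u hu
    by_contra h
    have := hB u h
    have h2 : B u = 0 := hu
    simp [h2] at this
  have hdim : Module.finrank ℝ (E d) = Module.finrank ℝ (E d →L[ℝ] ℝ) := by
    rw [← LinearEquiv.finrank_eq (LinearMap.toContinuousLinearMap (𝕜 := ℝ) (E := E d) (F' := ℝ))]
    exact (Subspace.dual_finrank_eq (K := ℝ) (V := E d)).symm
  exact ⟨(LinearMap.linearEquivOfInjective _ hinj hdim).toContinuousLinearEquiv, by ext; rfl⟩

theorem apply_inverse (hB : ∀ u, u ≠ 0 → 0 < B u u) (α : E d →L[ℝ] ℝ) : B (B.inverse α) = α := by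
  obtain ⟨L, hL⟩ := isInvertible_of_pos hB
  rw [← hL, ContinuousLinearMap.inverse_equiv]
  simp

theorem inverse_apply (hB : ∀ u, u ≠ 0 → 0 < B u u) (v : E d) : B.inverse (B v) = v := by
  obtain ⟨L, hL⟩ := isInvertible_of_pos hB
  rw [← hL, ContinuousLinearMap.inverse_equiv]
  simp

theorem eq_of_forall_apply_eq (hB : ∀ u, u ≠ 0 → 0 < B u u) {v w : E d}
    (h : ∀ u, B v u = B w u) : v = w := by
  rw [← inverse_apply hB v, ← inverse_apply hB w]
  congr 1
  ext u
  exact h u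

/-- `b` is a frame in which `B` is the standard inner product, expressed by the expansion
`w = ∑ i, B w (b i) • b i`. -/
def IsFrame (B : E d →L[ℝ] E d →L[ℝ] ℝ) (b : Fin d → E d) : Prop :=
  ∀ w, ∑ i, B w (b i) • b i = w

/-- A symmetric form has an orthogonal basis; positivity allows its vectors to be normalised. -/
theorem exists_isFrame (hs : ∀ u v, B u v = B v u) (hB : ∀ u, u ≠ 0 → 0 < B u u) :
    ∃ b, IsFrame B b := by
  let B' : LinearMap.BilinForm ℝ (E d) := LinearMap.mk₂ ℝ (fun u v => B u v)
    (by simp) (by simp) (by simp) (by simp)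
  have : Invertible (2 : ℝ) := invertibleOfNonzero two_ne_zero
  obtain ⟨v, hv⟩ := LinearMap.BilinForm.exists_orthogonal_basis (B := B') ⟨fun x y => by
    simpa [B'] using hs x y⟩
  have hdim : Module.finrank ℝ (E d) = d := by simp
  let v' := v.reindex (finCongr hdim)
  have hv' : ∀ i j, i ≠ j → B (v' i) (v' j) = 0 := by
    intro i j hij
    have := hv (show (finCongr hdim).symm i ≠ (finCongr hdim).symm j by simpa using hij)
    simpa [B', v'] using this
  have hpos : ∀ i, 0 < B (v' i) (v' i) := fun i => hB _ (v'.ne_zero i)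
  refine ⟨fun i => (Real.sqrt (B (v' i) (v' i)))⁻¹ • v' i, fun w => ?_⟩
  have hexp : ∀ w i, B w (v' i) = v'.repr w i * B (v' i) (v' i) := by
    intro w i
    conv_lhs => rw [← v'.sum_repr w]
    simp only [map_sum, map_smul, sum_apply, smul_apply,
      smul_eq_mul]
    refine Finset.sum_eq_single i (fun j _ hj => ?_) (by simp)
    rw [hv' j i hj, mul_zero]
  conv_rhs => rw [← v'.sum_repr w]
  refine Finset.sum_congr rfl fun i _ => ?_
  rw [map_smul, hexp w i, smul_smul, smul_eq_mul]
  congr 1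
  have h1 := Real.mul_self_sqrt (hpos i).le
  have h2 : Real.sqrt (B (v' i) (v' i)) ≠ 0 := (Real.sqrt_pos.2 (hpos i)).ne'
  generalize B (v' i) (v' i) = t at *
  field_simp
  rw [sq, h1, mul_comm]

/-- Bilinearity of a two-tensor given as a function of two vectors. -/
structure IsBilin (T : E d → E d → ℝ) : Prop where
  add_left : ∀ u u' v, T (u + u') v = T u v + T u' v
  smul_left : ∀ (t : ℝ) u v, T (t • u) v = t * T u v
  add_right : ∀ u v v', T u (v + v') = T u v + T u v'
  smul_right : ∀ (t : ℝ) u v, T u (t • v) = t * T u v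

namespace IsBilin

variable {T S : E d → E d → ℝ}

theorem sum_left (hT : IsBilin T) {ι : Type*} (s : Finset ι) (f : ι → E d) (v : E d) :
    T (∑ i ∈ s, f i) v = ∑ i ∈ s, T (f i) v :=
  map_sum (AddMonoidHom.mk' (fun u => T u v) fun a b => hT.add_left a b v) f s

theorem sum_right (hT : IsBilin T) {ι : Type*} (s : Finset ι) (f : ι → E d) (v : E d) :
    T v (∑ i ∈ s, f i) = ∑ i ∈ s, T v (f i) :=
  map_sum (AddMonoidHom.mk' (fun u => T v u) fun a b => hT.add_right v a b) f s

theorem of_clm (B : E d →L[ℝ] E d →L[ℝ] ℝ) : IsBilin fun u v => B u v := by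
  constructor <;> simp

theorem sub (hT : IsBilin T) (hS : IsBilin S) : IsBilin fun u v => T u v - S u v := by
  constructor <;> intros <;>
    simp only [hT.add_left, hT.smul_left, hT.add_right, hT.smul_right,
      hS.add_left, hS.smul_left, hS.add_right, hS.smul_right] <;> ring

theorem const_mul (t : ℝ) (hT : IsBilin T) : IsBilin fun u v => t * T u v := by
  constructor <;> intros <;>
    simp only [hT.add_left, hT.smul_left, hT.add_right, hT.smul_right] <;> ring

theorem mul_const (t : ℝ) (hT : IsBilin T) : IsBilin fun u v => T u v * t := by
  constructor <;> intros <;>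
    simp only [hT.add_left, hT.smul_left, hT.add_right, hT.smul_right] <;> ring

theorem comp_left (hT : IsBilin T) (L : E d →L[ℝ] E d) : IsBilin fun u v => T (L u) v := by
  constructor <;> intros <;>
    simp only [map_add, map_smul, hT.add_left, hT.smul_left, hT.add_right, hT.smul_right]

theorem comp_right (hT : IsBilin T) (L : E d →L[ℝ] E d) : IsBilin fun u v => T u (L v) := by
  constructor <;> intros <;>
    simp only [map_add, map_smul, hT.add_left, hT.smul_left, hT.add_right, hT.smul_right]

end IsBilin

theorem sum_apply_smul_e (w : E d) : ∑ i, w i • (e i : E d) = w := by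
  ext j
  simp [e, Pi.single_apply]

theorem metricTrace_eq_sum_raised {T : E d → E d → ℝ} (hT : IsBilin T) :
    metricTrace B T = ∑ j, T (B.inverse (EuclideanSpace.proj j : E d →L[ℝ] ℝ)) (e j) := by
  unfold metricTrace
  rw [Finset.sum_comm]
  refine Finset.sum_congr rfl fun j _ => ?_
  conv_rhs => rw [← sum_apply_smul_e (B.inverse (EuclideanSpace.proj j : E d →L[ℝ] ℝ))]
  rw [hT.sum_left]
  simp only [hT.smul_left]

/-- The vector raised from `dx^j` has frame coefficients `b i j`, and summing over `j` rebuilds `b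
i` in the other argument. Metric traces thereby become coordinate free. -/
theorem metricTrace_eq_sum_frame (hB : ∀ u, u ≠ 0 → 0 < B u u) {b : Fin d → E d}
    (hb : IsFrame B b) {T : E d → E d → ℝ} (hT : IsBilin T) :
    metricTrace B T = ∑ i, T (b i) (b i) := by
  rw [metricTrace_eq_sum_raised hT]
  have h1 : ∀ j, B.inverse (EuclideanSpace.proj j : E d →L[ℝ] ℝ) = ∑ i, b i j • b i := by
    intro j
    conv_lhs => rw [← hb (B.inverse (EuclideanSpace.proj j : E d →L[ℝ] ℝ))]
    rw [apply_inverse hB]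
    rfl
  simp only [h1, hT.sum_left, hT.smul_left]
  rw [Finset.sum_comm]
  refine Finset.sum_congr rfl fun i _ => ?_
  conv_rhs => rw [← sum_apply_smul_e (b i)]
  rw [hT.sum_right, sum_apply_smul_e]
  simp only [hT.smul_right]

/-- The trace of an endomorphism involves no metric, so a frame of any form `B` computes it. This is
the version needed for the contraction in `ricci`. -/
theorem trace_eq_sum_frame {b : Fin d → E d} (hb : IsFrame B b) (L : E d →ₗ[ℝ] E d) :
    ∑ i, (L (e i)) i = ∑ i, B (L (b i)) (b i) := by
  have h1 : ∀ i, (L (e i)) i = ∑ k, B (L (e i)) (b k) * b k i := by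
    intro i
    conv_lhs => rw [← hb (L (e i))]
    simp
  simp only [h1]
  rw [Finset.sum_comm]
  refine Finset.sum_congr rfl fun k _ => ?_
  have h2 : L (b k) = ∑ i, b k i • L (e i) := by
    conv_lhs => rw [← sum_apply_smul_e (b k)]
    simp only [map_sum, map_smul]
  rw [h2]
  simp only [map_sum, map_smul, sum_apply, smul_apply, smul_eq_mul]
  exact Finset.sum_congr rfl fun i _ => mul_comm _ _

theorem sum_frame_self {b : Fin d → E d} (hb : IsFrame B b) :
    ∑ i, B (b i) (b i) = d := by
  have h := trace_eq_sum_frame hb LinearMap.id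
  simp only [LinearMap.id_apply] at h
  rw [← h]
  simp [e]

/-- Contracts a repeated frame index. `L` is an unbundled linear function so that it can be one
argument of an unbundled tensor. -/
theorem sum_frame_mul {b : Fin d → E d} (hb : IsFrame B b) {L : E d → ℝ}
    (hadd : ∀ u v, L (u + v) = L u + L v) (hsmul : ∀ (t : ℝ) u, L (t • u) = t * L u) (w : E d) :
    ∑ i, B w (b i) * L (b i) = L w := by
  conv_rhs => rw [← hb w]
  have := map_sum (AddMonoidHom.mk' L hadd) (fun i => B w (b i) • b i) Finset.univ
  simp only [AddMonoidHom.mk'_apply, hsmul] at this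
  exact this.symm

theorem metricTrace_congr {T S : E d → E d → ℝ} (h : ∀ u v, T u v = S u v) :
    metricTrace B T = metricTrace B S := by
  rw [show T = S from funext fun u => funext (h u)]

theorem metricTrace_add (T S : E d → E d → ℝ) :
    metricTrace B (fun u v => T u v + S u v) = metricTrace B T + metricTrace B S := by
  simp only [metricTrace, mul_add, Finset.sum_add_distrib]

theorem metricTrace_sub (T S : E d → E d → ℝ) :
    metricTrace B (fun u v => T u v - S u v) = metricTrace B T - metricTrace B S := by
  simp only [metricTrace, mul_sub, Finset.sum_sub_distrib]

theorem metricTrace_const_mul (t : ℝ) (T : E d → E d → ℝ) :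
    metricTrace B (fun u v => t * T u v) = t * metricTrace B T := by
  simp only [metricTrace, Finset.mul_sum]
  exact Finset.sum_congr rfl fun i _ => Finset.sum_congr rfl fun j _ => by ring

theorem metricTrace_self (hs : ∀ u v, B u v = B v u) (hB : ∀ u, u ≠ 0 → 0 < B u u) :
    metricTrace B (fun u v => B u v) = d := by
  obtain ⟨b, hb⟩ := exists_isFrame hs hB
  rw [metricTrace_eq_sum_frame hB hb (.of_clm B), sum_frame_self hb]

theorem inverse_smul_form (hB : ∀ u, u ≠ 0 → 0 < B u u) {t : ℝ} (ht : 0 < t)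
    (α : E d →L[ℝ] ℝ) : (t • B).inverse α = t⁻¹ • B.inverse α := by
  have hB' : ∀ u, u ≠ 0 → 0 < (t • B) u u := fun u hu => by
    simpa using mul_pos ht (hB u hu)
  refine eq_of_forall_apply_eq hB' fun u => ?_
  rw [apply_inverse hB']
  simp [apply_inverse hB, ht.ne']

theorem metricTrace_smul_form (hB : ∀ u, u ≠ 0 → 0 < B u u) {t : ℝ} (ht : 0 < t)
    (T : E d → E d → ℝ) : metricTrace (t • B) T = t⁻¹ * metricTrace B T := by
  simp only [metricTrace, inverse_smul_form hB ht, Finset.mul_sum, PiLp.smul_apply, smul_eq_mul]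
  exact Finset.sum_congr rfl fun i _ => Finset.sum_congr rfl fun j _ => by ring

end LinearAlgebra

end Coord

namespace Coord

variable {d : ℕ}


/-! Shortcut instances for towers of continuous linear maps. -/

instance covector_normed : NormedAddCommGroup (E d →L[ℝ] ℝ) := inferInstance
instance covector_normedSpace : NormedSpace ℝ (E d →L[ℝ] ℝ) := inferInstance
instance covector_addCommGroup : AddCommGroup (E d →L[ℝ] ℝ) := inferInstance
instance covector_module : Module ℝ (E d →L[ℝ] ℝ) := inferInstance
instance bilinear_normed : NormedAddCommGroup (E d →L[ℝ] E d →L[ℝ] ℝ) := inferInstance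
instance bilinear_normedSpace : NormedSpace ℝ (E d →L[ℝ] E d →L[ℝ] ℝ) := inferInstance
instance bilinear_addCommGroup : AddCommGroup (E d →L[ℝ] E d →L[ℝ] ℝ) := inferInstance
instance bilinear_module : Module ℝ (E d →L[ℝ] E d →L[ℝ] ℝ) := inferInstance
instance trilinear_normed : NormedAddCommGroup (E d →L[ℝ] E d →L[ℝ] E d →L[ℝ] ℝ) := inferInstance
instance trilinear_normedSpace : NormedSpace ℝ (E d →L[ℝ] E d →L[ℝ] E d →L[ℝ] ℝ) := inferInstance
instance trilinear_addCommGroup : AddCommGroup (E d →L[ℝ] E d →L[ℝ] E d →L[ℝ] ℝ) := inferInstance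
instance trilinear_module : Module ℝ (E d →L[ℝ] E d →L[ℝ] E d →L[ℝ] ℝ) := inferInstance
instance endo_normed : NormedAddCommGroup (E d →L[ℝ] E d) := inferInstance
instance endo_normedSpace : NormedSpace ℝ (E d →L[ℝ] E d) := inferInstance
instance endo_addCommGroup : AddCommGroup (E d →L[ℝ] E d) := inferInstance
instance endo_module : Module ℝ (E d →L[ℝ] E d) := inferInstance
instance bilinearVec_normed : NormedAddCommGroup (E d →L[ℝ] E d →L[ℝ] E d) := inferInstance
instance bilinearVec_normedSpace : NormedSpace ℝ (E d →L[ℝ] E d →L[ℝ] E d) := inferInstance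
instance bilinearVec_addCommGroup : AddCommGroup (E d →L[ℝ] E d →L[ℝ] E d) := inferInstance
instance bilinearVec_module : Module ℝ (E d →L[ℝ] E d →L[ℝ] E d) := inferInstance
instance trilinearVec_normed : NormedAddCommGroup (E d →L[ℝ] E d →L[ℝ] E d →L[ℝ] E d) := inferInstance
instance trilinearVec_normedSpace : NormedSpace ℝ (E d →L[ℝ] E d →L[ℝ] E d →L[ℝ] E d) := inferInstance
instance trilinearVec_addCommGroup : AddCommGroup (E d →L[ℝ] E d →L[ℝ] E d →L[ℝ] E d) := inferInstance
instance trilinearVec_module : Module ℝ (E d →L[ℝ] E d →L[ℝ] E d →L[ℝ] E d) := inferInstance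
instance raise_normed : NormedAddCommGroup ((E d →L[ℝ] ℝ) →L[ℝ] E d) := inferInstance
instance raise_normedSpace : NormedSpace ℝ ((E d →L[ℝ] ℝ) →L[ℝ] E d) := inferInstance

/-! ### The Levi-Civita connection of a metric on an open set -/

/-- `G` is a smooth Riemannian metric on the open set `U`. -/
structure IsMetricOn (G : E d → (E d →L[ℝ] E d →L[ℝ] ℝ)) (U : Set (E d)) : Prop where
  isOpen : IsOpen U
  contDiffOn : ContDiffOn ℝ ∞ G U
  symm : ∀ z ∈ U, ∀ u v, G z u v = G z v u
  pos : ∀ z ∈ U, ∀ u, u ≠ 0 → 0 < G z u u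

/-- The Christoffel symbols of the first kind as a continuous bilinear map. -/
def christoffelLowL (G : E d → (E d →L[ℝ] E d →L[ℝ] ℝ)) (y : E d) :
    E d →L[ℝ] E d →L[ℝ] (E d →L[ℝ] ℝ) :=
  (1 / 2 : ℝ) • (fderiv ℝ G y + (fderiv ℝ G y).flip
    - ((ContinuousLinearMap.flipₗᵢ ℝ (E d) (E d) ℝ).toContinuousLinearEquiv :
        (E d →L[ℝ] E d →L[ℝ] ℝ) →L[ℝ] (E d →L[ℝ] E d →L[ℝ] ℝ)) ∘L (fderiv ℝ G y).flip)

theorem christoffelLowL_apply (G : E d → (E d →L[ℝ] E d →L[ℝ] ℝ)) (y u v : E d) :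
    christoffelLowL G y u v = christoffelLow G y u v := by
  ext w
  simp [christoffelLowL, christoffelLow]

/-- The Christoffel symbols as a continuous bilinear map. -/
def christoffelL (G : E d → (E d →L[ℝ] E d →L[ℝ] ℝ)) (y : E d) : E d →L[ℝ] E d →L[ℝ] E d :=
  (ContinuousLinearMap.compL ℝ (E d) (E d →L[ℝ] ℝ) (E d) (G y).inverse) ∘L christoffelLowL G y

theorem christoffelL_apply (G : E d → (E d →L[ℝ] E d →L[ℝ] ℝ)) (y u v : E d) :
    christoffelL G y u v = christoffel G y u v := by
  simp [christoffelL, christoffel, christoffelLowL_apply]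

namespace IsMetricOn

variable {G : E d → (E d →L[ℝ] E d →L[ℝ] ℝ)} {U : Set (E d)} {y : E d}

theorem mono (hG : IsMetricOn G U) {V : Set (E d)} (hV : IsOpen V) (h : V ⊆ U) :
    IsMetricOn G V :=
  ⟨hV, hG.contDiffOn.mono h, fun z hz => hG.symm z (h hz), fun z hz => hG.pos z (h hz)⟩

theorem contDiffAt (hG : IsMetricOn G U) (hy : y ∈ U) : ContDiffAt ℝ ∞ G y :=
  hG.contDiffOn.contDiffAt (hG.isOpen.mem_nhds hy)

theorem differentiableAt (hG : IsMetricOn G U) (hy : y ∈ U) : DifferentiableAt ℝ G y :=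
  (hG.contDiffAt hy).differentiableAt (by simp)

theorem mem_nhds (hG : IsMetricOn G U) (hy : y ∈ U) : U ∈ nhds y := hG.isOpen.mem_nhds hy

theorem apply_inverse (hG : IsMetricOn G U) (hy : y ∈ U) (α : E d →L[ℝ] ℝ) (v : E d) :
    G y ((G y).inverse α) v = α v := by
  rw [Coord.apply_inverse (hG.pos y hy)]

theorem exists_isFrame (hG : IsMetricOn G U) (hy : y ∈ U) : ∃ b, IsFrame (G y) b :=
  Coord.exists_isFrame (hG.symm y hy) (hG.pos y hy)

theorem contDiffOn_inverse (hG : IsMetricOn G U) : ContDiffOn ℝ ∞ (fun z => (G z).inverse) U := by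
  intro z hz
  exact ((isInvertible_of_pos (hG.pos z hz)).contDiffAt_map_inverse.comp z
    (hG.contDiffAt hz)).contDiffWithinAt

theorem contDiffOn_fderiv (hG : IsMetricOn G U) : ContDiffOn ℝ ∞ (fderiv ℝ G) U :=
  hG.contDiffOn.fderiv_of_isOpen hG.isOpen (by simp)

theorem contDiffOn_christoffelL (hG : IsMetricOn G U) : ContDiffOn ℝ ∞ (christoffelL G) U := by
  have h1 := hG.contDiffOn_fderiv
  have h2 : ContDiffOn ℝ ∞ (fun z => (fderiv ℝ G z).flip) U :=
    (ContinuousLinearMap.flipₗᵢ ℝ (E d) (E d) (E d →L[ℝ] ℝ)).toContinuousLinearEquiv.contDiff.comp_contDiffOn h1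
  have h3 : ContDiffOn ℝ ∞ (christoffelLowL G) U :=
    ((h1.add h2).sub (contDiffOn_const.clm_comp h2)).const_smul _
  exact ((ContinuousLinearMap.compL ℝ (E d) (E d →L[ℝ] ℝ) (E d)).contDiff.comp_contDiffOn
    hG.contDiffOn_inverse).clm_comp h3

theorem differentiableAt_christoffelL (hG : IsMetricOn G U) (hy : y ∈ U) :
    DifferentiableAt ℝ (christoffelL G) y :=
  (hG.contDiffOn_christoffelL.contDiffAt (hG.mem_nhds hy)).differentiableAt (by simp)

theorem fderiv_symm (hG : IsMetricOn G U) (hy : y ∈ U) (u v w : E d) :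
    fderiv ℝ G y u v w = fderiv ℝ G y u w v := by
  have hd : ∀ v w, HasFDerivAt (fun z => G z v w)
      ((ContinuousLinearMap.apply ℝ ℝ w) ∘L (ContinuousLinearMap.apply ℝ _ v) ∘L fderiv ℝ G y) y := by
    intro v w
    exact (ContinuousLinearMap.apply ℝ ℝ w).hasFDerivAt.comp y
      ((ContinuousLinearMap.apply ℝ (E d →L[ℝ] ℝ) v).hasFDerivAt.comp y
        (hG.differentiableAt hy).hasFDerivAt)
  have h := (hd v w).unique ((hd w v).congr_of_eventuallyEq
    (Filter.eventuallyEq_of_mem (hG.mem_nhds hy) fun z hz => hG.symm z hz v w))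
  simpa using congrArg (fun L => L u) h

theorem christoffel_symm (hG : IsMetricOn G U) (hy : y ∈ U) (u v : E d) :
    christoffel G y u v = christoffel G y v u := by
  unfold christoffel
  congr 1
  ext w
  simp only [christoffelLow_apply, hG.fderiv_symm hy w u v]
  ring

/-- Compatibility of the Levi-Civita connection with the metric. -/
theorem fderiv_apply (hG : IsMetricOn G U) (hy : y ∈ U) (u v w : E d) :
    fderiv ℝ G y u v w = G y (christoffel G y u v) w + G y v (christoffel G y u w) := by
  rw [hG.symm y hy v]
  unfold christoffel
  rw [hG.apply_inverse hy, hG.apply_inverse hy]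
  simp only [christoffelLow_apply]
  rw [hG.fderiv_symm hy u w v]
  ring

/-- The Levi-Civita connection is the only torsion-free metric connection. -/
theorem eq_christoffel (hG : IsMetricOn G U) (hy : y ∈ U) {A : E d → E d → E d}
    (hA : ∀ u v, A u v = A v u)
    (hc : ∀ u v w, fderiv ℝ G y u v w = G y (A u v) w + G y v (A u w)) (u v : E d) :
    christoffel G y u v = A u v := by
  refine eq_of_forall_apply_eq (hG.pos y hy) fun w => ?_
  unfold christoffel
  -- Koszul's argument: compatibility is substituted into the three terms of the Christoffel symbol,
  -- and the symmetry of `A` cancels everything but `2 G(A u v, w)`.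
  rw [hG.apply_inverse hy, christoffelLow_apply, hc, hc, hc, hA w u, hA w v, hA v u,
    hG.symm y hy (A u w) v, hG.symm y hy u (A v w)]
  ring

theorem hasFDerivAt_apply (hG : IsMetricOn G U) (hy : y ∈ U) {a b : E d → E d}
    {a' b' : E d →L[ℝ] E d} (ha : HasFDerivAt a a' y) (hb : HasFDerivAt b b' y) (u : E d) :
    fderiv ℝ (fun z => G z (a z) (b z)) y u
      = fderiv ℝ G y u (a y) (b y) + G y (a' u) (b y) + G y (a y) (b' u) := by
  have h := ((hG.differentiableAt hy).hasFDerivAt.clm_apply ha).clm_apply hb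
  rw [h.fderiv]
  simp
  ring

theorem hasFDerivAt_christoffel (hG : IsMetricOn G U) (hy : y ∈ U) {a b : E d → E d}
    {a' b' : E d →L[ℝ] E d} (ha : HasFDerivAt a a' y) (hb : HasFDerivAt b b' y) (u : E d) :
    fderiv ℝ (fun z => christoffel G z (a z) (b z)) y u
      = fderiv ℝ (christoffelL G) y u (a y) (b y) + christoffel G y (a' u) (b y)
        + christoffel G y (a y) (b' u) := by
  have h := ((hG.differentiableAt_christoffelL hy).hasFDerivAt.clm_apply ha).clm_apply hb
  simp only [christoffelL_apply] at h
  rw [h.fderiv]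
  simp [christoffelL_apply]
  abel

/-- Derivatives of the symbols at fixed vectors become values of the derivative of one
operator-valued map, to which linearity and the symmetry of second derivatives apply. -/
theorem fderiv_christoffel (hG : IsMetricOn G U) (hy : y ∈ U) (u v w : E d) :
    fderiv ℝ (fun z => christoffel G z v w) y u = fderiv ℝ (christoffelL G) y u v w := by
  have := hG.hasFDerivAt_christoffel hy (hasFDerivAt_const v y) (hasFDerivAt_const w y) u
  rw [this]
  simp [← christoffelL_apply]

end IsMetricOn

theorem christoffel_add_left (G : E d → (E d →L[ℝ] E d →L[ℝ] ℝ)) (y u u' v : E d) :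
    christoffel G y (u + u') v = christoffel G y u v + christoffel G y u' v := by
  simp [← christoffelL_apply]

theorem christoffel_smul_left (G : E d → (E d →L[ℝ] E d →L[ℝ] ℝ)) (y : E d) (t : ℝ) (u v : E d) :
    christoffel G y (t • u) v = t • christoffel G y u v := by
  simp [← christoffelL_apply]

theorem christoffel_add_right (G : E d → (E d →L[ℝ] E d →L[ℝ] ℝ)) (y u v v' : E d) :
    christoffel G y u (v + v') = christoffel G y u v + christoffel G y u v' := by
  simp [← christoffelL_apply]

theorem christoffel_smul_right (G : E d → (E d →L[ℝ] E d →L[ℝ] ℝ)) (y : E d) (t : ℝ) (u v : E d) :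
    christoffel G y u (t • v) = t • christoffel G y u v := by
  simp [← christoffelL_apply]

theorem christoffel_sub_right (G : E d → (E d →L[ℝ] E d →L[ℝ] ℝ)) (y u v v' : E d) :
    christoffel G y u (v - v') = christoffel G y u v - christoffel G y u v' := by
  simp [← christoffelL_apply]

/-! ### Curvature as a multilinear map -/

/-- The Riemann curvature as a continuous multilinear map of its three arguments. -/
def riemannL (G : E d → (E d →L[ℝ] E d →L[ℝ] ℝ)) (y : E d) (u v : E d) : E d →L[ℝ] E d :=
  fderiv ℝ (christoffelL G) y u v - fderiv ℝ (christoffelL G) y v u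
    + christoffelL G y u ∘L christoffelL G y v - christoffelL G y v ∘L christoffelL G y u

namespace IsMetricOn

variable {G : E d → (E d →L[ℝ] E d →L[ℝ] ℝ)} {U : Set (E d)} {y : E d}

theorem riemann_eq (hG : IsMetricOn G U) (hy : y ∈ U) (u v w : E d) :
    riemann G y u v w = fderiv ℝ (christoffelL G) y u v w - fderiv ℝ (christoffelL G) y v u w
      + christoffel G y u (christoffel G y v w) - christoffel G y v (christoffel G y u w) := by
  rw [riemann, hG.fderiv_christoffel hy, hG.fderiv_christoffel hy]

theorem riemann_eq_riemannL (hG : IsMetricOn G U) (hy : y ∈ U) (u v w : E d) :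
    riemann G y u v w = riemannL G y u v w := by
  rw [hG.riemann_eq hy]
  simp [riemannL, christoffelL_apply]

theorem riemann_add_left (hG : IsMetricOn G U) (hy : y ∈ U) (u u' v w : E d) :
    riemann G y (u + u') v w = riemann G y u v w + riemann G y u' v w := by
  simp only [hG.riemann_eq_riemannL hy, riemannL, map_add, add_apply, sub_apply,
    ContinuousLinearMap.add_comp, ContinuousLinearMap.comp_add]
  abel

theorem riemann_smul_left (hG : IsMetricOn G U) (hy : y ∈ U) (t : ℝ) (u v w : E d) :
    riemann G y (t • u) v w = t • riemann G y u v w := by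
  simp [hG.riemann_eq_riemannL hy, riemannL]
  module

theorem riemann_swap (u v w : E d) : riemann G y u v w = - riemann G y v u w := by
  simp only [riemann]
  abel

theorem riemann_add_right (hG : IsMetricOn G U) (hy : y ∈ U) (u v w w' : E d) :
    riemann G y u v (w + w') = riemann G y u v w + riemann G y u v w' := by
  simp only [hG.riemann_eq_riemannL hy, map_add]

theorem riemann_smul_right (hG : IsMetricOn G U) (hy : y ∈ U) (t : ℝ) (u v w : E d) :
    riemann G y u v (t • w) = t • riemann G y u v w := by
  simp only [hG.riemann_eq_riemannL hy, map_smul]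

theorem isBilin_ricci (hG : IsMetricOn G U) (hy : y ∈ U) : IsBilin (ricci G y) := by
  constructor
  · intro u u' v
    simp only [ricci, riemann_swap (e _), hG.riemann_add_left hy]
    simp [Finset.sum_add_distrib]
    ring
  · intro t u v
    simp only [ricci, riemann_swap (e _), hG.riemann_smul_left hy]
    simp [Finset.mul_sum]
  · intro u u' v
    simp only [ricci, hG.riemann_add_right hy]
    simp [Finset.sum_add_distrib]
  · intro t u v
    simp only [ricci, hG.riemann_smul_right hy]
    simp [Finset.mul_sum]

/-- The frame may belong to a form `B` other than `G y`. This permits tracing the curvature of a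
rescaled metric in a frame of the original one, and tracing at nearby points in a frozen frame. -/
theorem ricci_eq_sum_frame (hG : IsMetricOn G U) (hy : y ∈ U) {B : E d →L[ℝ] E d →L[ℝ] ℝ}
    {b : Fin d → E d} (hb : IsFrame B b) (v w : E d) :
    ricci G y v w = ∑ i, B (riemann G y (b i) v w) (b i) := by
  let L : E d →ₗ[ℝ] E d :=
    { toFun := fun u => riemann G y u v w
      map_add' := fun a b => hG.riemann_add_left hy a b v w
      map_smul' := fun t a => hG.riemann_smul_left hy t a v w }
  exact trace_eq_sum_frame hb L

theorem isBilin_schouten (hG : IsMetricOn G U) (hy : y ∈ U) : IsBilin (schouten G y) := by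
  have h := ((hG.isBilin_ricci hy).sub ((IsBilin.of_clm (G y)).const_mul (J G y))).mul_const
    ((d : ℝ) - 2)⁻¹
  exact h

/-- Metric trace of the Ricci tensor. -/
theorem metricTrace_ricci (hd : 4 ≤ d) : metricTrace (G y) (ricci G y)
    = 2 * ((d : ℝ) - 1) * J G y := by
  have : (4 : ℝ) ≤ d := by exact_mod_cast hd
  rw [J]
  field_simp [show (d : ℝ) - 1 ≠ 0 by linarith]

theorem ricci_eq (hd : 4 ≤ d) (u v : E d) :
    ricci G y u v = ((d : ℝ) - 2) * schouten G y u v + J G y * G y u v := by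
  have : (4 : ℝ) ≤ d := by exact_mod_cast hd
  rw [schouten]
  field_simp [show (d : ℝ) - 2 ≠ 0 by linarith]
  ring

/-- Tracing `Ric = (d - 2) P + J g` gives `2 (d - 1) J = (d - 2) tr P + d J`. -/
theorem metricTrace_schouten (hd : 4 ≤ d) (hG : IsMetricOn G U) (hy : y ∈ U) :
    metricTrace (G y) (schouten G y) = J G y := by
  have h4 : (4 : ℝ) ≤ d := by exact_mod_cast hd
  have h := metricTrace_ricci (G := G) (y := y) hd
  rw [show ricci G y = fun u v => ((d : ℝ) - 2) * schouten G y u v + J G y * G y u v from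
    funext fun u => funext fun v => ricci_eq hd u v, metricTrace_add, metricTrace_const_mul,
    metricTrace_const_mul, metricTrace_self (hG.symm y hy) (hG.pos y hy)] at h
  have h2 : (d : ℝ) - 2 ≠ 0 := by linarith
  have h3 : metricTrace (G y) (fun u v => schouten G y u v) = J G y := by
    apply mul_left_cancel₀ h2
    linarith
  exact h3

end IsMetricOn

end Coord

namespace Coord

variable {d : ℕ}

/-- Smoothness threshold for the symmetry of second derivatives, used at every such appeal. -/
theorem minSmoothness_two_le : minSmoothness ℝ 2 ≤ (∞ : WithTop ℕ∞) := by
  rw [minSmoothness_of_isRCLikeNormedField]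
  exact WithTop.coe_le_coe.2 (le_top : (2 : ℕ∞) ≤ ⊤)

/-! ### Covectors, Hessians and gradients -/

section Hessian

variable {G : E d → (E d →L[ℝ] E d →L[ℝ] ℝ)} {U : Set (E d)} {y : E d} {F : E d → ℝ}

theorem hessian_eq (G : E d → (E d →L[ℝ] E d →L[ℝ] ℝ)) (F : E d → ℝ) (y u v : E d) :
    hessian G F y u v = fderiv ℝ (fderiv ℝ F) y u v - fderiv ℝ F y (christoffel G y u v) := rfl

theorem isBilin_hessian (G : E d → (E d →L[ℝ] E d →L[ℝ] ℝ)) (F : E d → ℝ) (y : E d) :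
    IsBilin (hessian G F y) := by
  constructor <;> intros <;>
    simp only [hessian_eq, christoffel_add_left, christoffel_smul_left, christoffel_add_right,
      christoffel_smul_right, map_add, map_smul, add_apply, smul_apply, smul_eq_mul] <;> ring

theorem hessian_congr {F' : E d → ℝ} (h : F =ᶠ[nhds y] F') (u v : E d) :
    hessian G F y u v = hessian G F' y u v := by
  rw [hessian_eq, hessian_eq, h.fderiv.fderiv_eq, h.fderiv_eq]

namespace IsMetricOn

theorem contDiffAt_of_on (hG : IsMetricOn G U) (hF : ContDiffOn ℝ ∞ F U) (hy : y ∈ U) :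
    ContDiffAt ℝ ∞ F y :=
  hF.contDiffAt (hG.mem_nhds hy)

theorem contDiffOn_fderiv_fun (hG : IsMetricOn G U) (hF : ContDiffOn ℝ ∞ F U) :
    ContDiffOn ℝ ∞ (fderiv ℝ F) U :=
  hF.fderiv_of_isOpen hG.isOpen (by simp)

theorem differentiableAt_fun (hG : IsMetricOn G U) (hF : ContDiffOn ℝ ∞ F U) (hy : y ∈ U) :
    DifferentiableAt ℝ F y :=
  (hG.contDiffAt_of_on hF hy).differentiableAt (by simp)

theorem differentiableAt_fderiv_fun (hG : IsMetricOn G U) (hF : ContDiffOn ℝ ∞ F U) (hy : y ∈ U) :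
    DifferentiableAt ℝ (fderiv ℝ F) y :=
  ((hG.contDiffOn_fderiv_fun hF).contDiffAt (hG.mem_nhds hy)).differentiableAt (by simp)

/-- The gradient of a function. -/
def _root_.AlmostEinstein.Coord.gradient (G : E d → (E d →L[ℝ] E d →L[ℝ] ℝ)) (F : E d → ℝ)
    (y : E d) : E d :=
  (G y).inverse (fderiv ℝ F y)

theorem apply_gradient (hG : IsMetricOn G U) (hy : y ∈ U) (F : E d → ℝ) (v : E d) :
    G y (gradient G F y) v = fderiv ℝ F y v :=
  hG.apply_inverse hy _ v

theorem apply_gradient' (hG : IsMetricOn G U) (hy : y ∈ U) (F : E d → ℝ) (v : E d) :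
    G y v (gradient G F y) = fderiv ℝ F y v := by
  rw [hG.symm y hy, hG.apply_gradient hy]

theorem contDiffOn_gradient (hG : IsMetricOn G U) (hF : ContDiffOn ℝ ∞ F U) :
    ContDiffOn ℝ ∞ (gradient G F) U :=
  hG.contDiffOn_inverse.clm_apply (hG.contDiffOn_fderiv_fun hF)

theorem differentiableAt_gradient (hG : IsMetricOn G U) (hF : ContDiffOn ℝ ∞ F U) (hy : y ∈ U) :
    DifferentiableAt ℝ (gradient G F) y :=
  ((hG.contDiffOn_gradient hF).contDiffAt (hG.mem_nhds hy)).differentiableAt (by simp)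

theorem fderiv_clm_apply_const {W : Type*} [NormedAddCommGroup W] [NormedSpace ℝ W]
    {A : E d → (E d →L[ℝ] W)} (hA : DifferentiableAt ℝ A y) (u v : E d) :
    fderiv ℝ (fun z => A z v) y u = fderiv ℝ A y u v := by
  rw [(hA.hasFDerivAt.clm_apply (hasFDerivAt_const v y)).fderiv]
  simp

/-- The covariant derivative of the gradient is the Hessian. -/
theorem apply_covDeriv_gradient (hG : IsMetricOn G U) (hF : ContDiffOn ℝ ∞ F U) (hy : y ∈ U)
    (u x : E d) :
    G y (fderiv ℝ (gradient G F) y u + christoffel G y u (gradient G F y)) x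
      = hessian G F y u x := by
  have h1 := hG.hasFDerivAt_apply hy (hG.differentiableAt_gradient hF hy).hasFDerivAt
    (hasFDerivAt_const x y) u
  -- The identity `G(grad F, x) = dF(x)` is differentiated and the derivative of `G` is replaced by
  -- Christoffel terms.
  have h2 : (fun z => G z (gradient G F z) x) =ᶠ[nhds y] fun z => fderiv ℝ F z x :=
    Filter.eventuallyEq_of_mem (hG.mem_nhds hy) fun z hz => hG.apply_gradient hz F x
  rw [h2.fderiv_eq, fderiv_clm_apply_const (hG.differentiableAt_fderiv_fun hF hy),
    hG.fderiv_apply hy, hG.apply_gradient hy] at h1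
  simp only [zero_apply, map_zero, add_zero] at h1
  rw [hessian_eq, h1, map_add, add_apply]
  ring

end IsMetricOn

end Hessian

/-! ### Conformal change of the metric -/

section Conformal

/-- The conformally rescaled metric `e^{2f} G`. -/
def rescale (f : E d → ℝ) (G : E d → (E d →L[ℝ] E d →L[ℝ] ℝ)) (z : E d) :
    E d →L[ℝ] E d →L[ℝ] ℝ :=
  Real.exp (2 * f z) • G z

variable {G : E d → (E d →L[ℝ] E d →L[ℝ] ℝ)} {U : Set (E d)} {y : E d} {f F : E d → ℝ}

namespace IsMetricOn

theorem rescale (hG : IsMetricOn G U) (hf : ContDiffOn ℝ ∞ f U) :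
    IsMetricOn (rescale f G) U where
  isOpen := hG.isOpen
  contDiffOn := (contDiffOn_const.mul hf).exp.smul hG.contDiffOn
  symm z hz u v := by simp [Coord.rescale, hG.symm z hz u v]
  pos z hz u hu := by
    simpa [Coord.rescale] using mul_pos (Real.exp_pos _) (hG.pos z hz u hu)

theorem fderiv_rescale (hG : IsMetricOn G U) (hf : ContDiffOn ℝ ∞ f U) (hy : y ∈ U) (u v w : E d) :
    fderiv ℝ (Coord.rescale f G) y u v w
      = Real.exp (2 * f y) * (2 * fderiv ℝ f y u * G y v w + fderiv ℝ G y u v w) := by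
  have h1 := (((hG.differentiableAt_fun hf hy).hasFDerivAt.const_mul 2).exp).smul
    (hG.differentiableAt hy).hasFDerivAt
  have h2 : fderiv ℝ (Coord.rescale f G) y = _ := h1.fderiv
  rw [h2]
  simp
  ring

/-- By uniqueness of the Levi-Civita connection, only the symmetry of the right side and its
compatibility with `e^{2f} G` have to be checked. -/
theorem christoffel_rescale (hG : IsMetricOn G U) (hf : ContDiffOn ℝ ∞ f U) (hy : y ∈ U)
    (u v : E d) :
    christoffel (Coord.rescale f G) y u v = christoffel G y u v + fderiv ℝ f y u • v
      + fderiv ℝ f y v • u - G y u v • gradient G f y := by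
  refine (hG.rescale hf).eq_christoffel hy (A := fun u v => christoffel G y u v
      + fderiv ℝ f y u • v + fderiv ℝ f y v • u - G y u v • gradient G f y) ?_ ?_ u v
  · intro u v
    rw [hG.christoffel_symm hy u v, hG.symm y hy u v]
    abel
  · intro u v w
    rw [hG.fderiv_rescale hf hy, hG.fderiv_apply hy]
    simp only [Coord.rescale, smul_apply, map_add, map_sub, map_smul, add_apply, sub_apply,
      smul_eq_mul, hG.apply_gradient hy, hG.apply_gradient' hy]
    rw [hG.symm y hy v u]
    ring

/-- The covariant derivative of the gradient of `f`, as an endomorphism. -/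
def _root_.AlmostEinstein.Coord.hessEndo (G : E d → (E d →L[ℝ] E d →L[ℝ] ℝ)) (f : E d → ℝ)
    (y u : E d) : E d :=
  fderiv ℝ (gradient G f) y u + christoffel G y u (gradient G f y)

theorem fderiv_christoffel_rescale (hG : IsMetricOn G U) (hf : ContDiffOn ℝ ∞ f U) (hy : y ∈ U)
    (u v w : E d) :
    fderiv ℝ (fun z => christoffel (Coord.rescale f G) z v w) y u
      = fderiv ℝ (christoffelL G) y u v w + fderiv ℝ (fderiv ℝ f) y u v • w
        + fderiv ℝ (fderiv ℝ f) y u w • v - fderiv ℝ G y u v w • gradient G f y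
        - G y v w • fderiv ℝ (gradient G f) y u := by
  have h1 : (fun z => christoffel (Coord.rescale f G) z v w) =ᶠ[nhds y]
      fun z => christoffelL G z v w + fderiv ℝ f z v • w
        + fderiv ℝ f z w • v - G z v w • gradient G f z :=
    Filter.eventuallyEq_of_mem (hG.mem_nhds hy) fun z hz => by
      simp only [hG.christoffel_rescale hf hz, christoffelL_apply]
  have hΓ := ((hG.differentiableAt_christoffelL hy).hasFDerivAt.clm_apply
    (hasFDerivAt_const v y)).clm_apply (hasFDerivAt_const w y)
  have hU := (hG.differentiableAt_fderiv_fun hf hy).hasFDerivAt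
  have hv := (hU.clm_apply (hasFDerivAt_const v y)).smul (hasFDerivAt_const w y)
  have hw := (hU.clm_apply (hasFDerivAt_const w y)).smul (hasFDerivAt_const v y)
  have hgr := (((hG.differentiableAt hy).hasFDerivAt.clm_apply
    (hasFDerivAt_const v y)).clm_apply (hasFDerivAt_const w y)).smul
      (hG.differentiableAt_gradient hf hy).hasFDerivAt
  rw [h1.fderiv_eq]
  refine (congrArg (fun L => L u) (((hΓ.add hv).add hw).sub hgr).fderiv).trans ?_
  simp
  abel

/-- Conformal change of the Riemann curvature. -/
theorem riemann_rescale (hG : IsMetricOn G U) (hf : ContDiffOn ℝ ∞ f U) (hy : y ∈ U)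
    (u v w : E d) :
    riemann (Coord.rescale f G) y u v w = riemann G y u v w
      + hessian G f y u w • v - hessian G f y v w • u
      - G y v w • hessEndo G f y u + G y u w • hessEndo G f y v
      - (fderiv ℝ f y u * fderiv ℝ f y w) • v + (fderiv ℝ f y v * fderiv ℝ f y w) • u
      - fderiv ℝ f y (gradient G f y) • (G y v w • u - G y u w • v)
      + (fderiv ℝ f y u * G y v w - fderiv ℝ f y v * G y u w) • gradient G f y := by
  have hs := (hG.contDiffAt_of_on hf hy).isSymmSndFDerivAt minSmoothness_two_le
  rw [riemann, hG.fderiv_christoffel_rescale hf hy, hG.fderiv_christoffel_rescale hf hy,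
    hG.riemann_eq hy]
  simp only [hG.christoffel_rescale hf hy, hG.fderiv_apply hy, hs.eq v u, hessian_eq, hessEndo,
    christoffel_add_right, christoffel_sub_right, christoffel_smul_right, map_add, map_sub,
    map_smul, smul_eq_mul, hG.apply_gradient' hy, hG.symm y hy v u, hG.christoffel_symm hy v u]
  rw [hG.symm y hy v (christoffel G y u w), hG.symm y hy u (christoffel G y v w)]
  module

end IsMetricOn

end Conformal

end Coord

/-! ### Conformal change of Ricci, Schouten and the conformal-to-Einstein equation. -/

namespace Coord

variable {d : ℕ}

namespace IsMetricOn

variable {G : E d → (E d →L[ℝ] E d →L[ℝ] ℝ)} {U : Set (E d)} {y : E d} {f F : E d → ℝ}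

/-- Conformal change of the Ricci tensor. -/
theorem ricci_rescale (hG : IsMetricOn G U) (hf : ContDiffOn ℝ ∞ f U) (hy : y ∈ U) (v w : E d) :
    ricci (Coord.rescale f G) y v w = ricci G y v w
      - ((d : ℝ) - 2) * (hessian G f y v w - fderiv ℝ f y v * fderiv ℝ f y w)
      - (metricTrace (G y) (hessian G f y)
          + ((d : ℝ) - 2) * fderiv ℝ f y (gradient G f y)) * G y v w := by
  obtain ⟨b, hb⟩ := hG.exists_isFrame hy
  have hH := isBilin_hessian G f y
  rw [(hG.rescale hf).ricci_eq_sum_frame hy hb, hG.ricci_eq_sum_frame hy hb,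
    metricTrace_eq_sum_frame (hG.pos y hy) hb hH]
  have h1 := sum_frame_mul hb (L := fun u => hessian G f y u w)
    (fun a c => hH.add_left a c w) (fun t a => hH.smul_left t a w) v
  have h2 := sum_frame_mul hb (L := fun u => hessian G f y v u)
    (hH.add_right v) (fun t a => hH.smul_right t v a) w
  have h3 := sum_frame_mul hb (L := fun u => fderiv ℝ f y u) (by simp) (by simp) v
  have h4 := sum_frame_mul hb (L := fun u => fderiv ℝ f y u) (by simp) (by simp) w
  have h5 := sum_frame_mul hb (L := fun u => fderiv ℝ f y u) (by simp) (by simp) (gradient G f y)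
  have h6 := sum_frame_mul hb (L := fun u => G y u w) (by simp) (by simp) v
  have h7 := sum_frame_self hb
  -- Each summand is arranged so that the frame index occurs only in a pattern contracted by `h1` to
  -- `h7`.
  have key : ∀ i, G y (riemann (Coord.rescale f G) y (b i) v w) (b i)
      = G y (riemann G y (b i) v w) (b i) + G y v (b i) * hessian G f y (b i) w
        - hessian G f y v w * G y (b i) (b i) - G y v w * hessian G f y (b i) (b i)
        + G y w (b i) * hessian G f y v (b i)
        - fderiv ℝ f y w * (G y v (b i) * fderiv ℝ f y (b i))
        + (fderiv ℝ f y v * fderiv ℝ f y w) * G y (b i) (b i)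
        - fderiv ℝ f y (gradient G f y) * G y v w * G y (b i) (b i)
        + fderiv ℝ f y (gradient G f y) * (G y v (b i) * G y (b i) w)
        + G y v w * (G y (gradient G f y) (b i) * fderiv ℝ f y (b i))
        - fderiv ℝ f y v * (G y w (b i) * fderiv ℝ f y (b i)) := by
    intro i
    rw [hG.riemann_rescale hf hy]
    simp only [map_add, map_sub, map_smul, add_apply, sub_apply, smul_apply, smul_eq_mul, hessEndo]
    rw [← hG.apply_covDeriv_gradient hf hy (b i) (b i), ← hG.apply_covDeriv_gradient hf hy v (b i)]
    simp only [map_add, add_apply, hG.apply_gradient hy, hG.symm y hy w (b i)]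
    ring
  simp only [key, Finset.sum_add_distrib, Finset.sum_sub_distrib, ← Finset.mul_sum,
    h1, h2, h3, h4, h5, h6, h7]
  ring

/-- Conformal change of `J`. -/
theorem J_rescale (hd : 4 ≤ d) (hG : IsMetricOn G U) (hf : ContDiffOn ℝ ∞ f U) (hy : y ∈ U) :
    J (Coord.rescale f G) y = (Real.exp (2 * f y))⁻¹ * (J G y - metricTrace (G y) (hessian G f y)
      - ((d : ℝ) - 2) / 2 * fderiv ℝ f y (gradient G f y)) := by
  have h4 : (4 : ℝ) ≤ d := by exact_mod_cast hd
  obtain ⟨b, hb⟩ := hG.exists_isFrame hy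
  have h5 := sum_frame_mul hb (L := fun u => fderiv ℝ f y u) (by simp) (by simp) (gradient G f y)
  simp only [hG.apply_gradient hy] at h5
  have h7 := sum_frame_self hb
  have hT := metricTrace_ricci (G := G) (y := y) hd
  have hH := isBilin_hessian G f y
  rw [metricTrace_eq_sum_frame (hG.pos y hy) hb (hG.isBilin_ricci hy)] at hT
  rw [J, Coord.rescale, metricTrace_smul_form (hG.pos y hy) (Real.exp_pos _),
    metricTrace_eq_sum_frame (hG.pos y hy) hb ((hG.rescale hf).isBilin_ricci hy)]
  simp only [hG.ricci_rescale hf hy, Finset.sum_sub_distrib,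
    ← Finset.mul_sum, h5, h7, hT, ← metricTrace_eq_sum_frame (hG.pos y hy) hb hH]
  field_simp [show (d : ℝ) - 1 ≠ 0 by linarith]
  ring

/-- Conformal change of the Schouten tensor. -/
theorem schouten_rescale (hd : 4 ≤ d) (hG : IsMetricOn G U) (hf : ContDiffOn ℝ ∞ f U) (hy : y ∈ U)
    (u v : E d) :
    schouten (Coord.rescale f G) y u v = schouten G y u v - hessian G f y u v
      + fderiv ℝ f y u * fderiv ℝ f y v
      - 1 / 2 * fderiv ℝ f y (gradient G f y) * G y u v := by
  have h4 : (4 : ℝ) ≤ d := by exact_mod_cast hd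
  rw [schouten, hG.ricci_rescale hf hy, hG.J_rescale hd hf hy, schouten]
  simp only [Coord.rescale, smul_apply, smul_eq_mul]
  field_simp [show (d : ℝ) - 2 ≠ 0 by linarith]
  ring

/-- Conformal change of the Hessian. -/
theorem hessian_rescale (hG : IsMetricOn G U) (hf : ContDiffOn ℝ ∞ f U) (hy : y ∈ U)
    (F : E d → ℝ) (u v : E d) :
    hessian (Coord.rescale f G) F y u v = hessian G F y u v - fderiv ℝ f y u * fderiv ℝ F y v
      - fderiv ℝ f y v * fderiv ℝ F y u + G y u v * fderiv ℝ F y (gradient G f y) := by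
  rw [hessian_eq, hG.christoffel_rescale hf hy, hessian_eq]
  simp only [map_add, map_sub, map_smul, smul_eq_mul]
  ring

theorem fderiv_exp_mul (hG : IsMetricOn G U) (hf : ContDiffOn ℝ ∞ f U) (hF : ContDiffOn ℝ ∞ F U)
    (hy : y ∈ U) (u : E d) :
    fderiv ℝ (fun z => Real.exp (f z) * F z) y u
      = Real.exp (f y) * (fderiv ℝ F y u + F y * fderiv ℝ f y u) := by
  have h := (hG.differentiableAt_fun hf hy).hasFDerivAt.exp.mul
    (hG.differentiableAt_fun hF hy).hasFDerivAt
  refine (congrArg (fun L => L u) h.fderiv).trans ?_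
  simp
  ring

theorem hessian_exp_mul (hG : IsMetricOn G U) (hf : ContDiffOn ℝ ∞ f U) (hF : ContDiffOn ℝ ∞ F U)
    (hy : y ∈ U) (u v : E d) :
    hessian G (fun z => Real.exp (f z) * F z) y u v
      = Real.exp (f y) * (hessian G F y u v + fderiv ℝ f y u * fderiv ℝ F y v
        + fderiv ℝ f y v * fderiv ℝ F y u
        + F y * (hessian G f y u v + fderiv ℝ f y u * fderiv ℝ f y v)) := by
  have h1 : fderiv ℝ (fun z => Real.exp (f z) * F z) =ᶠ[nhds y]
      fun z => Real.exp (f z) • (fderiv ℝ F z + F z • fderiv ℝ f z) :=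
    Filter.eventuallyEq_of_mem (hG.mem_nhds hy) fun z hz => by
      ext u
      rw [hG.fderiv_exp_mul hf hF hz u]
      simp [mul_add]
  have hdf := (hG.differentiableAt_fun hf hy).hasFDerivAt
  have hdF := (hG.differentiableAt_fun hF hy).hasFDerivAt
  have hddf := (hG.differentiableAt_fderiv_fun hf hy).hasFDerivAt
  have hddF := (hG.differentiableAt_fderiv_fun hF hy).hasFDerivAt
  have h2 := hdf.exp.smul (hddF.add (hdF.smul hddf))
  have h3 : fderiv ℝ (fderiv ℝ (fun z => Real.exp (f z) * F z)) y u v = _ :=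
    congrArg (fun L : E d →L[ℝ] E d →L[ℝ] ℝ => L u v) (h1.fderiv_eq.trans h2.fderiv)
  rw [hessian_eq, h3, hG.fderiv_exp_mul hf hF hy, hessian_eq, hessian_eq]
  simp
  ring

/-- Conformal change of `∇∇F + P F` for a density `F` of weight one. -/
theorem hessian_add_schouten_rescale (hd : 4 ≤ d) (hG : IsMetricOn G U) (hf : ContDiffOn ℝ ∞ f U)
    (hF : ContDiffOn ℝ ∞ F U) (hy : y ∈ U) (u v : E d) :
    hessian (Coord.rescale f G) (fun z => Real.exp (f z) * F z) y u v
        + schouten (Coord.rescale f G) y u v * (Real.exp (f y) * F y)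
      = Real.exp (f y) * (hessian G F y u v + schouten G y u v * F y
        + G y u v * (fderiv ℝ F y (gradient G f y)
          + 1 / 2 * fderiv ℝ f y (gradient G f y) * F y)) := by
  rw [hG.hessian_rescale hf hy, hG.hessian_exp_mul hf hF hy, hG.schouten_rescale hd hf hy,
    hG.fderiv_exp_mul hf hF hy, hG.fderiv_exp_mul hf hF hy, hG.fderiv_exp_mul hf hF hy]
  ring

end IsMetricOn

/-- The bottom slot `ρ = (Δ - J) F / d` of the tractor associated with `F`. -/
def bottomSlot (G : E d → (E d →L[ℝ] E d →L[ℝ] ℝ)) (F : E d → ℝ) (y : E d) : ℝ :=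
  1 / (d : ℝ) * (laplacian G F y - J G y * F y)

namespace IsMetricOn

variable {G : E d → (E d →L[ℝ] E d →L[ℝ] ℝ)} {U : Set (E d)} {y : E d} {f F : E d → ℝ}

/-- Fixes the normalisation of the bottom slot: the pure trace part of `∇∇F + PF` is `-ρ G`. -/
theorem metricTrace_hessian_add_schouten (hd : 4 ≤ d) (hG : IsMetricOn G U) (hy : y ∈ U)
    (F : E d → ℝ) :
    metricTrace (G y) (fun u v => hessian G F y u v + schouten G y u v * F y)
      = - (d : ℝ) * bottomSlot G F y := by
  have h4 : (4 : ℝ) ≤ d := by exact_mod_cast hd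
  have h := hG.metricTrace_schouten hd hy
  simp only [mul_comm _ (F y)]
  rw [metricTrace_add, metricTrace_const_mul, bottomSlot, laplacian]
  change metricTrace (G y) (hessian G F y) + F y * metricTrace (G y) (schouten G y) = _
  rw [h]
  field_simp
  ring

/-- Turns the trace-free condition into `∇∇F + PF + ρG = 0`, the middle slot of the tractor
connection. -/
theorem traceFreeHessSchouten_eq (hd : 4 ≤ d) (hG : IsMetricOn G U) (hy : y ∈ U)
    (F : E d → ℝ) (u v : E d) :
    traceFreeHessSchouten G F y u v = hessian G F y u v + schouten G y u v * F y
      + bottomSlot G F y * G y u v := by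
  have h4 : (4 : ℝ) ≤ d := by exact_mod_cast hd
  rw [traceFreeHessSchouten, traceFree, hG.metricTrace_hessian_add_schouten hd hy]
  field_simp
  ring

/-- Conformal change of the bottom slot. -/
theorem bottomSlot_rescale (hd : 4 ≤ d) (hG : IsMetricOn G U) (hf : ContDiffOn ℝ ∞ f U)
    (hF : ContDiffOn ℝ ∞ F U) (hy : y ∈ U) :
    bottomSlot (Coord.rescale f G) (fun z => Real.exp (f z) * F z) y
      = Real.exp (- f y) * (bottomSlot G F y - fderiv ℝ F y (gradient G f y)
        - 1 / 2 * fderiv ℝ f y (gradient G f y) * F y) := by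
  have h4 : (4 : ℝ) ≤ d := by exact_mod_cast hd
  have h1 := (hG.rescale hf).metricTrace_hessian_add_schouten hd hy
    (fun z => Real.exp (f z) * F z)
  have h2 := hG.metricTrace_hessian_add_schouten hd hy F
  -- The law for `∇∇F + PF` is traced with the rescaled metric: the trace contributes `e^{-2f}` and
  -- the density `e^f`, so the net factor is `e^{-f}`.
  simp only [hG.hessian_add_schouten_rescale hd hf hF hy] at h1
  rw [Coord.rescale, metricTrace_smul_form (hG.pos y hy) (Real.exp_pos _), metricTrace_const_mul,
    metricTrace_add, h2] at h1
  simp only [mul_comm (G y _ _)] at h1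
  rw [metricTrace_const_mul, metricTrace_self (hG.symm y hy) (hG.pos y hy)] at h1
  have h3 : (Real.exp (2 * f y))⁻¹ = Real.exp (- f y) * Real.exp (- f y) := by
    rw [← Real.exp_neg, ← Real.exp_add]; ring_nf
  have h5 : Real.exp (- f y) * Real.exp (f y) = 1 := by
    rw [← Real.exp_add]; simp
  have h6 : (d : ℝ) ≠ 0 := by linarith
  rw [h3] at h1
  apply mul_left_cancel₀ h6
  linear_combination h1 + Real.exp (- f y) * ((d : ℝ) * (bottomSlot G F y)
    - (d : ℝ) * (fderiv ℝ F y (gradient G f y)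
      + 1 / 2 * fderiv ℝ f y (gradient G f y) * F y)) * h5

/-- The conformal-to-Einstein equation is conformally invariant. -/
theorem traceFreeHessSchouten_rescale (hd : 4 ≤ d) (hG : IsMetricOn G U) (hf : ContDiffOn ℝ ∞ f U)
    (hF : ContDiffOn ℝ ∞ F U) (hy : y ∈ U) (u v : E d) :
    traceFreeHessSchouten (Coord.rescale f G) (fun z => Real.exp (f z) * F z) y u v
      = Real.exp (f y) * traceFreeHessSchouten G F y u v := by
  rw [(hG.rescale hf).traceFreeHessSchouten_eq hd hy, hG.traceFreeHessSchouten_eq hd hy,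
    hG.hessian_add_schouten_rescale hd hf hF hy, hG.bottomSlot_rescale hd hf hF hy]
  have h5 : Real.exp (- f y) * Real.exp (2 * f y) = Real.exp (f y) := by
    rw [← Real.exp_add]; ring_nf
  simp only [Coord.rescale, smul_apply, smul_eq_mul]
  linear_combination (bottomSlot G F y - fderiv ℝ F y (gradient G f y)
        - 1 / 2 * fderiv ℝ f y (gradient G f y) * F y) * G y u v * h5

end IsMetricOn

end Coord

namespace Coord

variable {d : ℕ}

/-! ### Change of coordinates -/

/-- `H` on `V` is the pullback of the metric `G` on `U` by the immersion `ψ`. -/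
structure IsPullback (ψ : E d → E d) (G H : E d → (E d →L[ℝ] E d →L[ℝ] ℝ)) (U V : Set (E d)) :
    Prop where
  left : IsMetricOn H V
  right : IsMetricOn G U
  mapsTo : Set.MapsTo ψ V U
  contDiffOn : ContDiffOn ℝ ∞ ψ V
  injective : ∀ z ∈ V, Function.Injective (fderiv ℝ ψ z)
  eq : ∀ z ∈ V, ∀ u v, H z u v = G (ψ z) (fderiv ℝ ψ z u) (fderiv ℝ ψ z v)

namespace IsPullback

variable {ψ : E d → E d} {G H : E d → (E d →L[ℝ] E d →L[ℝ] ℝ)} {U V : Set (E d)} {y : E d}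
  {F : E d → ℝ}

theorem surjective (h : IsPullback ψ G H U V) (hy : y ∈ V) : Function.Surjective (fderiv ℝ ψ y) :=
  LinearMap.surjective_of_injective (f := (fderiv ℝ ψ y : E d →ₗ[ℝ] E d)) (h.injective y hy)

theorem hasFDerivAt (h : IsPullback ψ G H U V) (hy : y ∈ V) :
    HasFDerivAt ψ (fderiv ℝ ψ y) y :=
  ((h.contDiffOn.contDiffAt (h.left.mem_nhds hy)).differentiableAt (by simp)).hasFDerivAt

theorem contDiffOn_fderiv (h : IsPullback ψ G H U V) : ContDiffOn ℝ ∞ (fderiv ℝ ψ) V :=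
  h.contDiffOn.fderiv_of_isOpen h.left.isOpen (by simp)

theorem contDiffOn_fderiv_fderiv (h : IsPullback ψ G H U V) :
    ContDiffOn ℝ ∞ (fderiv ℝ (fderiv ℝ ψ)) V :=
  h.contDiffOn_fderiv.fderiv_of_isOpen h.left.isOpen (by simp)

theorem hasFDerivAt_fderiv (h : IsPullback ψ G H U V) (hy : y ∈ V) :
    HasFDerivAt (fderiv ℝ ψ) (fderiv ℝ (fderiv ℝ ψ) y) y :=
  ((h.contDiffOn_fderiv.contDiffAt (h.left.mem_nhds hy)).differentiableAt (by simp)).hasFDerivAt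

theorem hasFDerivAt_fderiv_fderiv (h : IsPullback ψ G H U V) (hy : y ∈ V) :
    HasFDerivAt (fderiv ℝ (fderiv ℝ ψ)) (fderiv ℝ (fderiv ℝ (fderiv ℝ ψ)) y) y :=
  ((h.contDiffOn_fderiv_fderiv.contDiffAt (h.left.mem_nhds hy)).differentiableAt
    (by simp)).hasFDerivAt

theorem fderiv_fderiv_symm (h : IsPullback ψ G H U V) (hy : y ∈ V) (u v : E d) :
    fderiv ℝ (fderiv ℝ ψ) y u v = fderiv ℝ (fderiv ℝ ψ) y v u :=
  ((h.contDiffOn.contDiffAt (h.left.mem_nhds hy)).isSymmSndFDerivAt minSmoothness_two_le).eq u v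

theorem fderiv_fderiv_fderiv_symm (h : IsPullback ψ G H U V) (hy : y ∈ V) (u v w : E d) :
    fderiv ℝ (fderiv ℝ (fderiv ℝ ψ)) y u v w = fderiv ℝ (fderiv ℝ (fderiv ℝ ψ)) y v u w :=
  congrArg (fun L : E d →L[ℝ] E d => L w) (((h.contDiffOn_fderiv.contDiffAt
    (h.left.mem_nhds hy)).isSymmSndFDerivAt minSmoothness_two_le).eq u v)

theorem fderiv_metric (h : IsPullback ψ G H U V) (hy : y ∈ V) (u v w : E d) :
    fderiv ℝ H y u v w
      = fderiv ℝ G (ψ y) (fderiv ℝ ψ y u) (fderiv ℝ ψ y v) (fderiv ℝ ψ y w)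
        + G (ψ y) (fderiv ℝ (fderiv ℝ ψ) y u v) (fderiv ℝ ψ y w)
        + G (ψ y) (fderiv ℝ ψ y v) (fderiv ℝ (fderiv ℝ ψ) y u w) := by
  have h1 : (fun z => H z v w) =ᶠ[nhds y]
      fun z => G (ψ z) (fderiv ℝ ψ z v) (fderiv ℝ ψ z w) :=
    Filter.eventuallyEq_of_mem (h.left.mem_nhds hy) fun z hz => h.eq z hz v w
  have h2 := h.left.hasFDerivAt_apply hy (hasFDerivAt_const v y) (hasFDerivAt_const w y) u
  simp only [zero_apply, map_zero, add_zero] at h2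
  have hG := (h.right.differentiableAt (h.mapsTo hy)).hasFDerivAt.comp y (h.hasFDerivAt hy)
  have h3 := (hG.clm_apply ((h.hasFDerivAt_fderiv hy).clm_apply (hasFDerivAt_const v y))).clm_apply
    ((h.hasFDerivAt_fderiv hy).clm_apply (hasFDerivAt_const w y))
  rw [← h2, h1.fderiv_eq]
  refine (congrArg (fun L => L u) h3.fderiv).trans ?_
  simp
  ring

/-- Transformation of the Christoffel symbols under a change of coordinates. -/
theorem fderiv_christoffel (h : IsPullback ψ G H U V) (hy : y ∈ V) (v w : E d) :
    fderiv ℝ ψ y (christoffel H y v w)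
      = christoffel G (ψ y) (fderiv ℝ ψ y v) (fderiv ℝ ψ y w) + fderiv ℝ (fderiv ℝ ψ) y v w := by
  have hy' := h.mapsTo hy
  refine eq_of_forall_apply_eq (h.right.pos _ hy') fun x' => ?_
  obtain ⟨x, rfl⟩ := h.surjective hy x'
  rw [← h.eq y hy, christoffel, h.left.apply_inverse hy, christoffelLow_apply]
  simp only [h.fderiv_metric hy, h.right.fderiv_apply hy', map_add, add_apply]
  set A := fderiv ℝ ψ y
  set D := fderiv ℝ (fderiv ℝ ψ) y
  have hs := h.right.symm _ hy'
  have hc := h.right.christoffel_symm hy'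
  -- Second derivatives of `ψ` occur in all three Koszul terms. By symmetry those differentiated
  -- along `x` cancel, leaving `2 G(D v w, A x)`.
  rw [h.fderiv_fderiv_symm hy w v, h.fderiv_fderiv_symm hy x v, h.fderiv_fderiv_symm hy x w,
    hc (A w) (A v), hc (A x) (A v), hc (A x) (A w), hs (A w), hs (A v) (christoffel _ _ _ _),
    hs (A w) (D v x), hs (A v) (D w x)]
  ring

/-- Derivative of the transformation law of the symbols. The third derivative of `ψ` that appears is
symmetric in `u, v`, hence drops out of the curvature. -/
theorem fderiv_fderiv_christoffel (h : IsPullback ψ G H U V) (hy : y ∈ V) (u v w : E d) :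
    fderiv ℝ ψ y (fderiv ℝ (christoffelL H) y u v w)
      = fderiv ℝ (christoffelL G) (ψ y) (fderiv ℝ ψ y u) (fderiv ℝ ψ y v) (fderiv ℝ ψ y w)
        + christoffel G (ψ y) (fderiv ℝ (fderiv ℝ ψ) y u v) (fderiv ℝ ψ y w)
        + christoffel G (ψ y) (fderiv ℝ ψ y v) (fderiv ℝ (fderiv ℝ ψ) y u w)
        + fderiv ℝ (fderiv ℝ (fderiv ℝ ψ)) y u v w
        - fderiv ℝ (fderiv ℝ ψ) y u (christoffel H y v w) := by
  have h1 : (fun z => fderiv ℝ ψ z (christoffelL H z v w)) =ᶠ[nhds y]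
      fun z => christoffelL G (ψ z) (fderiv ℝ ψ z v) (fderiv ℝ ψ z w)
        + fderiv ℝ (fderiv ℝ ψ) z v w :=
    Filter.eventuallyEq_of_mem (h.left.mem_nhds hy) fun z hz => by
      simp only [christoffelL_apply, h.fderiv_christoffel hz]
  have hA := h.hasFDerivAt_fderiv hy
  have hl := hA.clm_apply ((((h.left.differentiableAt_christoffelL hy).hasFDerivAt).clm_apply
    (hasFDerivAt_const v y)).clm_apply (hasFDerivAt_const w y))
  have hΓ := (h.right.differentiableAt_christoffelL (h.mapsTo hy)).hasFDerivAt.comp y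
    (h.hasFDerivAt hy)
  have hr := ((hΓ.clm_apply (hA.clm_apply (hasFDerivAt_const v y))).clm_apply
    (hA.clm_apply (hasFDerivAt_const w y))).add
      (((h.hasFDerivAt_fderiv_fderiv hy).clm_apply (hasFDerivAt_const v y)).clm_apply
        (hasFDerivAt_const w y))
  have key := congrArg (fun L : E d →L[ℝ] E d => L u)
    ((hl.fderiv.symm.trans h1.fderiv_eq).trans hr.fderiv)
  simp [christoffelL_apply] at key
  rw [eq_sub_iff_add_eq, key]
  abel

/-- Naturality of the Riemann curvature. -/
theorem fderiv_riemann (h : IsPullback ψ G H U V) (hy : y ∈ V) (u v w : E d) :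
    fderiv ℝ ψ y (riemann H y u v w)
      = riemann G (ψ y) (fderiv ℝ ψ y u) (fderiv ℝ ψ y v) (fderiv ℝ ψ y w) := by
  rw [h.left.riemann_eq hy, h.right.riemann_eq (h.mapsTo hy)]
  simp only [map_add, map_sub, h.fderiv_fderiv_christoffel hy, h.fderiv_christoffel hy,
    christoffel_add_right]
  rw [h.fderiv_fderiv_fderiv_symm hy u v w, h.fderiv_fderiv_symm hy u v]
  abel

theorem isFrame (h : IsPullback ψ G H U V) (hy : y ∈ V) {b : Fin d → E d} (hb : IsFrame (H y) b) :
    IsFrame (G (ψ y)) (fun i => fderiv ℝ ψ y (b i)) := by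
  intro w
  obtain ⟨x, rfl⟩ := h.surjective hy w
  conv_rhs => rw [← hb x]
  simp [h.eq y hy]

/-- Naturality of the Ricci tensor. -/
theorem ricci_eq (h : IsPullback ψ G H U V) (hy : y ∈ V) (u v : E d) :
    ricci H y u v = ricci G (ψ y) (fderiv ℝ ψ y u) (fderiv ℝ ψ y v) := by
  obtain ⟨b, hb⟩ := h.left.exists_isFrame hy
  rw [h.left.ricci_eq_sum_frame hy hb, h.right.ricci_eq_sum_frame (h.mapsTo hy) (h.isFrame hy hb)]
  simp only [h.eq y hy, h.fderiv_riemann hy]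

/-- Naturality of the metric trace. -/
theorem metricTrace_eq (h : IsPullback ψ G H U V) (hy : y ∈ V) {S T : E d → E d → ℝ}
    (hS : IsBilin S) (hT : IsBilin T)
    (hST : ∀ u v, S u v = T (fderiv ℝ ψ y u) (fderiv ℝ ψ y v)) :
    metricTrace (H y) S = metricTrace (G (ψ y)) T := by
  obtain ⟨b, hb⟩ := h.left.exists_isFrame hy
  rw [metricTrace_eq_sum_frame (h.left.pos y hy) hb hS,
    metricTrace_eq_sum_frame (h.right.pos _ (h.mapsTo hy)) (h.isFrame hy hb) hT]
  simp only [hST]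

theorem J_eq (h : IsPullback ψ G H U V) (hy : y ∈ V) : J H y = J G (ψ y) := by
  rw [J, J, h.metricTrace_eq hy (h.left.isBilin_ricci hy) (h.right.isBilin_ricci (h.mapsTo hy))
    (h.ricci_eq hy)]

theorem schouten_eq (h : IsPullback ψ G H U V) (hy : y ∈ V) (u v : E d) :
    schouten H y u v = schouten G (ψ y) (fderiv ℝ ψ y u) (fderiv ℝ ψ y v) := by
  rw [schouten, schouten, h.ricci_eq hy, h.J_eq hy, h.eq y hy]

/-- Naturality of the Hessian. -/
theorem hessian_eq (h : IsPullback ψ G H U V) (hF : ContDiffOn ℝ ∞ F U) (hy : y ∈ V) (u v : E d) :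
    hessian H (F ∘ ψ) y u v = hessian G F (ψ y) (fderiv ℝ ψ y u) (fderiv ℝ ψ y v) := by
  have h1 : ∀ z ∈ V, HasFDerivAt (F ∘ ψ) (fderiv ℝ F (ψ z) ∘L fderiv ℝ ψ z) z := fun z hz =>
    (h.right.differentiableAt_fun hF (h.mapsTo hz)).hasFDerivAt.comp z (h.hasFDerivAt hz)
  have h2 : fderiv ℝ (F ∘ ψ) =ᶠ[nhds y] fun z => fderiv ℝ F (ψ z) ∘L fderiv ℝ ψ z :=
    Filter.eventuallyEq_of_mem (h.left.mem_nhds hy) fun z hz => (h1 z hz).fderiv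
  have h3 := ((h.right.differentiableAt_fderiv_fun hF (h.mapsTo hy)).hasFDerivAt.comp y
    (h.hasFDerivAt hy)).clm_comp (h.hasFDerivAt_fderiv hy)
  have h4 := congrArg (fun L : E d →L[ℝ] E d →L[ℝ] ℝ => L u v) (h2.fderiv_eq.trans h3.fderiv)
  rw [Coord.hessian_eq, Coord.hessian_eq, (h1 y hy).fderiv, ContinuousLinearMap.comp_apply,
    h.fderiv_christoffel hy]
  refine (congrArg (· - _) h4).trans ?_
  simp
  ring

theorem laplacian_eq (h : IsPullback ψ G H U V) (hF : ContDiffOn ℝ ∞ F U) (hy : y ∈ V) :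
    laplacian H (F ∘ ψ) y = laplacian G F (ψ y) := by
  rw [laplacian, laplacian, h.metricTrace_eq hy (isBilin_hessian _ _ _) (isBilin_hessian _ _ _)
    (h.hessian_eq hF hy)]

theorem bottomSlot_eq (h : IsPullback ψ G H U V) (hF : ContDiffOn ℝ ∞ F U) (hy : y ∈ V) :
    bottomSlot H (F ∘ ψ) y = bottomSlot G F (ψ y) := by
  rw [bottomSlot, bottomSlot, h.laplacian_eq hF hy, h.J_eq hy, Function.comp_apply]

theorem traceFreeHessSchouten_eq (hd : 4 ≤ d) (h : IsPullback ψ G H U V) (hF : ContDiffOn ℝ ∞ F U)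
    (hy : y ∈ V) (u v : E d) :
    traceFreeHessSchouten H (F ∘ ψ) y u v
      = traceFreeHessSchouten G F (ψ y) (fderiv ℝ ψ y u) (fderiv ℝ ψ y v) := by
  rw [h.left.traceFreeHessSchouten_eq hd hy, h.right.traceFreeHessSchouten_eq hd (h.mapsTo hy),
    h.hessian_eq hF hy, h.schouten_eq hy, h.bottomSlot_eq hF hy, h.eq y hy, Function.comp_apply]

end IsPullback

end Coord

namespace Coord

variable {d : ℕ}

/-! ### Smoothness of curvature -/

namespace IsMetricOn

variable {G : E d → (E d →L[ℝ] E d →L[ℝ] ℝ)} {U : Set (E d)} {y : E d} {F : E d → ℝ}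

theorem contDiffOn_christoffel (hG : IsMetricOn G U) (u v : E d) :
    ContDiffOn ℝ ∞ (fun z => christoffel G z u v) U := by
  simp only [← christoffelL_apply]
  exact (hG.contDiffOn_christoffelL.clm_apply contDiffOn_const).clm_apply contDiffOn_const

theorem contDiffOn_fderiv_christoffelL (hG : IsMetricOn G U) :
    ContDiffOn ℝ ∞ (fderiv ℝ (christoffelL G)) U :=
  hG.contDiffOn_christoffelL.fderiv_of_isOpen hG.isOpen (by simp)

theorem contDiffOn_riemann (hG : IsMetricOn G U) (u v w : E d) :
    ContDiffOn ℝ ∞ (fun z => riemann G z u v w) U := by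
  have h1 := fun a b c : E d => ((hG.contDiffOn_fderiv_christoffelL.clm_apply
    (contDiffOn_const (c := a))).clm_apply (contDiffOn_const (c := b))).clm_apply
      (contDiffOn_const (c := c))
  have h2 := fun a b c : E d => (hG.contDiffOn_christoffelL.clm_apply
    (contDiffOn_const (c := a))).clm_apply (hG.contDiffOn_christoffel b c)
  refine ((((h1 u v w).sub (h1 v u w)).add (h2 u v w)).sub (h2 v u w)).congr fun z hz => ?_
  simp only [hG.riemann_eq hz, christoffelL_apply]

theorem contDiffOn_ricci (hG : IsMetricOn G U) (u v : E d) :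
    ContDiffOn ℝ ∞ (fun z => ricci G z u v) U := by
  unfold ricci
  exact ContDiffOn.sum fun i _ =>
    (EuclideanSpace.proj i : E d →L[ℝ] ℝ).contDiff.comp_contDiffOn (hG.contDiffOn_riemann _ _ _)

theorem contDiffOn_raised (hG : IsMetricOn G U) (α : E d →L[ℝ] ℝ) :
    ContDiffOn ℝ ∞ (fun z => (G z).inverse α) U :=
  hG.contDiffOn_inverse.clm_apply contDiffOn_const

theorem contDiffOn_metricTrace (hG : IsMetricOn G U) {T : E d → E d → E d → ℝ}
    (hT : ∀ u v, ContDiffOn ℝ ∞ (fun z => T z u v) U) :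
    ContDiffOn ℝ ∞ (fun z => metricTrace (G z) (T z)) U := by
  unfold metricTrace
  exact ContDiffOn.sum fun i _ => ContDiffOn.sum fun j _ =>
    ((EuclideanSpace.proj i : E d →L[ℝ] ℝ).contDiff.comp_contDiffOn
      (hG.contDiffOn_raised (EuclideanSpace.proj j))).mul (hT _ _)

theorem contDiffOn_J (hG : IsMetricOn G U) : ContDiffOn ℝ ∞ (J G) U :=
  (hG.contDiffOn_metricTrace hG.contDiffOn_ricci).div_const _

theorem contDiffOn_apply (hG : IsMetricOn G U) (u v : E d) :
    ContDiffOn ℝ ∞ (fun z => G z u v) U :=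
  (hG.contDiffOn.clm_apply contDiffOn_const).clm_apply contDiffOn_const

theorem contDiffOn_schouten (hG : IsMetricOn G U) (u v : E d) :
    ContDiffOn ℝ ∞ (fun z => schouten G z u v) U :=
  ((hG.contDiffOn_ricci u v).sub (hG.contDiffOn_J.mul (hG.contDiffOn_apply u v))).div_const _

theorem contDiffOn_hessian (hG : IsMetricOn G U) (hF : ContDiffOn ℝ ∞ F U) (u v : E d) :
    ContDiffOn ℝ ∞ (fun z => hessian G F z u v) U := by
  have h1 := hG.contDiffOn_fderiv_fun hF
  have h2 : ContDiffOn ℝ ∞ (fderiv ℝ (fderiv ℝ F)) U := h1.fderiv_of_isOpen hG.isOpen (by simp)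
  exact ((h2.clm_apply contDiffOn_const).clm_apply contDiffOn_const).sub
    (h1.clm_apply (hG.contDiffOn_christoffel u v))

theorem contDiffOn_bottomSlot (hG : IsMetricOn G U) (hF : ContDiffOn ℝ ∞ F U) :
    ContDiffOn ℝ ∞ (bottomSlot G F) U :=
  contDiffOn_const.mul (((hG.contDiffOn_metricTrace (hG.contDiffOn_hessian hF)).neg).sub
    (hG.contDiffOn_J.mul hF))

theorem hasFDerivAt_of_on {W : Type*} [NormedAddCommGroup W] [NormedSpace ℝ W] {f : E d → W}
    (hG : IsMetricOn G U) (hf : ContDiffOn ℝ ∞ f U) (hy : y ∈ U) :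
    HasFDerivAt f (fderiv ℝ f y) y :=
  ((hf.contDiffAt (hG.mem_nhds hy)).differentiableAt (by simp)).hasFDerivAt

end IsMetricOn

/-! ### Covariant derivatives of two-tensors -/

/-- The covariant derivative `(∇_x T)(u, v)` of a two-tensor. -/
def covDeriv₂ (G : E d → (E d →L[ℝ] E d →L[ℝ] ℝ)) (T : E d → E d → E d → ℝ) (y x u v : E d) : ℝ :=
  fderiv ℝ (fun z => T z u v) y x - T y (christoffel G y x u) v - T y u (christoffel G y x v)

/-- The covariant derivative `(∇_x R)(u, v) w` of the Riemann curvature. -/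
def covDerivRiemann (G : E d → (E d →L[ℝ] E d →L[ℝ] ℝ)) (y x u v w : E d) : E d :=
  fderiv ℝ (fun z => riemann G z u v w) y x + christoffel G y x (riemann G y u v w)
    - riemann G y (christoffel G y x u) v w - riemann G y u (christoffel G y x v) w
    - riemann G y u v (christoffel G y x w)

namespace IsMetricOn

variable {G : E d → (E d →L[ℝ] E d →L[ℝ] ℝ)} {U : Set (E d)} {y : E d} {F : E d → ℝ}

/-- The tensor is unbundled, so bilinearity has to be carried through the derivative before
`covDeriv₂` can be traced in a frame. -/
theorem isBilin_covDeriv₂ (hG : IsMetricOn G U) (hy : y ∈ U) {T : E d → E d → E d → ℝ}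
    (hT : ∀ z ∈ U, IsBilin (T z)) (hs : ∀ u v, ContDiffOn ℝ ∞ (fun z => T z u v) U) (x : E d) :
    IsBilin (covDeriv₂ G T y x) := by
  have hd := fun u v => hG.hasFDerivAt_of_on (hs u v) hy
  have h1 : IsBilin fun u v => fderiv ℝ (fun z => T z u v) y x := by
    constructor
    · intro u u' v
      have h : (fun z => T z (u + u') v) =ᶠ[nhds y] fun z => T z u v + T z u' v :=
        Filter.eventuallyEq_of_mem (hG.mem_nhds hy) fun z hz => (hT z hz).add_left u u' v
      rw [h.fderiv_eq]
      exact congrArg (fun L => L x) ((hd u v).add (hd u' v)).fderiv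
    · intro t u v
      have h : (fun z => T z (t • u) v) =ᶠ[nhds y] fun z => t * T z u v :=
        Filter.eventuallyEq_of_mem (hG.mem_nhds hy) fun z hz => (hT z hz).smul_left t u v
      rw [h.fderiv_eq]
      exact congrArg (fun L => L x) ((hd u v).const_mul t).fderiv
    · intro u v v'
      have h : (fun z => T z u (v + v')) =ᶠ[nhds y] fun z => T z u v + T z u v' :=
        Filter.eventuallyEq_of_mem (hG.mem_nhds hy) fun z hz => (hT z hz).add_right u v v'
      rw [h.fderiv_eq]
      exact congrArg (fun L => L x) ((hd u v).add (hd u v')).fderiv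
    · intro t u v
      have h : (fun z => T z u (t • v)) =ᶠ[nhds y] fun z => t * T z u v :=
        Filter.eventuallyEq_of_mem (hG.mem_nhds hy) fun z hz => (hT z hz).smul_right t u v
      rw [h.fderiv_eq]
      exact congrArg (fun L => L x) ((hd u v).const_mul t).fderiv
  have h2 := (hT y hy).comp_left (christoffelL G y x)
  have h3 := (hT y hy).comp_right (christoffelL G y x)
  simp only [christoffelL_apply] at h2 h3
  exact (h1.sub h2).sub h3

/-- The metric trace commutes with covariant differentiation. -/
theorem fderiv_metricTrace (hG : IsMetricOn G U) (hy : y ∈ U) {T : E d → E d → E d → ℝ}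
    (hT : IsBilin (T y)) (hs : ∀ u v, ContDiffOn ℝ ∞ (fun z => T z u v) U) (x : E d) :
    fderiv ℝ (fun z => metricTrace (G z) (T z)) y x
      = metricTrace (G y) (covDeriv₂ G T y x) := by
  obtain ⟨b, hb⟩ := hG.exists_isFrame hy
  set n : Fin d → E d → E d := fun j z => (G z).inverse (EuclideanSpace.proj j : E d →L[ℝ] ℝ)
    with hn
  have hnd : ∀ j, HasFDerivAt (n j) (fderiv ℝ (n j) y) y := fun j =>
    hG.hasFDerivAt_of_on (hG.contDiffOn_raised _) hy
  have hd := fun u v => hG.hasFDerivAt_of_on (hs u v) hy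
  have h1 := HasFDerivAt.fun_sum (u := Finset.univ) fun (i : Fin d) _ =>
    HasFDerivAt.fun_sum (u := Finset.univ) fun (j : Fin d) _ =>
    ((EuclideanSpace.proj i : E d →L[ℝ] ℝ).hasFDerivAt.comp y (hnd j)).mul (hd (e i) (e j))
  have h2 : fderiv ℝ (fun z => metricTrace (G z) (T z)) y x
      = ∑ j, T y (fderiv ℝ (n j) y x) (e j)
        + metricTrace (G y) (fun u v => fderiv ℝ (fun z => T z u v) y x) := by
    refine (congrArg (fun L => L x) h1.fderiv).trans ?_
    have h3 : ∀ j, T y (fderiv ℝ (n j) y x) (e j)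
        = ∑ i, fderiv ℝ (n j) y x i * T y (e i) (e j) := fun j => by
      conv_lhs => rw [← sum_apply_smul_e (fderiv ℝ (n j) y x)]
      rw [hT.sum_left]
      simp only [hT.smul_left]
    simp only [h3, metricTrace]
    rw [Finset.sum_comm (f := fun j i => fderiv ℝ (n j) y x i * T y (e i) (e j)),
      ← Finset.sum_add_distrib]
    simp only [sum_apply, ← Finset.sum_add_distrib]
    refine Finset.sum_congr rfl fun i _ => Finset.sum_congr rfl fun j _ => ?_
    simp [hn]
    ring
  -- Since `G(n_j, w) = w_j` is constant along the chart, differentiating it determines the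
  -- derivative of the raised coordinate covector, that is, of the inverse metric.
  have h4 : ∀ j w, G y (fderiv ℝ (n j) y x) w
      = - G y (christoffel G y x (n j y)) w - christoffel G y x w j := by
    intro j w
    have h5 : (fun z => G z (n j z) w) =ᶠ[nhds y] fun _ => w j :=
      Filter.eventuallyEq_of_mem (hG.mem_nhds hy) fun z hz => hG.apply_inverse hz _ w
    have h6 := hG.hasFDerivAt_apply hy (hnd j) (hasFDerivAt_const w y) x
    have h7 : G y (n j y) (christoffel G y x w) = christoffel G y x w j :=
      hG.apply_inverse hy _ _
    rw [h5.fderiv_eq, hG.fderiv_apply hy, h7] at h6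
    simp at h6
    linarith
  have h8 : ∀ j, fderiv ℝ (n j) y x
      = - christoffel G y x (n j y) - ∑ i, christoffel G y x (b i) j • b i := by
    intro j
    refine eq_of_forall_apply_eq (hG.pos y hy) fun w => ?_
    rw [h4]
    simp only [map_sub, map_neg, map_sum, map_smul, sub_apply, neg_apply, sum_apply, smul_apply,
      smul_eq_mul]
    congr 1
    have := sum_frame_mul hb (L := fun u => christoffel G y x u j)
      (fun u v => by simp [christoffel_add_right]) (fun t u => by simp [christoffel_smul_right]) w
    rw [← this]
    exact Finset.sum_congr rfl fun i _ => by rw [hG.symm y hy (b i) w, mul_comm]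
  -- The derivative of the inverse metric supplies exactly the two Christoffel corrections in
  -- `covDeriv₂`.
  have h9 : ∑ j, T y (fderiv ℝ (n j) y x) (e j)
      = - metricTrace (G y) (fun u v => T y (christoffel G y x u) v)
        - metricTrace (G y) (fun u v => T y u (christoffel G y x v)) := by
    have h2 := hT.comp_left (christoffelL G y x)
    have h3 := hT.comp_right (christoffelL G y x)
    simp only [christoffelL_apply] at h2 h3
    rw [metricTrace_eq_sum_raised h2, metricTrace_eq_sum_frame (hG.pos y hy) hb h3]
    have h10 : ∀ j, T y (fderiv ℝ (n j) y x) (e j) = - T y (christoffel G y x (n j y)) (e j)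
        - ∑ i, christoffel G y x (b i) j * T y (b i) (e j) := by
      intro j
      rw [h8, sub_eq_add_neg, hT.add_left, ← neg_one_smul ℝ (∑ i, _), hT.smul_left, hT.sum_left,
        ← neg_one_smul ℝ (christoffel G y x (n j y)), hT.smul_left]
      simp only [hT.smul_left]
      ring
    simp only [h10, Finset.sum_sub_distrib, Finset.sum_neg_distrib]
    rw [Finset.sum_comm]
    congr 1
    refine Finset.sum_congr rfl fun i _ => ?_
    conv_rhs => rw [← sum_apply_smul_e (christoffel G y x (b i))]
    rw [hT.sum_right]
    simp only [hT.smul_right]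
  rw [h2, h9]
  change _ = metricTrace (G y) (fun u v => fderiv ℝ (fun z => T z u v) y x
    - T y (christoffel G y x u) v - T y u (christoffel G y x v))
  rw [metricTrace_sub, metricTrace_sub]
  ring

/-! ### The Bianchi identities -/

theorem fderiv_riemann (hG : IsMetricOn G U) (hy : y ∈ U) (x u v w : E d) :
    fderiv ℝ (fun z => riemann G z u v w) y x
      = fderiv ℝ (fderiv ℝ (christoffelL G)) y x u v w
        - fderiv ℝ (fderiv ℝ (christoffelL G)) y x v u w
        + fderiv ℝ (christoffelL G) y x u (christoffel G y v w)
        + christoffel G y u (fderiv ℝ (christoffelL G) y x v w)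
        - fderiv ℝ (christoffelL G) y x v (christoffel G y u w)
        - christoffel G y v (fderiv ℝ (christoffelL G) y x u w) := by
  have hD := hG.hasFDerivAt_of_on hG.contDiffOn_fderiv_christoffelL hy
  have hC := hG.hasFDerivAt_of_on hG.contDiffOn_christoffelL hy
  have h1 := fun a b c : E d => ((hD.clm_apply (hasFDerivAt_const a y)).clm_apply
    (hasFDerivAt_const b y)).clm_apply (hasFDerivAt_const c y)
  have h2 := fun a b c : E d => (hC.clm_apply (hasFDerivAt_const a y)).clm_apply
    ((hC.clm_apply (hasFDerivAt_const b y)).clm_apply (hasFDerivAt_const c y))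
  have h3 : (fun z => riemann G z u v w) =ᶠ[nhds y] fun z => fderiv ℝ (christoffelL G) z u v w
      - fderiv ℝ (christoffelL G) z v u w + christoffelL G z u (christoffelL G z v w)
      - christoffelL G z v (christoffelL G z u w) :=
    Filter.eventuallyEq_of_mem (hG.mem_nhds hy) fun z hz => by
      simp only [hG.riemann_eq hz, christoffelL_apply]
  rw [h3.fderiv_eq]
  refine (congrArg (fun L => L x)
    ((((h1 u v w).sub (h1 v u w)).add (h2 u v w)).sub (h2 v u w)).fderiv).trans ?_
  simp [christoffelL_apply]
  abel

/-- The second Bianchi identity. -/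
theorem bianchi (hG : IsMetricOn G U) (hy : y ∈ U) (x u v w : E d) :
    covDerivRiemann G y x u v w + covDerivRiemann G y u v x w + covDerivRiemann G y v x u w
      = 0 := by
  -- Symmetry of the second derivative of the Christoffel map removes the terms of top order;
  -- symmetry of the symbols pairs off the corrections in the two form arguments.
  have hs := fun a b c => congrArg (fun L : E d →L[ℝ] E d →L[ℝ] E d => L c w)
    (((hG.contDiffOn_christoffelL.contDiffAt (hG.mem_nhds hy)).isSymmSndFDerivAt
      minSmoothness_two_le).eq a b)
  have hc := hG.christoffel_symm hy
  simp only [covDerivRiemann, hG.fderiv_riemann hy, hG.riemann_eq hy, christoffel_add_right,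
    christoffel_sub_right]
  rw [hs x u v, hs v x u, hs u v x, hc u x, hc v x, hc v u]
  abel

/-- The Riemann curvature is skew with respect to the metric. -/
theorem apply_riemann_skew (hG : IsMetricOn G U) (hy : y ∈ U) (u v w x : E d) :
    G y (riemann G y u v w) x + G y w (riemann G y u v x) = 0 := by
  have hD := hG.hasFDerivAt_of_on hG.contDiffOn_fderiv hy
  have hC := fun c => hG.hasFDerivAt_of_on (hG.contDiffOn_christoffel v c) hy
  -- Second derivatives of `G` are computed by using metric compatibility twice. Their symmetry in
  -- `a, b` is the skewness of the curvature.
  have key : ∀ a b, fderiv ℝ (fderiv ℝ G) y a b w x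
      = G y (christoffel G y a (christoffel G y b w)) x + G y (christoffel G y b w) (christoffel G y a x)
        + G y (fderiv ℝ (christoffelL G) y a b w) x
        + G y (christoffel G y a w) (christoffel G y b x) + G y w (christoffel G y a (christoffel G y b x))
        + G y w (fderiv ℝ (christoffelL G) y a b x) := by
    intro a b
    have h1 : (fun z => fderiv ℝ G z b w x) =ᶠ[nhds y]
        fun z => G z (christoffel G z b w) x + G z w (christoffel G z b x) :=
      Filter.eventuallyEq_of_mem (hG.mem_nhds hy) fun z hz => hG.fderiv_apply hz b w x
    have h2 := ((hD.clm_apply (hasFDerivAt_const b y)).clm_apply (hasFDerivAt_const w y)).clm_apply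
      (hasFDerivAt_const x y)
    have hC := fun c => hG.hasFDerivAt_of_on (hG.contDiffOn_christoffel b c) hy
    have h3 := hG.hasFDerivAt_apply hy (hC w) (hasFDerivAt_const x y) a
    have h4 := hG.hasFDerivAt_apply hy (hasFDerivAt_const w y) (hC x) a
    have h5 : DifferentiableAt ℝ (fun z => G z (christoffel G z b w) x) y :=
      (((hG.differentiableAt hy).hasFDerivAt.clm_apply (hC w)).clm_apply
        (hasFDerivAt_const x y)).differentiableAt
    have h6 : DifferentiableAt ℝ (fun z => G z w (christoffel G z b x)) y :=
      (((hG.differentiableAt hy).hasFDerivAt.clm_apply (hasFDerivAt_const w y)).clm_apply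
        (hC x)).differentiableAt
    have h7 := congrArg (fun L : E d →L[ℝ] ℝ => L a) ((h2.fderiv.symm.trans h1.fderiv_eq).trans
      (fderiv_fun_add h5 h6))
    simp only [add_apply, h3, h4, hG.fderiv_apply hy, hG.fderiv_christoffel hy] at h7
    simp at h7
    rw [h7]
    ring
  have hs := congrArg (fun L : E d →L[ℝ] E d →L[ℝ] ℝ => L w x)
    (((hG.contDiffAt hy).isSymmSndFDerivAt minSmoothness_two_le).eq u v)
  simp only [key] at hs
  simp only [hG.riemann_eq hy, map_add, map_sub, add_apply, sub_apply]
  linarith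

/-- Derivative of `apply_riemann_skew`; the Christoffel corrections cancel by the same skewness with
one argument replaced by its Christoffel term. -/
theorem apply_covDerivRiemann_skew (hG : IsMetricOn G U) (hy : y ∈ U) (a u v w x : E d) :
    G y (covDerivRiemann G y a u v w) x + G y w (covDerivRiemann G y a u v x) = 0 := by
  have hR := fun c => hG.hasFDerivAt_of_on (hG.contDiffOn_riemann u v c) hy
  have h1 : (fun z => G z (riemann G z u v w) x + G z w (riemann G z u v x)) =ᶠ[nhds y]
      fun _ => (0 : ℝ) :=
    Filter.eventuallyEq_of_mem (hG.mem_nhds hy) fun z hz => hG.apply_riemann_skew hz u v w x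
  have h3 := hG.hasFDerivAt_apply hy (hR w) (hasFDerivAt_const x y) a
  have h4 := hG.hasFDerivAt_apply hy (hasFDerivAt_const w y) (hR x) a
  have h5 : DifferentiableAt ℝ (fun z => G z (riemann G z u v w) x) y :=
    (((hG.differentiableAt hy).hasFDerivAt.clm_apply (hR w)).clm_apply
      (hasFDerivAt_const x y)).differentiableAt
  have h6 : DifferentiableAt ℝ (fun z => G z w (riemann G z u v x)) y :=
    (((hG.differentiableAt hy).hasFDerivAt.clm_apply (hasFDerivAt_const w y)).clm_apply
      (hR x)).differentiableAt
  have h7 := congrArg (fun L : E d →L[ℝ] ℝ => L a) (h1.fderiv_eq.symm.trans (fderiv_fun_add h5 h6))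
  simp only [add_apply, h3, h4, hG.fderiv_apply hy] at h7
  simp at h7
  simp only [covDerivRiemann, map_add, map_sub, add_apply, sub_apply]
  linarith [hG.apply_riemann_skew hy (christoffel G y a u) v w x,
    hG.apply_riemann_skew hy u (christoffel G y a v) w x,
    hG.apply_riemann_skew hy u v (christoffel G y a w) x,
    hG.apply_riemann_skew hy u v w (christoffel G y a x)]

end IsMetricOn

end Coord

/-! ### Contracted Bianchi identities. -/

namespace Coord

variable {d : ℕ}

/-- Cyclicity of the trace, `tr (KL) = tr (LK)`, obtained by expanding both sides in the frame. -/
theorem sum_frame_comm {B : E d →L[ℝ] E d →L[ℝ] ℝ} {b : Fin d → E d} (hb : IsFrame B b)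
    (K L : E d →L[ℝ] E d) :
    ∑ i, B (K (L (b i))) (b i) = ∑ i, B (L (K (b i))) (b i) := by
  have h1 : ∀ K L : E d →L[ℝ] E d, ∀ i,
      B (K (L (b i))) (b i) = ∑ k, B (L (b i)) (b k) * B (K (b k)) (b i) := by
    intro K L i
    conv_lhs => rw [← hb (L (b i))]
    simp only [map_sum, map_smul, sum_apply, smul_apply, smul_eq_mul]
  simp only [h1]
  rw [Finset.sum_comm]
  exact Finset.sum_congr rfl fun i _ => Finset.sum_congr rfl fun k _ => mul_comm _ _

namespace IsMetricOn

variable {G : E d → (E d →L[ℝ] E d →L[ℝ] ℝ)} {U : Set (E d)} {y : E d} {F : E d → ℝ}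

/-- The frame is frozen at `y` and need not be orthonormal nearby, because Ricci is a trace without
a metric. The Christoffel terms on the output and on the traced argument cancel by cyclicity. -/
theorem covDeriv₂_ricci (hG : IsMetricOn G U) (hy : y ∈ U) {b : Fin d → E d}
    (hb : IsFrame (G y) b) (x v w : E d) :
    covDeriv₂ G (ricci G) y x v w = ∑ i, G y (covDerivRiemann G y x (b i) v w) (b i) := by
  have h1 : (fun z => ricci G z v w) =ᶠ[nhds y]
      fun z => ∑ i, G y (riemann G z (b i) v w) (b i) :=
    Filter.eventuallyEq_of_mem (hG.mem_nhds hy) fun z hz => hG.ricci_eq_sum_frame hz hb v w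
  have h2 := HasFDerivAt.fun_sum (u := Finset.univ) fun (i : Fin d) _ =>
    (((G y).hasFDerivAt.comp y (hG.hasFDerivAt_of_on (hG.contDiffOn_riemann (b i) v w) hy))).clm_apply
      (hasFDerivAt_const (b i) y)
  have h3 : fderiv ℝ (fun z => ricci G z v w) y x
      = ∑ i, G y (fderiv ℝ (fun z => riemann G z (b i) v w) y x) (b i) := by
    rw [h1.fderiv_eq]
    refine (congrArg (fun L => L x) h2.fderiv).trans ?_
    simp
  let L : E d →ₗ[ℝ] E d :=
    { toFun := fun u => riemann G y u v w
      map_add' := fun a b => hG.riemann_add_left hy a b v w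
      map_smul' := fun t a => hG.riemann_smul_left hy t a v w }
  have h4 := sum_frame_comm hb (christoffelL G y x) (LinearMap.toContinuousLinearMap L)
  simp only [christoffelL_apply] at h4
  change ∑ i, G y (christoffel G y x (riemann G y (b i) v w)) (b i)
    = ∑ i, G y (riemann G y (christoffel G y x (b i)) v w) (b i) at h4
  rw [covDeriv₂, h3, hG.ricci_eq_sum_frame hy hb, hG.ricci_eq_sum_frame hy hb]
  simp only [covDerivRiemann, map_add, map_sub, add_apply, sub_apply, Finset.sum_add_distrib,
    Finset.sum_sub_distrib, h4]
  ring

/-- The contracted second Bianchi identity for the Ricci tensor. -/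
theorem fderiv_metricTrace_ricci (hG : IsMetricOn G U) (hy : y ∈ U) {b : Fin d → E d}
    (hb : IsFrame (G y) b) (x : E d) :
    fderiv ℝ (fun z => metricTrace (G z) (ricci G z)) y x
      = 2 * ∑ i, covDeriv₂ G (ricci G) y (b i) x (b i) := by
  rw [hG.fderiv_metricTrace hy (hG.isBilin_ricci hy) hG.contDiffOn_ricci,
    metricTrace_eq_sum_frame (hG.pos y hy) hb
      (hG.isBilin_covDeriv₂ hy (fun z hz => hG.isBilin_ricci hz) hG.contDiffOn_ricci x)]
  simp only [hG.covDeriv₂_ricci hy hb]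
  have hswap : ∀ a u v w, covDerivRiemann G y a u v w = - covDerivRiemann G y a v u w := by
    intro a u v w
    have h : (fun z => riemann G z u v w) = fun z => - riemann G z v u w :=
      funext fun z => riemann_swap u v w
    simp only [covDerivRiemann, h, fderiv_fun_neg, neg_apply]
    rw [riemann_swap u v, riemann_swap (christoffel G y a u), riemann_swap u (christoffel G y a v),
      riemann_swap u v]
    simp only [← christoffelL_apply, map_neg]
    abel
  -- The second Bianchi identity with two pairs of arguments contracted. The two terms on the right
  -- are one contraction with `i` and `j` interchanged, whence the factor `2`.
  have key : ∀ i j, G y (covDerivRiemann G y x (b i) (b j) (b j)) (b i)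
      = G y (covDerivRiemann G y (b i) (b j) x (b i)) (b j)
        + G y (covDerivRiemann G y (b j) (b i) x (b j)) (b i) := by
    intro i j
    have h1 := congrArg (fun v => G y v (b i)) (hG.bianchi hy x (b i) (b j) (b j))
    simp only [map_add, add_apply, map_zero, zero_apply] at h1
    have h2 := hG.apply_covDerivRiemann_skew hy (b i) (b j) x (b j) (b i)
    have h3 := congrArg (fun v => G y v (b i)) (hswap (b j) x (b i) (b j))
    simp only [map_neg, neg_apply] at h3
    rw [hG.symm y hy (b j)] at h2
    linarith
  rw [Finset.sum_comm]
  simp only [key, Finset.sum_add_distrib]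
  rw [Finset.sum_comm (f := fun j i => G y (covDerivRiemann G y (b j) (b i) x (b j)) (b i))]
  rw [two_mul]

theorem covDeriv₂_metric (hG : IsMetricOn G U) (hy : y ∈ U) (x u v : E d) :
    fderiv ℝ (fun z => G z u v) y x - G y (christoffel G y x u) v - G y u (christoffel G y x v)
      = 0 := by
  have h := hG.hasFDerivAt_apply hy (hasFDerivAt_const u y) (hasFDerivAt_const v y) x
  rw [h, hG.fderiv_apply hy]
  simp

theorem covDeriv₂_schouten (hG : IsMetricOn G U) (hy : y ∈ U) (x u v : E d) :
    covDeriv₂ G (schouten G) y x u v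
      = (covDeriv₂ G (ricci G) y x u v - fderiv ℝ (J G) y x * G y u v) / ((d : ℝ) - 2) := by
  have h1 := ((hG.hasFDerivAt_of_on (hG.contDiffOn_ricci u v) hy).sub
    ((hG.hasFDerivAt_of_on hG.contDiffOn_J hy).mul
      (hG.hasFDerivAt_of_on (hG.contDiffOn_apply u v) hy))).mul_const ((d : ℝ) - 2)⁻¹
  have h2 : fderiv ℝ (fun z => schouten G z u v) y x = _ := congrArg (fun L => L x) h1.fderiv
  have h3 := hG.covDeriv₂_metric hy x u v
  rw [covDeriv₂, h2, schouten, schouten, covDeriv₂]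
  simp only [smul_apply, sub_apply, add_apply, smul_eq_mul]
  linear_combination (- J G y / ((d : ℝ) - 2)) * h3

/-- The contracted second Bianchi identity for the Schouten tensor. -/
theorem sum_covDeriv₂_schouten (hd : 4 ≤ d) (hG : IsMetricOn G U) (hy : y ∈ U) {b : Fin d → E d}
    (hb : IsFrame (G y) b) (x : E d) :
    ∑ i, covDeriv₂ G (schouten G) y (b i) x (b i) = fderiv ℝ (J G) y x := by
  have h4 : (4 : ℝ) ≤ d := by exact_mod_cast hd
  have h1 := hG.fderiv_metricTrace_ricci hy hb x
  have h2 : (fun z => metricTrace (G z) (ricci G z)) = fun z => 2 * ((d : ℝ) - 1) * J G z :=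
    funext fun z => metricTrace_ricci hd
  have h3 : fderiv ℝ (fun z => 2 * ((d : ℝ) - 1) * J G z) y x = 2 * ((d : ℝ) - 1) * fderiv ℝ (J G) y x :=
    congrArg (fun L => L x)
      ((hG.hasFDerivAt_of_on hG.contDiffOn_J hy).const_mul (2 * ((d : ℝ) - 1))).fderiv
  have h5 := sum_frame_mul hb (L := fun u => fderiv ℝ (J G) y u) (by simp) (by simp) x
  rw [h2, h3] at h1
  simp only [hG.covDeriv₂_schouten hy, ← Finset.sum_div, Finset.sum_sub_distrib,
    mul_comm (fderiv ℝ (J G) y _), h5]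
  -- The numerator is `(d - 1) dJ - dJ = (d - 2) dJ`.
  rw [div_eq_iff (by linarith)]
  linarith

/-- Covariant differentiation commutes with the trace and `tr P = J`. Equality with the other
contraction of `∇P` is what eliminates `dJ` from the prolongation. -/
theorem sum_covDeriv₂_schouten_self (hd : 4 ≤ d) (hG : IsMetricOn G U) (hy : y ∈ U)
    {b : Fin d → E d} (hb : IsFrame (G y) b) (x : E d) :
    ∑ i, covDeriv₂ G (schouten G) y x (b i) (b i) = fderiv ℝ (J G) y x := by
  have h1 := hG.fderiv_metricTrace hy (hG.isBilin_schouten hy) hG.contDiffOn_schouten x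
  have h2 : (fun z => metricTrace (G z) (schouten G z)) =ᶠ[nhds y] J G :=
    Filter.eventuallyEq_of_mem (hG.mem_nhds hy) fun z hz => hG.metricTrace_schouten hd hz
  rw [h2.fderiv_eq, metricTrace_eq_sum_frame (hG.pos y hy) hb
      (hG.isBilin_covDeriv₂ hy (fun z hz => hG.isBilin_schouten hz) hG.contDiffOn_schouten x)] at h1
  exact h1.symm

/-! ### Prolongation of the conformal-to-Einstein equation -/

/-- The Ricci identity for the differential of a function. -/
theorem covDeriv₂_hessian_sub (hG : IsMetricOn G U) (hF : ContDiffOn ℝ ∞ F U) (hy : y ∈ U)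
    (u v w : E d) :
    covDeriv₂ G (hessian G F) y u v w - covDeriv₂ G (hessian G F) y v u w
      = - fderiv ℝ F y (riemann G y u v w) := by
  have hF1 := hG.contDiffOn_fderiv_fun hF
  have hF2 : ContDiffOn ℝ ∞ (fderiv ℝ (fderiv ℝ F)) U := hF1.fderiv_of_isOpen hG.isOpen (by simp)
  have hd1 := hG.hasFDerivAt_of_on hF1 hy
  have hd2 := hG.hasFDerivAt_of_on hF2 hy
  have key : ∀ a b, fderiv ℝ (fun z => hessian G F z b w) y a
      = fderiv ℝ (fderiv ℝ (fderiv ℝ F)) y a b w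
        - fderiv ℝ (fderiv ℝ F) y a (christoffel G y b w)
        - fderiv ℝ F y (fderiv ℝ (christoffelL G) y a b w) := by
    intro a b
    have h := ((hd2.clm_apply (hasFDerivAt_const b y)).clm_apply (hasFDerivAt_const w y)).sub
      (hd1.clm_apply (hG.hasFDerivAt_of_on (hG.contDiffOn_christoffel b w) hy))
    refine (congrArg (fun L => L a) h.fderiv).trans ?_
    simp [hG.fderiv_christoffel hy]
    ring
  have hs := congrArg (fun L : E d →L[ℝ] ℝ => L w)
    (((hF1.contDiffAt (hG.mem_nhds hy)).isSymmSndFDerivAt minSmoothness_two_le).eq u v)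
  simp only [covDeriv₂, key, hs]
  simp only [hessian_eq, hG.riemann_eq hy, map_add, map_sub,
    hG.christoffel_symm hy v u]
  ring

/-- A function solves the conformal-to-Einstein equation on `U`. -/
def _root_.AlmostEinstein.Coord.SolvesOn (G : E d → (E d →L[ℝ] E d →L[ℝ] ℝ)) (F : E d → ℝ)
    (U : Set (E d)) : Prop :=
  ContDiffOn ℝ ∞ F U ∧ ∀ z ∈ U, ∀ u v, traceFreeHessSchouten G F z u v = 0

theorem hessian_of_solves (hd : 4 ≤ d) (hG : IsMetricOn G U) (hF : SolvesOn G F U) (hy : y ∈ U)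
    (u v : E d) :
    hessian G F y u v = - (schouten G y u v * F y) - bottomSlot G F y * G y u v := by
  have := hF.2 y hy u v
  rw [hG.traceFreeHessSchouten_eq hd hy] at this
  linarith

/-- The derivative of the bottom slot of a solution. -/
theorem fderiv_bottomSlot (hd : 4 ≤ d) (hG : IsMetricOn G U) (hF : SolvesOn G F U) (hy : y ∈ U)
    (x : E d) :
    fderiv ℝ (bottomSlot G F) y x = schouten G y x (gradient G F y) := by
  have h4 : (4 : ℝ) ≤ d := by exact_mod_cast hd
  obtain ⟨b, hb⟩ := hG.exists_isFrame hy
  have hdF := hG.hasFDerivAt_of_on hF.1 hy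
  have hdr := hG.hasFDerivAt_of_on (hG.contDiffOn_bottomSlot hF.1) hy
  have hP := hG.isBilin_schouten hy
  have hcov : ∀ c u v, covDeriv₂ G (hessian G F) y c u v
      = - (covDeriv₂ G (schouten G) y c u v * F y) - schouten G y u v * fderiv ℝ F y c
        - fderiv ℝ (bottomSlot G F) y c * G y u v := by
    intro c u v
    have h1 : (fun z => hessian G F z u v) =ᶠ[nhds y]
        fun z => - (schouten G z u v * F z) - bottomSlot G F z * G z u v :=
      Filter.eventuallyEq_of_mem (hG.mem_nhds hy) fun z hz => hG.hessian_of_solves hd hF hz u v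
    have h2 := (((hG.hasFDerivAt_of_on (hG.contDiffOn_schouten u v) hy).mul hdF).neg).sub
      (hdr.mul (hG.hasFDerivAt_of_on (hG.contDiffOn_apply u v) hy))
    have h3 : fderiv ℝ (fun z => - (schouten G z u v * F z) - bottomSlot G F z * G z u v) y c = _ :=
      congrArg (fun L => L c) h2.fderiv
    have h5 := hG.covDeriv₂_metric hy c u v
    simp only [covDeriv₂, h1.fderiv_eq, h3, hG.hessian_of_solves hd hF hy]
    simp only [neg_apply, sub_apply, add_apply, smul_apply, smul_eq_mul]
    linear_combination (- bottomSlot G F y) * h5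
  have key : ∀ i, covDeriv₂ G (hessian G F) y x (b i) (b i)
      - covDeriv₂ G (hessian G F) y (b i) x (b i)
      = - G y (riemann G y (b i) x (gradient G F y)) (b i) := by
    intro i
    rw [hG.covDeriv₂_hessian_sub hF.1 hy, ← hG.apply_gradient' hy, riemann_swap (b i) x]
    have := hG.apply_riemann_skew hy x (b i) (b i) (gradient G F y)
    rw [hG.symm y hy (b i)] at this
    simp only [map_neg, neg_apply]
    linarith
  -- On the left the `F dJ` terms cancel, which leaves `P(x, grad F) - J dF(x) - (d - 1) dρ(x)`. On
  -- the right stands `-Ric(x, grad F) = -(d - 2) P(x, grad F) - J dF(x)`. The `J dF` terms cancel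
  -- and `d - 1` divides out.
  have hsum := Finset.sum_congr (rfl : (Finset.univ : Finset (Fin d)) = _) fun i _ => key i
  have h1 := hG.sum_covDeriv₂_schouten hd hy hb x
  have h2 := hG.sum_covDeriv₂_schouten_self hd hy hb x
  have h3 := hG.metricTrace_schouten hd hy
  rw [metricTrace_eq_sum_frame (hG.pos y hy) hb hP] at h3
  have h5 := sum_frame_self hb
  have h6 : ∑ i, schouten G y x (b i) * fderiv ℝ F y (b i) = schouten G y x (gradient G F y) := by
    rw [← sum_frame_mul hb (L := fun u => schouten G y x u) (hP.add_right x)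
      (fun t u => hP.smul_right t x u) (gradient G F y)]
    exact Finset.sum_congr rfl fun i _ => by rw [hG.apply_gradient hy, mul_comm]
  have h7 := sum_frame_mul hb (L := fun u => fderiv ℝ (bottomSlot G F) y u) (by simp) (by simp) x
  simp only [mul_comm (G y x _)] at h7
  simp only [hcov] at hsum
  simp only [Finset.sum_sub_distrib, Finset.sum_neg_distrib, ← Finset.sum_mul, ← Finset.mul_sum,
    h1, h2, h3, h5, h6, h7, ← hG.ricci_eq_sum_frame hy hb, ricci_eq hd,
    hG.apply_gradient' hy] at hsum
  have h8 : (d : ℝ) - 1 ≠ 0 := by linarith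
  apply mul_left_cancel₀ h8
  linarith

/-- The square of the tractor `(F, dF, ρ)` with respect to the tractor metric. -/
def _root_.AlmostEinstein.Coord.tractorSq (G : E d → (E d →L[ℝ] E d →L[ℝ] ℝ)) (F : E d → ℝ)
    (y : E d) : ℝ :=
  2 * F y * bottomSlot G F y + fderiv ℝ F y (gradient G F y)

/-- The tractor metric is preserved by the connection. Directly: `2ρ dF + 2F dρ + 2∇∇F(·, grad F)`
vanishes after inserting the equation and the formula for `dρ`. -/
theorem fderiv_tractorSq (hd : 4 ≤ d) (hG : IsMetricOn G U) (hF : SolvesOn G F U) (hy : y ∈ U) :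
    HasFDerivAt (tractorSq G F) (0 : E d →L[ℝ] ℝ) y := by
  have hdF := hG.hasFDerivAt_of_on hF.1 hy
  have hdr := hG.hasFDerivAt_of_on (hG.contDiffOn_bottomSlot hF.1) hy
  have hddF := hG.hasFDerivAt_of_on (hG.contDiffOn_fderiv_fun hF.1) hy
  have hgr := (hG.differentiableAt_gradient hF.1 hy).hasFDerivAt
  have h := ((hdF.const_mul 2).mul hdr).add (hddF.clm_apply hgr)
  refine h.congr_fderiv ?_
  ext v
  have h1 : hessian G F y v (gradient G F y)
      = fderiv ℝ (fderiv ℝ F) y v (gradient G F y)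
        - fderiv ℝ F y (christoffel G y v (gradient G F y)) := hessian_eq _ _ _ _ _
  have h2 := hG.apply_covDeriv_gradient hF.1 hy v (gradient G F y)
  rw [hG.apply_gradient' hy, map_add] at h2
  have h3 := hG.hessian_of_solves hd hF hy v (gradient G F y)
  rw [hG.apply_gradient' hy] at h3
  simp [hG.fderiv_bottomSlot hd hF hy]
  linear_combination 2 * h3 - h1 + h2

end IsMetricOn

end Coord

namespace Coord

variable {d : ℕ}

/-! ### Unique continuation for solutions -/

/-- The covector `P(w, ·)`. -/
def schoutenCov (G : E d → (E d →L[ℝ] E d →L[ℝ] ℝ)) (w z : E d) : E d →L[ℝ] ℝ :=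
  ∑ i, schouten G z w (e i) • (EuclideanSpace.proj i : E d →L[ℝ] ℝ)

namespace IsMetricOn

variable {G : E d → (E d →L[ℝ] E d →L[ℝ] ℝ)} {U : Set (E d)} {y : E d} {F : E d → ℝ}

theorem schoutenCov_apply (hG : IsMetricOn G U) (hy : y ∈ U) (w v : E d) :
    schoutenCov G w y v = schouten G y w v := by
  conv_rhs => rw [← sum_apply_smul_e v, (hG.isBilin_schouten hy).sum_right]
  simp only [(hG.isBilin_schouten hy).smul_right, schoutenCov, sum_apply, smul_apply, smul_eq_mul]
  exact Finset.sum_congr rfl fun i _ => mul_comm _ _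

theorem contDiffOn_schoutenCov (hG : IsMetricOn G U) (w : E d) :
    ContDiffOn ℝ ∞ (schoutenCov G w) U := by
  unfold schoutenCov
  exact ContDiffOn.sum fun i _ => (hG.contDiffOn_schouten w (e i)).smul contDiffOn_const

/-- Together with `fderiv_bottomSlot` this closes the linear first order system for `(F, dF, ρ)`. It
is an identity of covectors so that operator norms can be taken. -/
theorem fderiv_fderiv_of_solves (hd : 4 ≤ d) (hG : IsMetricOn G U) (hF : SolvesOn G F U)
    (hy : y ∈ U) (w : E d) :
    fderiv ℝ (fderiv ℝ F) y w = - (F y • schoutenCov G w y) - bottomSlot G F y • G y w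
      + fderiv ℝ F y ∘L christoffelL G y w := by
  ext v
  have h1 := hG.hessian_of_solves hd hF hy w v
  rw [hessian_eq] at h1
  simp only [add_apply, sub_apply, neg_apply, smul_apply, smul_eq_mul, hG.schoutenCov_apply hy,
    ContinuousLinearMap.comp_apply, christoffelL_apply]
  linear_combination h1

/-- Uniqueness for the linear system satisfied by `(F, dF, ρ)` restricted to the segment, with
Grönwall's inequality in place of parallel transport. -/
theorem eq_zero_of_segment (hd : 4 ≤ d) (hG : IsMetricOn G U) (hF : SolvesOn G F U) {z : E d}
    (hseg : segment ℝ y z ⊆ U) (h0 : F y = 0) (h1 : fderiv ℝ F y = 0)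
    (h2 : bottomSlot G F y = 0) : F z = 0 := by
  set w := z - y with hw
  set γ : ℝ → E d := fun t => y + t • w with hγ
  have hγU : ∀ t ∈ Set.Icc (0 : ℝ) 1, γ t ∈ U := fun t ht => hseg (by
    rw [segment_eq_image']
    exact ⟨t, ht, rfl⟩)
  have hγd : ∀ t, HasDerivAt γ w t := fun t => by
    have h := ((hasDerivAt_id t).smul_const w).const_add y
    rw [one_smul] at h
    exact h
  have hγc : Continuous γ := by fun_prop
  let X : ℝ → ℝ × (E d →L[ℝ] ℝ) × ℝ := fun t =>
    (F (γ t), fderiv ℝ F (γ t), bottomSlot G F (γ t))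
  let X' : ℝ → ℝ × (E d →L[ℝ] ℝ) × ℝ := fun t =>
    (fderiv ℝ F (γ t) w, fderiv ℝ (fderiv ℝ F) (γ t) w, fderiv ℝ (bottomSlot G F) (γ t) w)
  have hX : ∀ t ∈ Set.Icc (0 : ℝ) 1, HasDerivAt X (X' t) t := fun t ht =>
    ((hG.hasFDerivAt_of_on hF.1 (hγU t ht)).comp_hasDerivAt t (hγd t)).prodMk
      (((hG.hasFDerivAt_of_on (hG.contDiffOn_fderiv_fun hF.1) (hγU t ht)).comp_hasDerivAt t
        (hγd t)).prodMk ((hG.hasFDerivAt_of_on (hG.contDiffOn_bottomSlot hF.1)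
          (hγU t ht)).comp_hasDerivAt t (hγd t)))
  -- The sum of the norms of all coefficients of the system dominates each of its three rows;
  -- continuity on `[0, 1]` gives a uniform bound `K`.
  let k : ℝ → ℝ := fun t => ‖w‖ + ‖schoutenCov G w (γ t)‖ + ‖G (γ t) w‖
    + ‖christoffelL G (γ t) w‖ + ‖schoutenCov G w (γ t)‖ * ‖(G (γ t)).inverse‖
  have hk : ContinuousOn k (Set.Icc 0 1) := by
    have hP := (hG.contDiffOn_schoutenCov w).continuousOn.comp hγc.continuousOn hγU
    have hGc := (hG.contDiffOn.clm_apply (contDiffOn_const (c := w))).continuousOn.comp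
      hγc.continuousOn hγU
    have hC := (hG.contDiffOn_christoffelL.clm_apply (contDiffOn_const (c := w))).continuousOn.comp
      hγc.continuousOn hγU
    have hI := hG.contDiffOn_inverse.continuousOn.comp hγc.continuousOn hγU
    exact (((continuousOn_const.add hP.norm).add hGc.norm).add hC.norm).add (hP.norm.mul hI.norm)
  obtain ⟨K, hK⟩ := isCompact_Icc.bddAbove_image hk
  have hbound : ∀ t ∈ Set.Icc (0 : ℝ) 1, ‖X' t‖ ≤ K * ‖X t‖ := by
    intro t ht
    have hkt : k t ≤ K := hK ⟨t, ht, rfl⟩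
    refine le_trans ?_ (mul_le_mul_of_nonneg_right hkt (norm_nonneg _))
    have n0 := norm_nonneg (X t)
    have n1 : ‖F (γ t)‖ ≤ ‖X t‖ := norm_fst_le (X t)
    have n2 : ‖fderiv ℝ F (γ t)‖ ≤ ‖X t‖ := (norm_fst_le (X t).2).trans (norm_snd_le (X t))
    have n3 : ‖bottomSlot G F (γ t)‖ ≤ ‖X t‖ := (norm_snd_le (X t).2).trans (norm_snd_le (X t))
    have p1 := norm_nonneg w
    have p2 := norm_nonneg (schoutenCov G w (γ t))
    have p3 := norm_nonneg (G (γ t) w)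
    have p4 := norm_nonneg (christoffelL G (γ t) w)
    have p5 := norm_nonneg (G (γ t)).inverse
    have e1 : ‖fderiv ℝ F (γ t) w‖ ≤ ‖w‖ * ‖X t‖ :=
      ((fderiv ℝ F (γ t)).le_opNorm w).trans (by rw [mul_comm]; gcongr)
    have e2 : ‖fderiv ℝ (fderiv ℝ F) (γ t) w‖ ≤ ‖schoutenCov G w (γ t)‖ * ‖X t‖
        + ‖G (γ t) w‖ * ‖X t‖ + ‖christoffelL G (γ t) w‖ * ‖X t‖ := by
      rw [hG.fderiv_fderiv_of_solves hd hF (hγU t ht) w]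
      refine (norm_add_le _ _).trans (add_le_add ((norm_sub_le _ _).trans (add_le_add ?_ ?_)) ?_)
      · rw [norm_neg, norm_smul, mul_comm]; gcongr
      · rw [norm_smul, mul_comm]; gcongr
      · refine (ContinuousLinearMap.opNorm_comp_le _ _).trans ?_
        rw [mul_comm]; gcongr
    have e3 : ‖fderiv ℝ (bottomSlot G F) (γ t) w‖
        ≤ ‖schoutenCov G w (γ t)‖ * ‖(G (γ t)).inverse‖ * ‖X t‖ := by
      rw [hG.fderiv_bottomSlot hd hF (hγU t ht), ← hG.schoutenCov_apply (hγU t ht)]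
      refine (ContinuousLinearMap.le_opNorm _ _).trans ?_
      rw [mul_assoc]
      gcongr
      refine (ContinuousLinearMap.le_opNorm _ _).trans ?_
      gcongr
    have q1 := mul_nonneg p1 n0
    have q2 := mul_nonneg p2 n0
    have q3 := mul_nonneg p3 n0
    have q4 := mul_nonneg p4 n0
    have q5 := mul_nonneg (mul_nonneg p2 p5) n0
    have hsum : k t * ‖X t‖ = ‖w‖ * ‖X t‖ + ‖schoutenCov G w (γ t)‖ * ‖X t‖
        + ‖G (γ t) w‖ * ‖X t‖ + ‖christoffelL G (γ t) w‖ * ‖X t‖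
        + ‖schoutenCov G w (γ t)‖ * ‖(G (γ t)).inverse‖ * ‖X t‖ := by
      simp only [k]; ring
    rw [hsum]
    refine norm_prod_le_iff.2 ⟨?_, norm_prod_le_iff.2 ⟨?_, ?_⟩⟩
    · exact e1.trans (by linarith)
    · exact e2.trans (by linarith)
    · exact e3.trans (by linarith)
  have hg := norm_le_gronwallBound_of_norm_deriv_right_le (f := X) (f' := X') (δ := 0) (K := K)
    (ε := 0) (a := 0) (b := 1) (fun t ht => (hX t ht).continuousAt.continuousWithinAt)
    (fun t ht => (hX t ⟨ht.1, ht.2.le⟩).hasDerivWithinAt)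
    (by simp [X, γ, h0, h1, h2])
    (fun t ht => by simpa using hbound t ⟨ht.1, ht.2.le⟩) 1 (by simp)
  have hz : γ 1 = z := by simp [hγ, hw]
  have h3 : X 1 = 0 := by
    rw [gronwallBound_ε0_δ0] at hg
    exact norm_le_zero_iff.1 hg
  have h4 := congrArg Prod.fst h3
  simpa [X, hz] using h4

end IsMetricOn

/-! ### The Einstein metric of a solution -/

theorem christoffel_congr {G H : E d → (E d →L[ℝ] E d →L[ℝ] ℝ)} {y : E d} (h : G =ᶠ[nhds y] H) :
    ∀ᶠ z in nhds y, ∀ u v, christoffel G z u v = christoffel H z u v := by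
  filter_upwards [h.eventuallyEq_nhds] with z hz u v
  rw [christoffel, christoffel, christoffelLow, christoffelLow, hz.fderiv_eq, hz.eq_of_nhds]

/-- Needed because `F⁻² G` agrees with a rescaling of `G` only away from the zeros of `F`. -/
theorem ricci_congr {G H : E d → (E d →L[ℝ] E d →L[ℝ] ℝ)} {y : E d} (h : G =ᶠ[nhds y] H)
    (u v : E d) : ricci G y u v = ricci H y u v := by
  have hc := christoffel_congr h
  have h1 : ∀ a b, (fun z => christoffel G z a b) =ᶠ[nhds y] fun z => christoffel H z a b :=
    fun a b => hc.mono fun z hz => hz a b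
  simp only [ricci, riemann, (h1 _ _).fderiv_eq, hc.self_of_nhds]

namespace IsMetricOn

variable {G : E d → (E d →L[ℝ] E d →L[ℝ] ℝ)} {U : Set (E d)} {y : E d} {F : E d → ℝ}

/-- In the scale `F⁻² G` the density becomes `F / |F|`, which is locally constant, so its Hessian
vanishes and the conformal change law determines `P`. -/
theorem schouten_rescale_neg_log (hd : 4 ≤ d) (hG : IsMetricOn G U) (hF : SolvesOn G F U)
    (hne : ∀ z ∈ U, F z ≠ 0) (hy : y ∈ U) (u v : E d) :
    schouten (Coord.rescale (fun z => - Real.log (F z)) G) y u v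
      = - (1 / 2) * tractorSq G F y * ((F y ^ 2)⁻¹ * G y u v) := by
  -- `Real.log` is the logarithm of the absolute value, so negative values of `F` need no separate
  -- scale.
  set f : E d → ℝ := fun z => - Real.log (F z) with hf
  have hfs : ContDiffOn ℝ ∞ f U := (hF.1.log hne).neg
  have hFy := hne y hy
  have hfd : ∀ w, fderiv ℝ f y w = - (F y)⁻¹ * fderiv ℝ F y w := fun w => by
    have h := ((hG.hasFDerivAt_of_on hF.1 hy).log hFy).neg
    refine (congrArg (fun L => L w) h.fderiv).trans ?_
    simp
  have hgr : gradient G f y = - (F y)⁻¹ • gradient G F y := by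
    refine eq_of_forall_apply_eq (hG.pos y hy) fun w => ?_
    rw [hG.apply_gradient hy, hfd, map_smul, smul_apply, hG.apply_gradient hy, smul_eq_mul]
  have habs : ∀ z ∈ U, Real.exp (f z) = |F z|⁻¹ := fun z hz => by
    rw [hf, Real.exp_neg, Real.exp_log_eq_abs (hne z hz)]
  have hconst : (fun z => Real.exp (f z) * F z) =ᶠ[nhds y] fun _ => |F y|⁻¹ * F y := by
    have hc := (hG.differentiableAt_fun hF.1 hy).continuousAt
    rcases lt_or_gt_of_ne hFy with h | h
    · filter_upwards [hc.eventually_lt continuousAt_const h, hG.mem_nhds hy] with z hz hzU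
      have := hne z hzU
      rw [habs z hzU, abs_of_neg hz, abs_of_neg h]
      field_simp
    · filter_upwards [continuousAt_const.eventually_lt hc h, hG.mem_nhds hy] with z hz hzU
      have := hne z hzU
      rw [habs z hzU, abs_of_pos hz, abs_of_pos h]
      field_simp
  have h1 := hG.hessian_add_schouten_rescale hd hfs hF.1 hy u v
  have h2 : hessian (Coord.rescale f G) (fun z => Real.exp (f z) * F z) y u v = 0 := by
    rw [hessian_congr hconst, hessian_eq]
    simp
  rw [h2, hG.hessian_of_solves hd hF hy, hfd, hgr, map_smul, smul_eq_mul] at h1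
  have h3 := (Real.exp_pos (f y)).ne'
  rw [zero_add, mul_left_comm, mul_right_inj' h3] at h1
  apply mul_right_cancel₀ hFy
  rw [h1, tractorSq]
  field_simp
  ring

/-- The metric `F⁻² G` determined by a solution `F` is Einstein. -/
theorem ricci_einstein (hd : 4 ≤ d) (hG : IsMetricOn G U) (hF : SolvesOn G F U)
    (hne : F y ≠ 0) (hy : y ∈ U) (u v : E d) :
    ricci (fun z => (F z ^ 2)⁻¹ • G z) y u v
      = - ((d : ℝ) - 1) * tractorSq G F y * ((F y ^ 2)⁻¹ * G y u v) := by
  have hV : IsOpen (U ∩ F ⁻¹' {0}ᶜ) := hF.1.continuousOn.isOpen_inter_preimage hG.isOpen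
    isOpen_compl_singleton
  have hGV := hG.mono hV Set.inter_subset_left
  have hFV : SolvesOn G F (U ∩ F ⁻¹' {0}ᶜ) :=
    ⟨hF.1.mono Set.inter_subset_left, fun z hz => hF.2 z hz.1⟩
  have hneV : ∀ z ∈ U ∩ F ⁻¹' {0}ᶜ, F z ≠ 0 := fun z hz => hz.2
  have hyV : y ∈ U ∩ F ⁻¹' {0}ᶜ := ⟨hy, hne⟩
  set f : E d → ℝ := fun z => - Real.log (F z) with hf
  have hfs : ContDiffOn ℝ ∞ f (U ∩ F ⁻¹' {0}ᶜ) := (hFV.1.log hneV).neg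
  have hexp : ∀ z ∈ U ∩ F ⁻¹' {0}ᶜ, Real.exp (2 * f z) = (F z ^ 2)⁻¹ := fun z hz => by
    rw [hf, two_mul, ← neg_add, Real.exp_neg, Real.exp_add, Real.exp_log_eq_abs (hneV z hz),
      abs_mul_abs_self, sq]
  have heq : (fun z => (F z ^ 2)⁻¹ • G z) =ᶠ[nhds y] Coord.rescale f G :=
    Filter.eventuallyEq_of_mem (hV.mem_nhds hyV) fun z hz => by
      simp only [Coord.rescale, hexp z hz]
  have hR := hGV.rescale hfs
  have hP := hGV.schouten_rescale_neg_log hd hFV hneV hyV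
  -- With `P` equal to `-½ h(I, I)` times the metric, its trace is `J = -(d/2) h(I, I)`, and `(d -
  -- 2) P + J g` has coefficient `-(d - 1) h(I, I)`.
  have h1 := hR.metricTrace_schouten hd hyV
  have h2 : schouten (Coord.rescale f G) y
      = fun u v => - (1 / 2) * tractorSq G F y * Coord.rescale f G y u v := by
    funext a b
    rw [hP a b, Coord.rescale, hexp y hyV, smul_apply, smul_apply, smul_eq_mul]
  rw [h2, metricTrace_const_mul, metricTrace_self (hR.symm y hyV) (hR.pos y hyV)] at h1
  rw [ricci_congr heq, ricci_eq hd, hP, ← h1, Coord.rescale, hexp y hyV, smul_apply, smul_apply,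
    smul_eq_mul]
  ring

end IsMetricOn

end Coord

/-! ### Coordinate expressions -/

section Charts

variable {d : ℕ} {M : Type*} [TopologicalSpace M] [ChartedSpace (E d) M]

theorem isOpen_target (p : M) : IsOpen (extChartAt (𝓡 d) p).target :=
  isOpen_extChartAt_target p

theorem coordAt_mem (p : M) : (coordAt p : E d) ∈ (extChartAt (𝓡 d) p).target :=
  mem_extChartAt_target p

theorem symm_coordAt (p : M) : (extChartAt (𝓡 d) p).symm (coordAt p) = p :=
  extChartAt_to_inv p

theorem funIn_coordAt (f : M → ℝ) (p : M) : funIn p f (coordAt p : E d) = f p :=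
  congrArg f (symm_coordAt p)

/-- The transition map from the preferred chart at `q` to the preferred chart at `p`. -/
def transition (p q : M) (z : E d) : E d :=
  extChartAt (𝓡 d) p ((extChartAt (𝓡 d) q).symm z)

/-- The domain of the transition map. -/
def transitionSource (d : ℕ) {M : Type*} [TopologicalSpace M] [ChartedSpace (E d) M] (p q : M) :
    Set (E d) :=
  (extChartAt (𝓡 d) q).target ∩ (extChartAt (𝓡 d) q).symm ⁻¹' (extChartAt (𝓡 d) p).source

theorem isOpen_transitionSource (p q : M) : IsOpen (transitionSource d p q) :=
  (continuousOn_extChartAt_symm q).isOpen_inter_preimage (isOpen_target q)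
    (isOpen_extChartAt_source p)

theorem symm_transition {p q : M} {z : E d} (hz : z ∈ transitionSource d p q) :
    (extChartAt (𝓡 d) p).symm (transition p q z) = (extChartAt (𝓡 d) q).symm z :=
  (extChartAt (𝓡 d) p).left_inv hz.2

theorem transition_mem {p q : M} {z : E d} (hz : z ∈ transitionSource d p q) :
    transition p q z ∈ (extChartAt (𝓡 d) p).target :=
  (extChartAt (𝓡 d) p).map_source hz.2

theorem coordAt_mem_transitionSource {p q : M} (hq : q ∈ (extChartAt (𝓡 d) p).source) :
    (coordAt q : E d) ∈ transitionSource d p q :=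
  ⟨coordAt_mem q, by rwa [Set.mem_preimage, symm_coordAt]⟩

theorem transition_coordAt (p q : M) :
    transition p q (coordAt q) = extChartAt (𝓡 d) p q := by
  rw [transition, symm_coordAt]

theorem contMDiff_of_funIn {f : M → ℝ}
    (h : ∀ p : M, ContDiffOn ℝ ∞ (funIn p f) (extChartAt (𝓡 d) p).target) :
    ContMDiff (𝓡 d) 𝓘(ℝ, ℝ) ∞ f := by
  intro p
  have h1 := (h p).contDiffAt ((isOpen_target p).mem_nhds (coordAt_mem p))
  have h2 : ContMDiffAt 𝓘(ℝ, E d) 𝓘(ℝ, ℝ) ∞ (funIn p f) (extChartAt (𝓡 d) p p) :=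
    h1.contMDiffAt
  have h3 := h2.comp p (contMDiffAt_extChartAt (I := 𝓡 d) (n := ∞) (x := p))
  exact h3.congr_of_eventuallyEq (Filter.eventuallyEq_of_mem (extChartAt_source_mem_nhds p)
    fun q hq => congrArg f ((extChartAt (𝓡 d) p).left_inv hq).symm)

variable [IsManifold (𝓡 d) ∞ M]

theorem mdifferentiableAt_symm {p : M} {y : E d} (hy : y ∈ (extChartAt (𝓡 d) p).target) :
    MDifferentiableAt 𝓘(ℝ, E d) (𝓡 d) (extChartAt (𝓡 d) p).symm y :=
  ((contMDiffOn_extChartAt_symm (n := ∞) p).contMDiffAt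
    ((isOpen_target p).mem_nhds hy)).mdifferentiableAt (by simp)

theorem frameAt_mfderiv {p q : M} (hq : q ∈ (extChartAt (𝓡 d) p).source) :
    (mfderiv 𝓘(ℝ, E d) (𝓡 d) (extChartAt (𝓡 d) p).symm (extChartAt (𝓡 d) p q)) ∘L
      (mfderiv (𝓡 d) 𝓘(ℝ, E d) (extChartAt (𝓡 d) p) q) = ContinuousLinearMap.id _ _ := by
  have h := mfderivWithin_extChartAt_symm_comp_mfderiv_extChartAt' (I := 𝓡 d) hq
  rwa [ModelWithCorners.range_eq_univ, mfderivWithin_univ] at h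

theorem mfderiv_frameAt {p : M} {y : E d} (hy : y ∈ (extChartAt (𝓡 d) p).target) :
    (mfderiv (𝓡 d) 𝓘(ℝ, E d) (extChartAt (𝓡 d) p) ((extChartAt (𝓡 d) p).symm y)) ∘L
      frameAt p y = ContinuousLinearMap.id _ _ := by
  have h := mfderiv_extChartAt_comp_mfderivWithin_extChartAt_symm (I := 𝓡 d) hy
  rwa [ModelWithCorners.range_eq_univ, mfderivWithin_univ] at h

theorem frameAt_injective {p : M} {y : E d} (hy : y ∈ (extChartAt (𝓡 d) p).target) :
    Function.Injective (frameAt p y) := fun u v huv => by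
  have h := fun w : E d => congrArg (fun L : E d →L[ℝ] E d => L w) (mfderiv_frameAt hy)
  exact ((h u).symm.trans (congrArg (mfderiv (𝓡 d) 𝓘(ℝ, E d) (extChartAt (𝓡 d) p)
    ((extChartAt (𝓡 d) p).symm y)) huv)).trans (h v)

/-- The two sides lie in tangent spaces whose base points are only propositionally equal, so they
are compared in the model space. -/
theorem frameAt_vecAt (p : M) (u : TangentSpace (𝓡 d) p) :
    (show E d from frameAt p (coordAt p) (vecAt p u)) = (show E d from u) :=
  congrArg (fun L : E d →L[ℝ] E d => L u) (frameAt_mfderiv (mem_extChartAt_source (I := 𝓡 d) p))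

theorem bilIn_coordAt (g : BilinField d M) (p : M) (u v : TangentSpace (𝓡 d) p) :
    bilIn p g (coordAt p) (vecAt p u) (vecAt p v) = g p u v := by
  -- Generalising the base point along with the vectors allows the equality of base points to be
  -- substituted.
  have h : ∀ (q : M) (_ : q = p) (a b : E d) (_ : a = u) (_ : b = v),
      (g q : E d →L[ℝ] E d →L[ℝ] ℝ) a b = g p u v := by
    rintro q rfl a b rfl rfl
    rfl
  exact h _ (symm_coordAt p) _ _ (frameAt_vecAt p u) (frameAt_vecAt p v)

/-- The preferred chart has identity derivative at its own base point. Model vectors at `coordAt p`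
may therefore be replaced by tangent vectors at `p`. -/
theorem vecAt_surjective (p : M) : Function.Surjective (vecAt (d := d) p) := by
  have h : vecAt (d := d) p = ContinuousLinearMap.id ℝ _ := mfderiv_extChartAt_self
  intro u
  exact ⟨u, by rw [h]; rfl⟩

theorem covIn_coordAt (α : CovectorField d M) (p : M) (u : TangentSpace (𝓡 d) p) :
    covIn p α (coordAt p) (vecAt p u) = α p u := by
  have h : ∀ (q : M) (_ : q = p) (a : E d) (_ : a = u),
      (α q : E d →L[ℝ] ℝ) a = α p u := by
    rintro q rfl a rfl
    rfl
  exact h _ (symm_coordAt p) _ (frameAt_vecAt p u)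

theorem contDiffOn_funIn {f : M → ℝ} (hf : ContMDiff (𝓡 d) 𝓘(ℝ, ℝ) ∞ f) (p : M) :
    ContDiffOn ℝ ∞ (funIn p f) (extChartAt (𝓡 d) p).target :=
  contMDiffOn_iff_contDiffOn.1
    (hf.comp_contMDiffOn (contMDiffOn_extChartAt_symm (n := ∞) p))

/-- The differential of a function in coordinates. -/
theorem covIn_mvfderiv {f : M → ℝ} {p : M} {y : E d} (hy : y ∈ (extChartAt (𝓡 d) p).target)
    (hf : MDifferentiableAt (𝓡 d) 𝓘(ℝ, ℝ) f ((extChartAt (𝓡 d) p).symm y)) :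
    covIn p (mvfderiv (𝓡 d) f) y = fderiv ℝ (funIn p f) y := by
  have h := mfderiv_comp y hf (mdifferentiableAt_symm hy)
  rw [mfderiv_eq_fderiv] at h
  exact h.symm

theorem fderiv_funIn_vecAt {f : M → ℝ} {p : M} (hf : MDifferentiableAt (𝓡 d) 𝓘(ℝ, ℝ) f p)
    (u : TangentSpace (𝓡 d) p) :
    fderiv ℝ (funIn p f) (coordAt p) (vecAt p u) = mvfderiv (𝓡 d) f p u := by
  rw [← covIn_mvfderiv (coordAt_mem p) (by rwa [symm_coordAt]), covIn_coordAt]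

/-- The coordinate field is the tangent map of the inverse chart applied to a constant field. -/
theorem contMDiff_frameAt (p : M) (u : E d) :
    ContMDiffOn 𝓘(ℝ, E d) ((𝓡 d).prod 𝓘(ℝ, E d)) ∞
      (fun y => Bundle.TotalSpace.mk' (E d) (E := fun q : M => TangentSpace (𝓡 d) q)
        ((extChartAt (𝓡 d) p).symm y) (frameAt p y u)) (extChartAt (𝓡 d) p).target := by
  have h1 := (contMDiffOn_extChartAt_symm (I := 𝓡 d) (n := ∞) p).contMDiffOn_tangentMapWithin
    (m := ∞) (by simp) (isOpen_target p).uniqueMDiffOn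
  have h2 : ContMDiff 𝓘(ℝ, E d) (𝓘(ℝ, E d).prod 𝓘(ℝ, E d)) ∞
      (fun y => Bundle.TotalSpace.mk' (E d) (E := fun q : E d => TangentSpace 𝓘(ℝ, E d) q) y u) :=
    contMDiff_vectorSpace_iff_contDiff.2 contDiff_const
  refine (h1.comp h2.contMDiffOn (fun y hy => hy)).congr fun y hy => ?_
  simp only [Function.comp_apply, tangentMapWithin,
    mfderivWithin_of_isOpen (isOpen_target p) hy]
  rfl

theorem contDiffOn_bilIn (g : Metric d M) (p : M) :
    ContDiffOn ℝ ∞ (bilIn p g.inner) (extChartAt (𝓡 d) p).target := by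
  refine contDiffOn_clm_apply.2 fun u => contDiffOn_clm_apply.2 fun v => ?_
  have hg := g.contMDiff.comp_contMDiffOn (contMDiffOn_extChartAt_symm (I := 𝓡 d) (n := ∞) p)
  have h := ContMDiffOn.clm_bundle_apply₂ (F₁ := E d) (F₂ := E d) (F₃ := ℝ)
    (E₁ := fun q : M => TangentSpace (𝓡 d) q) (E₂ := fun q : M => TangentSpace (𝓡 d) q)
    (E₃ := Bundle.Trivial M ℝ) hg (contMDiff_frameAt p u) (contMDiff_frameAt p v)
  intro y hy
  have h2 := (Bundle.contMDiffWithinAt_totalSpace.1 (h y hy)).2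
  exact contMDiffWithinAt_iff_contDiffWithinAt.1 h2

theorem isMetricOn_bilIn (g : Metric d M) (p : M) :
    Coord.IsMetricOn (bilIn p g.inner) (extChartAt (𝓡 d) p).target where
  isOpen := isOpen_target p
  contDiffOn := contDiffOn_bilIn g p
  symm _ _ _ _ := g.symm _ _ _
  pos _ hy _ hu := g.pos _ _ fun h => hu (frameAt_injective hy (h.trans (map_zero _).symm))

theorem contDiffOn_transition (p q : M) :
    ContDiffOn ℝ ∞ (transition p q) (transitionSource d p q) :=
  contMDiffOn_iff_contDiffOn.1 ((contMDiffOn_extChartAt (I := 𝓡 d) (n := ∞) (x := p)).comp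
    ((contMDiffOn_extChartAt_symm (I := 𝓡 d) (n := ∞) q).mono Set.inter_subset_left)
    fun z hz => by simpa using hz.2)

theorem frameAt_transition {p q : M} {z : E d} (hz : z ∈ transitionSource d p q) (u : E d) :
    (show E d from frameAt p (transition p q z) (fderiv ℝ (transition p q) z u))
      = (show E d from frameAt q z u) := by
  have hd : MDifferentiableAt 𝓘(ℝ, E d) 𝓘(ℝ, E d) (transition p q) z :=
    (((contDiffOn_transition p q).contDiffAt
      ((isOpen_transitionSource p q).mem_nhds hz)).differentiableAt (by simp)).mdifferentiableAt
  have h1 := mfderiv_comp z (mdifferentiableAt_symm (transition_mem hz)) hd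
  have h2 : (extChartAt (𝓡 d) p).symm ∘ transition p q =ᶠ[nhds z] (extChartAt (𝓡 d) q).symm :=
    Filter.eventuallyEq_of_mem ((isOpen_transitionSource p q).mem_nhds hz) fun w hw =>
      symm_transition hw
  rw [mfderiv_eq_fderiv] at h1
  have h3 := h2.mfderiv_eq (I := 𝓘(ℝ, E d)) (I' := 𝓡 d)
  exact congrArg (fun L : E d →L[ℝ] E d => L u) (h1.symm.trans h3)

/-- Makes the naturality results for `IsPullback` available on the manifold. The metric identity
holds because both coordinate expressions evaluate `g` at the same point on the same vectors. -/
theorem isPullback_transition (g : Metric d M) (p q : M) :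
    Coord.IsPullback (transition p q) (bilIn p g.inner) (bilIn q g.inner)
      (extChartAt (𝓡 d) p).target (transitionSource d p q) where
  left := (isMetricOn_bilIn g q).mono (isOpen_transitionSource p q) Set.inter_subset_left
  right := isMetricOn_bilIn g p
  mapsTo z hz := transition_mem hz
  contDiffOn := contDiffOn_transition p q
  injective z hz u v huv := frameAt_injective hz.1 ((frameAt_transition hz u).symm.trans
    ((congrArg (fun x : E d => (show E d from frameAt p (transition p q z) x)) huv).trans
      (frameAt_transition hz v)))
  eq z hz u v := by
    have h : ∀ (x x' : M) (_ : x = x') (a a' b b' : E d) (_ : a = a') (_ : b = b'),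
        (g.inner x : E d →L[ℝ] E d →L[ℝ] ℝ) a b = (g.inner x' : E d →L[ℝ] E d →L[ℝ] ℝ) a' b' := by
      rintro x _ rfl a _ b _ rfl rfl
      rfl
    exact (h _ _ (symm_transition hz) _ _ _ _ (frameAt_transition hz u)
      (frameAt_transition hz v)).symm

theorem smoothCovector_mvfderiv {f : M → ℝ} (hf : ContMDiff (𝓡 d) 𝓘(ℝ, ℝ) ∞ f) :
    SmoothCovector (mvfderiv (𝓡 d) f) := by
  intro p
  rw [contMDiffAt_hom_bundle]
  refine ⟨contMDiffAt_id, ?_⟩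
  have h := (hf p).mfderiv_const (m := ∞) (by simp)
  refine h.congr_of_eventuallyEq (Filter.Eventually.of_forall fun q => ?_)
  simp only [inTangentCoordinates, ContinuousLinearMap.inCoordinates]
  ext v
  simp
  rfl

end Charts

/-! ### Locality and naturality of the bottom slot, the tractor square and the equation. -/

namespace Coord

variable {d : ℕ} {G : E d → (E d →L[ℝ] E d →L[ℝ] ℝ)} {y : E d} {F F' : E d → ℝ}

theorem bottomSlot_congr (h : F =ᶠ[nhds y] F') : bottomSlot G F y = bottomSlot G F' y := by
  simp only [bottomSlot, laplacian, h.eq_of_nhds]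
  rw [metricTrace_congr (hessian_congr h)]

theorem tractorSq_congr (h : F =ᶠ[nhds y] F') : tractorSq G F y = tractorSq G F' y := by
  simp only [tractorSq, gradient, h.eq_of_nhds, bottomSlot_congr h, h.fderiv_eq]

theorem traceFreeHessSchouten_congr (h : F =ᶠ[nhds y] F') (u v : E d) :
    traceFreeHessSchouten G F y u v = traceFreeHessSchouten G F' y u v := by
  simp only [traceFreeHessSchouten, h.eq_of_nhds, hessian_congr h]

namespace IsPullback

variable {ψ : E d → E d} {H : E d → (E d →L[ℝ] E d →L[ℝ] ℝ)} {U V : Set (E d)}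

theorem fderiv_comp (h : IsPullback ψ G H U V) (hF : ContDiffOn ℝ ∞ F U) (hy : y ∈ V) :
    fderiv ℝ (F ∘ ψ) y = fderiv ℝ F (ψ y) ∘L fderiv ℝ ψ y :=
  ((h.right.differentiableAt_fun hF (h.mapsTo hy)).hasFDerivAt.comp y (h.hasFDerivAt hy)).fderiv

theorem fderiv_gradient (h : IsPullback ψ G H U V) (hF : ContDiffOn ℝ ∞ F U) (hy : y ∈ V) :
    fderiv ℝ ψ y (gradient H (F ∘ ψ) y) = gradient G F (ψ y) := by
  refine eq_of_forall_apply_eq (h.right.pos _ (h.mapsTo hy)) fun x' => ?_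
  obtain ⟨x, rfl⟩ := h.surjective hy x'
  rw [← h.eq y hy, h.left.apply_gradient hy, h.right.apply_gradient (h.mapsTo hy),
    h.fderiv_comp hF hy, ContinuousLinearMap.comp_apply]

theorem tractorSq_eq (h : IsPullback ψ G H U V) (hF : ContDiffOn ℝ ∞ F U) (hy : y ∈ V) :
    tractorSq H (F ∘ ψ) y = tractorSq G F (ψ y) := by
  rw [tractorSq, tractorSq, h.bottomSlot_eq hF hy, h.fderiv_comp hF hy,
    ContinuousLinearMap.comp_apply, h.fderiv_gradient hF hy, Function.comp_apply]

end IsPullback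

/-- If `∇∇F + P F` is a multiple of the metric at a point, the factor is the bottom slot. -/
theorem IsMetricOn.eq_bottomSlot (hd : 4 ≤ d) {U : Set (E d)} (hG : IsMetricOn G U) (hy : y ∈ U)
    {r : ℝ} (h : ∀ u v, hessian G F y u v + schouten G y u v * F y + r * G y u v = 0) :
    r = bottomSlot G F y := by
  have h4 : (4 : ℝ) ≤ d := by exact_mod_cast hd
  have h1 := hG.metricTrace_hessian_add_schouten hd hy F
  rw [metricTrace_congr (S := fun u v => - r * G y u v) fun u v => by linarith [h u v],
    metricTrace_const_mul, metricTrace_self (hG.symm y hy) (hG.pos y hy)] at h1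
  have h2 : (d : ℝ) ≠ 0 := by linarith
  apply mul_left_cancel₀ h2
  linarith

end Coord

/-! ### Solutions and parallel tractors on the manifold. -/

section Manifold

variable {d : ℕ} {M : Type*} [TopologicalSpace M] [ChartedSpace (E d) M] {f : M → ℝ}

theorem mdifferentiableAt_of_contMDiff (hf : ContMDiff (𝓡 d) 𝓘(ℝ, ℝ) ∞ f) (p : M) :
    MDifferentiableAt (𝓡 d) 𝓘(ℝ, ℝ) f p :=
  (hf p).mdifferentiableAt (by simp)

theorem contMDiff_exp_mul {φ : M → ℝ} (hφ : ContMDiff (𝓡 d) 𝓘(ℝ, ℝ) ∞ φ)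
    (hf : ContMDiff (𝓡 d) 𝓘(ℝ, ℝ) ∞ f) :
    ContMDiff (𝓡 d) 𝓘(ℝ, ℝ) ∞ (fun p => Real.exp (φ p) * f p) :=
  (Real.contDiff_exp.contMDiff.comp hφ).mul hf

/-! ### Invariantly defined functions in coordinates -/

theorem funIn_eventuallyEq (f : M → ℝ) {p q : M} (hq : q ∈ (extChartAt (𝓡 d) p).source) :
    funIn q f =ᶠ[nhds (coordAt q : E d)] funIn p f ∘ transition p q :=
  Filter.eventuallyEq_of_mem
    ((isOpen_transitionSource p q).mem_nhds (coordAt_mem_transitionSource hq))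
    fun _ hz => congrArg f (symm_transition hz).symm

variable [IsManifold (𝓡 d) ∞ M]

/-- The bottom slot `ρ = (Δ - J) f / d` of the tractor associated with a function. -/
def bottom (g : Metric d M) (f : M → ℝ) (q : M) : ℝ :=
  Coord.bottomSlot (bilIn q g.inner) (funIn q f) (coordAt q)

/-- The tractor square of the tractor associated with a function. -/
def square (g : Metric d M) (f : M → ℝ) (q : M) : ℝ :=
  Coord.tractorSq (bilIn q g.inner) (funIn q f) (coordAt q)

/-- `bottom` uses a different chart at each point. Naturality computes it throughout one chart
domain, which is what makes it differentiable by coordinate formulas. -/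
theorem bottom_eq (g : Metric d M) (hf : ContMDiff (𝓡 d) 𝓘(ℝ, ℝ) ∞ f) {p q : M}
    (hq : q ∈ (extChartAt (𝓡 d) p).source) :
    bottom g f q = Coord.bottomSlot (bilIn p g.inner) (funIn p f) (extChartAt (𝓡 d) p q) := by
  rw [bottom, Coord.bottomSlot_congr (funIn_eventuallyEq f hq),
    (isPullback_transition g p q).bottomSlot_eq (contDiffOn_funIn hf p)
      (coordAt_mem_transitionSource hq), transition_coordAt]

theorem square_eq (g : Metric d M) (hf : ContMDiff (𝓡 d) 𝓘(ℝ, ℝ) ∞ f) {p q : M}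
    (hq : q ∈ (extChartAt (𝓡 d) p).source) :
    square g f q = Coord.tractorSq (bilIn p g.inner) (funIn p f) (extChartAt (𝓡 d) p q) := by
  rw [square, Coord.tractorSq_congr (funIn_eventuallyEq f hq),
    (isPullback_transition g p q).tractorSq_eq (contDiffOn_funIn hf p)
      (coordAt_mem_transitionSource hq), transition_coordAt]

theorem funIn_bottom (g : Metric d M) (hf : ContMDiff (𝓡 d) 𝓘(ℝ, ℝ) ∞ f) {p : M} {y : E d}
    (hy : y ∈ (extChartAt (𝓡 d) p).target) :
    funIn p (bottom g f) y = Coord.bottomSlot (bilIn p g.inner) (funIn p f) y := by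
  rw [funIn, bottom_eq g hf ((extChartAt (𝓡 d) p).map_target hy),
    (extChartAt (𝓡 d) p).right_inv hy]

theorem contMDiff_bottom (g : Metric d M) (hf : ContMDiff (𝓡 d) 𝓘(ℝ, ℝ) ∞ f) :
    ContMDiff (𝓡 d) 𝓘(ℝ, ℝ) ∞ (bottom g f) :=
  contMDiff_of_funIn fun p =>
    ((isMetricOn_bilIn g p).contDiffOn_bottomSlot (contDiffOn_funIn hf p)).congr
      fun _ hy => funIn_bottom g hf hy

/-- A solution of the conformal-to-Einstein equation solves it in every chart. -/
theorem SolvesEinsteinEq.solvesOn (hd : 4 ≤ d) {g : Metric d M}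
    (hf : ContMDiff (𝓡 d) 𝓘(ℝ, ℝ) ∞ f) (h : SolvesEinsteinEq g.inner f) (p : M) :
    Coord.SolvesOn (bilIn p g.inner) (funIn p f) (extChartAt (𝓡 d) p).target := by
  refine ⟨contDiffOn_funIn hf p, fun y hy u v => ?_⟩
  have hq := (extChartAt (𝓡 d) p).map_target hy
  set q := (extChartAt (𝓡 d) p).symm y
  have hψ := isPullback_transition g p q
  have hm := coordAt_mem_transitionSource hq
  have hy' : transition p q (coordAt q) = y := by
    rw [transition_coordAt, (extChartAt (𝓡 d) p).right_inv hy]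
  -- Every model vector at `y` comes, through the transition map, from a tangent vector at `q`,
  -- where the equation is assumed in the chart of `q`.
  obtain ⟨u, rfl⟩ := hψ.surjective hm u
  obtain ⟨v, rfl⟩ := hψ.surjective hm v
  obtain ⟨u, rfl⟩ := vecAt_surjective q u
  obtain ⟨v, rfl⟩ := vecAt_surjective q v
  have h1 := hψ.traceFreeHessSchouten_eq hd (contDiffOn_funIn hf p) hm (vecAt q u) (vecAt q v)
  rw [hy'] at h1
  rw [← h1, ← Coord.traceFreeHessSchouten_congr (funIn_eventuallyEq f hq)]
  exact h q u v

theorem apply_inverse (g : Metric d M) (p : M) (α : TangentSpace (𝓡 d) p →L[ℝ] ℝ)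
    (v : TangentSpace (𝓡 d) p) : g.inner p ((g.inner p).inverse α) v = α v :=
  congrArg (fun L : E d →L[ℝ] ℝ => L v)
    (Coord.apply_inverse (B := g.inner p) (fun u hu => g.pos p u hu) α)

theorem vecAt_inverse (g : Metric d M) (α : CovectorField d M) (p : M) :
    vecAt p ((g.inner p).inverse (α p))
      = (bilIn p g.inner (coordAt p)).inverse (covIn p α (coordAt p)) := by
  have hm := isMetricOn_bilIn g p
  refine Coord.eq_of_forall_apply_eq (hm.pos _ (coordAt_mem p)) fun w => ?_
  obtain ⟨w, rfl⟩ := vecAt_surjective p w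
  rw [bilIn_coordAt, apply_inverse, hm.apply_inverse (coordAt_mem p), covIn_coordAt]

theorem vecAt_inverse_mvfderiv (g : Metric d M) (hf : ContMDiff (𝓡 d) 𝓘(ℝ, ℝ) ∞ f) (p : M) :
    vecAt p ((g.inner p).inverse (mvfderiv (𝓡 d) f p))
      = Coord.gradient (bilIn p g.inner) (funIn p f) (coordAt p) := by
  rw [vecAt_inverse, covIn_mvfderiv (coordAt_mem p) (mdifferentiableAt_of_contMDiff hf _)]
  rfl

theorem cometric_mvfderiv (g : Metric d M) {φ : M → ℝ} (hφ : ContMDiff (𝓡 d) 𝓘(ℝ, ℝ) ∞ φ)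
    (hf : ContMDiff (𝓡 d) 𝓘(ℝ, ℝ) ∞ f) (p : M) :
    cometric g p (mvfderiv (𝓡 d) φ p) (mvfderiv (𝓡 d) f p)
      = fderiv ℝ (funIn p f) (coordAt p)
        (Coord.gradient (bilIn p g.inner) (funIn p φ) (coordAt p)) := by
  rw [cometric, ← vecAt_inverse_mvfderiv g hφ,
    fderiv_funIn_vecAt (mdifferentiableAt_of_contMDiff hf p)]

theorem covDeriv_mvfderiv (g : Metric d M) (hf : ContMDiff (𝓡 d) 𝓘(ℝ, ℝ) ∞ f) (p : M)
    (u v : TangentSpace (𝓡 d) p) :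
    covDeriv g.inner (mvfderiv (𝓡 d) f) p u v
      = Coord.hessian (bilIn p g.inner) (funIn p f) (coordAt p) (vecAt p u) (vecAt p v) := by
  have h : covIn p (mvfderiv (𝓡 d) f) =ᶠ[nhds (coordAt p : E d)] fderiv ℝ (funIn p f) :=
    Filter.eventuallyEq_of_mem ((isOpen_target p).mem_nhds (coordAt_mem p))
      fun _ hy => covIn_mvfderiv hy (mdifferentiableAt_of_contMDiff hf _)
  rw [covDeriv, Coord.covDeriv, h.fderiv_eq, h.eq_of_nhds]
  rfl

/-! ### Conformal rescaling -/

theorem bilIn_rescaling {g g' : Metric d M} {φ : M → ℝ} (h : IsRescaling g g' φ) (p : M) :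
    bilIn p g'.inner = Coord.rescale (funIn p φ) (bilIn p g.inner) := by
  funext y
  ext u v
  rw [bilIn_apply, h.2]
  rfl

theorem SolvesEinsteinEq.rescaling (hd : 4 ≤ d) {g g' : Metric d M} {φ : M → ℝ}
    (h : IsRescaling g g' φ) (hf : ContMDiff (𝓡 d) 𝓘(ℝ, ℝ) ∞ f)
    (hs : SolvesEinsteinEq g.inner f) :
    SolvesEinsteinEq g'.inner (fun p => Real.exp (φ p) * f p) := by
  intro p u v
  rw [traceFreeHessSchouten, bilIn_rescaling h]
  have h1 := (isMetricOn_bilIn g p).traceFreeHessSchouten_rescale hd (contDiffOn_funIn h.1 p)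
    (contDiffOn_funIn hf p) (coordAt_mem p) (vecAt p u) (vecAt p v)
  refine h1.trans ?_
  rw [show Coord.traceFreeHessSchouten (bilIn p g.inner) (funIn p f) (coordAt p) (vecAt p u)
    (vecAt p v) = 0 from hs p u v, mul_zero]

/-- The tractor `(f, df, ρ)` associated with a function, in the scale `g`. -/
def slotsOf (g : Metric d M) (f : M → ℝ) (p : M) : Slots d p :=
  (f p, mvfderiv (𝓡 d) f p, bottom g f p)

/-- Makes `(1/d) Dσ` a well-defined tractor: the middle slot is the product rule and the last one is
`bottomSlot_rescale`. -/
theorem slotsOf_rescaling (hd : 4 ≤ d) {g g' : Metric d M} {φ : M → ℝ}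
    (h : IsRescaling g g' φ) (hf : ContMDiff (𝓡 d) 𝓘(ℝ, ℝ) ∞ f) (p : M) :
    slotsOf g' (fun p => Real.exp (φ p) * f p) p = transform g 0 φ p (slotsOf g f p) := by
  have hm := isMetricOn_bilIn g p
  have hφ' := contDiffOn_funIn h.1 p
  have hf' := contDiffOn_funIn hf p
  refine Prod.ext ?_ (Prod.ext ?_ ?_)
  · simp [slotsOf, transform]
  · ext u
    simp only [slotsOf, transform, zero_add, one_mul, smul_apply, add_apply, smul_eq_mul]
    rw [← fderiv_funIn_vecAt (mdifferentiableAt_of_contMDiff (contMDiff_exp_mul h.1 hf) p),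
      ← fderiv_funIn_vecAt (mdifferentiableAt_of_contMDiff h.1 p),
      ← fderiv_funIn_vecAt (mdifferentiableAt_of_contMDiff hf p)]
    have h1 := hm.fderiv_exp_mul hφ' hf' (coordAt_mem p) (vecAt p u)
    simp only [funIn_coordAt] at h1
    exact h1
  · simp only [slotsOf, transform, cometric_mvfderiv g h.1 hf, cometric_mvfderiv g h.1 h.1]
    rw [bottom, bilIn_rescaling h]
    have h1 := hm.bottomSlot_rescale hd hφ' hf' (coordAt_mem p)
    simp only [funIn_coordAt] at h1
    rw [zero_sub, neg_one_mul]
    exact h1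

/-! ### Parallel tractors and solutions -/

theorem hessian_add_eq_zero (hd : 4 ≤ d) {g : Metric d M} (hf : ContMDiff (𝓡 d) 𝓘(ℝ, ℝ) ∞ f)
    (h : SolvesEinsteinEq g.inner f) (p : M) (u v : TangentSpace (𝓡 d) p) :
    covDeriv g.inner (mvfderiv (𝓡 d) f) p u v + bottom g f p * g.inner p u v
      + f p * schouten g.inner p u v = 0 := by
  have h1 := (isMetricOn_bilIn g p).hessian_of_solves hd (h.solvesOn hd hf p) (coordAt_mem p)
    (vecAt p u) (vecAt p v)
  rw [covDeriv_mvfderiv g hf, h1, bilIn_coordAt, funIn_coordAt, schouten, bottom]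
  ring

theorem mvfderiv_bottom (hd : 4 ≤ d) {g : Metric d M} (hf : ContMDiff (𝓡 d) 𝓘(ℝ, ℝ) ∞ f)
    (h : SolvesEinsteinEq g.inner f) (p : M) (v : TangentSpace (𝓡 d) p) :
    mvfderiv (𝓡 d) (bottom g f) p v
      = schouten g.inner p v ((g.inner p).inverse (mvfderiv (𝓡 d) f p)) := by
  have h1 : funIn p (bottom g f) =ᶠ[nhds (coordAt p : E d)]
      Coord.bottomSlot (bilIn p g.inner) (funIn p f) :=
    Filter.eventuallyEq_of_mem ((isOpen_target p).mem_nhds (coordAt_mem p))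
      fun _ hy => funIn_bottom g hf hy
  rw [← fderiv_funIn_vecAt (mdifferentiableAt_of_contMDiff (contMDiff_bottom g hf) p),
    h1.fderiv_eq, (isMetricOn_bilIn g p).fderiv_bottomSlot hd (h.solvesOn hd hf p) (coordAt_mem p),
    schouten, vecAt_inverse_mvfderiv g hf]

/-- The three slots vanish by construction, by the equation, and by its prolongation respectively.
-/
theorem tractorConnection_slotsOf (hd : 4 ≤ d) {g : Metric d M}
    (hf : ContMDiff (𝓡 d) 𝓘(ℝ, ℝ) ∞ f) (h : SolvesEinsteinEq g.inner f) (p : M)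
    (v : TangentSpace (𝓡 d) p) : tractorConnection g (slotsOf g f) p v = 0 := by
  refine Prod.ext ?_ (Prod.ext ?_ ?_)
  · exact sub_self _
  · funext u
    exact hessian_add_eq_zero hd hf h p v u
  · exact sub_eq_zero.2 (mvfderiv_bottom hd hf h p v)

/-- A parallel tractor is determined by its top slot, which is a solution. -/
theorem eq_slotsOf_of_parallel (hd : 4 ≤ d) {g : Metric d M} {U : (p : M) → Slots d p}
    (hf : ContMDiff (𝓡 d) 𝓘(ℝ, ℝ) ∞ fun p => (U p).1)
    (h : ∀ p v, tractorConnection g U p v = 0) :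
    U = slotsOf g (fun p => (U p).1) ∧ SolvesEinsteinEq g.inner (fun p => (U p).1) := by
  have h1 : (fun q => (U q).2.1) = mvfderiv (𝓡 d) (fun q => (U q).1) := by
    funext p
    ext v
    exact (sub_eq_zero.1 (congrArg Prod.fst (h p v))).symm
  have h2 : ∀ (p : M) (u v : E d),
      Coord.hessian (bilIn p g.inner) (funIn (d := d) p fun q => (U q).1) (coordAt p) u v
        + Coord.schouten (bilIn p g.inner) (coordAt p) u v
          * funIn (d := d) p (fun q => (U q).1) (coordAt p)
        + (U p).2.2 * bilIn p g.inner (coordAt p) u v = 0 := by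
    intro p u v
    obtain ⟨u, rfl⟩ := vecAt_surjective p u
    obtain ⟨v, rfl⟩ := vecAt_surjective p v
    have h3 : covDeriv g.inner (fun q => (U q).2.1) p u v + (U p).2.2 * g.inner p u v
        + (U p).1 * schouten g.inner p u v = 0 :=
      congrFun (congrArg (fun x : ℝ × (TangentSpace (𝓡 d) p → ℝ) × ℝ => x.2.1) (h p u)) v
    rw [h1, covDeriv_mvfderiv g hf] at h3
    rw [bilIn_coordAt, funIn_coordAt]
    rw [schouten] at h3
    linarith
  -- The trace of the middle slot leaves no freedom for `ρ`.
  have h4 : ∀ p, (U p).2.2 = bottom g (fun q => (U q).1) p := fun p =>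
    (isMetricOn_bilIn g p).eq_bottomSlot hd (coordAt_mem p) (h2 p)
  refine ⟨funext fun p => Prod.ext rfl (Prod.ext (congrFun h1 p) (h4 p)), fun p u v => ?_⟩
  rw [traceFreeHessSchouten, (isMetricOn_bilIn g p).traceFreeHessSchouten_eq hd (coordAt_mem (d := d) p)]
  have h5 := h2 p (vecAt p u) (vecAt p v)
  rwa [h4] at h5

/-! ### Zeros of solutions and the Einstein metric -/

/-- The interior of the zero set is clopen. A chart ball around a point of its closure contains a
point near which `f` vanishes; there `f`, `df` and `ρ` are all zero, and segments in the ball spread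
this to the whole ball. -/
theorem dense_ne_zero (hd : 4 ≤ d) [ConnectedSpace M] {g : Metric d M}
    (hf : ContMDiff (𝓡 d) 𝓘(ℝ, ℝ) ∞ f) (h : SolvesEinsteinEq g.inner f) (hne : f ≠ 0) :
    Dense {p : M | f p ≠ 0} := by
  have hclosed : IsClosed (interior {p : M | f p = 0}) := by
    refine isClosed_of_closure_subset fun p hp => ?_
    have hm := isMetricOn_bilIn g p
    obtain ⟨ε, hε, hball⟩ := _root_.Metric.isOpen_iff.1 (isOpen_target p) _ (coordAt_mem (d := d) p)
    have hnhds : (extChartAt (𝓡 d) p).source ∩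
        extChartAt (𝓡 d) p ⁻¹' _root_.Metric.ball (coordAt p) ε ∈ nhds p :=
      Filter.inter_mem (extChartAt_source_mem_nhds p)
        ((continuousAt_extChartAt p).preimage_mem_nhds (_root_.Metric.ball_mem_nhds _ hε))
    obtain ⟨q, ⟨hq1, hq2⟩, hq3⟩ := mem_closure_iff_nhds.1 hp _ hnhds
    have hy := (extChartAt (𝓡 d) p).map_source hq1
    have hq4 : (extChartAt (𝓡 d) p).symm (extChartAt (𝓡 d) p q) = q :=
      (extChartAt (𝓡 d) p).left_inv hq1
    have hzero : funIn p f =ᶠ[nhds (extChartAt (𝓡 d) p q)] fun _ => (0 : ℝ) := by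
      have hc : ContinuousAt (extChartAt (𝓡 d) p).symm (extChartAt (𝓡 d) p q) :=
        continuousAt_extChartAt_symm'' hy
      have := hc.preimage_mem_nhds (by rw [hq4]; exact mem_interior_iff_mem_nhds.1 hq3)
      filter_upwards [this] with z hz using hz
    rw [mem_interior_iff_mem_nhds]
    filter_upwards [hnhds] with z hz
    have hb : Coord.bottomSlot (bilIn p g.inner) (funIn p f) (extChartAt (𝓡 d) p q) = 0 := by
      rw [Coord.bottomSlot_congr hzero]
      simp [Coord.bottomSlot, Coord.laplacian, Coord.metricTrace, Coord.hessian_eq]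
    have h1 := hm.eq_zero_of_segment hd (h.solvesOn hd hf p) (z := extChartAt (𝓡 d) p z)
      (((convex_ball _ _).segment_subset hq2 hz.2).trans hball) hzero.eq_of_nhds
      (by rw [hzero.fderiv_eq]; simp) hb
    rw [funIn, (extChartAt (𝓡 d) p).left_inv hz.1] at h1
    exact h1
  rcases isClopen_iff.1 ⟨hclosed, isOpen_interior⟩ with h1 | h1
  · have h2 : {p : M | f p ≠ 0} = {p : M | f p = 0}ᶜ := rfl
    rw [h2, ← interior_eq_empty_iff_dense_compl]
    exact h1
  · refine absurd (funext fun p => ?_) hne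
    have h2 : p ∈ interior {p : M | f p = 0} := by rw [h1]; exact Set.mem_univ p
    exact (interior_subset h2 : p ∈ {p : M | f p = 0})

/-- The square has zero derivative on a ball in each chart, so it is locally constant, and `M` is
connected. -/
theorem square_eq_const (hd : 4 ≤ d) [ConnectedSpace M] {g : Metric d M}
    (hf : ContMDiff (𝓡 d) 𝓘(ℝ, ℝ) ∞ f) (h : SolvesEinsteinEq g.inner f) (p q : M) :
    square g f p = square g f q := by
  refine IsLocallyConstant.apply_eq_of_preconnectedSpace
    ((IsLocallyConstant.iff_eventually_eq _).2 fun p => ?_) p q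
  obtain ⟨ε, hε, hball⟩ := _root_.Metric.isOpen_iff.1 (isOpen_target p) _ (coordAt_mem (d := d) p)
  have hd' := fun z hz => (isMetricOn_bilIn g p).fderiv_tractorSq hd (h.solvesOn hd hf p)
    (hball hz : z ∈ _)
  have hconst : ∀ x ∈ _root_.Metric.ball (coordAt p : E d) ε,
      ∀ y ∈ _root_.Metric.ball (coordAt p : E d) ε,
      Coord.tractorSq (bilIn p g.inner) (funIn p f) x
        = Coord.tractorSq (bilIn p g.inner) (funIn p f) y := fun x hx y hy =>
    _root_.Metric.isOpen_ball.is_const_of_fderiv_eq_zero (𝕜 := ℝ)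
      (convex_ball (coordAt p : E d) ε).isPreconnected
      (fun z hz => (hd' z hz).differentiableAt.differentiableWithinAt)
      (fun z hz => (hd' z hz).fderiv) hx hy
  filter_upwards [extChartAt_source_mem_nhds (I := 𝓡 d) p,
    (continuousAt_extChartAt (I := 𝓡 d) p).preimage_mem_nhds
      (_root_.Metric.ball_mem_nhds (coordAt p : E d) hε)] with z hz1 hz2
  rw [square_eq g hf hz1]
  exact hconst _ hz2 _ (_root_.Metric.mem_ball_self hε)

theorem ricci_inv_sq_smul (hd : 4 ≤ d) {g : Metric d M}
    (hf : ContMDiff (𝓡 d) 𝓘(ℝ, ℝ) ∞ f) (h : SolvesEinsteinEq g.inner f) {p : M} (hp : f p ≠ 0)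
    (u v : TangentSpace (𝓡 d) p) :
    ricci (fun q => (f q ^ 2)⁻¹ • g.inner q) p u v
      = - ((d : ℝ) - 1) * square g f p * ((f p ^ 2)⁻¹ * g.inner p u v) := by
  have h1 := (isMetricOn_bilIn g p).ricci_einstein hd (h.solvesOn hd hf p)
    (by rwa [funIn_coordAt]) (coordAt_mem p) (vecAt p u) (vecAt p v)
  rw [bilIn_coordAt, funIn_coordAt] at h1
  exact h1

end Manifold

section Manifold

variable {d : ℕ} {M : Type*} [TopologicalSpace M] [ChartedSpace (E d) M]
  [IsManifold (𝓡 d) ∞ M] {c : ConformalStructure d M}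

/-! ### Densities of weight one -/

theorem IsRescaling.trans {g g' g'' : Metric d M} {φ ψ : M → ℝ} (h : IsRescaling g g' φ)
    (h' : IsRescaling g' g'' ψ) : IsRescaling g g'' (ψ + φ) := by
  refine ⟨h'.1.add h.1, fun p => ?_⟩
  rw [h'.2, h.2, smul_smul, ← Real.exp_add, Pi.add_apply, mul_add]

/-- Both factors are read off on one nonzero vector, which exists because `d > 0`. -/
theorem IsRescaling.unique (hd : 4 ≤ d) {g g' : Metric d M} {φ ψ : M → ℝ}
    (h : IsRescaling g g' φ) (h' : IsRescaling g g' ψ) : φ = ψ := by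
  funext p
  have hv : (Coord.e ⟨0, by omega⟩ : E d) ≠ 0 := by simp [Coord.e]
  have hpos := g.pos p (Coord.e ⟨0, by omega⟩ : E d) hv
  have h1 := congrArg (fun B : E d →L[ℝ] E d →L[ℝ] ℝ =>
    B (Coord.e ⟨0, by omega⟩) (Coord.e ⟨0, by omega⟩)) ((h.2 p).symm.trans (h'.2 p))
  have h2 := Real.exp_injective (mul_right_cancel₀ hpos.ne' h1)
  linarith

theorem exists_isRescaling (g g' : c.metrics) : ∃ φ : M → ℝ, IsRescaling g.1 g'.1 φ :=
  (c.mem_iff g.1 g.2 g'.1).1 g'.2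

variable {σ : (p : M) → Density c 1 p}

theorem densIn_rescaling {g g' : c.metrics} {φ : M → ℝ} (h : IsRescaling g.1 g'.1 φ)
    (σ : (p : M) → Density c 1 p) :
    densIn g' σ = fun p => Real.exp (φ p) * densIn g σ p := by
  funext p
  rw [densIn, (σ p).2 g g' φ h, one_mul]
  rfl

theorem density_eq_zero_iff (g : c.metrics) {p : M} : σ p = 0 ↔ densIn g σ p = 0 := by
  refine ⟨fun h => by rw [densIn, h]; rfl, fun h => Subtype.ext (funext fun g' => ?_)⟩
  obtain ⟨φ, hφ⟩ := exists_isRescaling g g'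
  have h1 := congrFun (densIn_rescaling hφ σ) p
  simp only [h, mul_zero] at h1
  exact h1

theorem densIn_ne_zero (hσ : σ ≠ 0) (g : c.metrics) : densIn g σ ≠ 0 := fun h =>
  hσ (funext fun _ => (density_eq_zero_iff g).2 (congrFun h _))

/-- The density of weight one with value `f` in the scale `g`. -/
def densityOf (hd : 4 ≤ d) (g : c.metrics) (f : M → ℝ) (p : M) : Density c 1 p :=
  ⟨fun g' => Real.exp ((exists_isRescaling g g').choose p) * f p, fun g' g'' φ h => by
    -- Uniqueness turns the chosen conformal factors into a cocycle.
    have h1 := (exists_isRescaling g g'').choose_spec.unique hd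
      ((exists_isRescaling g g').choose_spec.trans h)
    beta_reduce
    rw [h1, Pi.add_apply, Real.exp_add, one_mul, mul_assoc]⟩

theorem densIn_densityOf (hd : 4 ≤ d) (g : c.metrics) (f : M → ℝ) :
    densIn g (densityOf hd g f) = f := by
  have h0 : IsRescaling g.1 g.1 0 := ⟨contMDiff_const, fun p => by simp⟩
  funext p
  have h1 := (exists_isRescaling g g).choose_spec.unique hd h0
  simp [densIn, densityOf, h1]

theorem smoothDensity_densityOf (hd : 4 ≤ d) (g : c.metrics) {f : M → ℝ}
    (hf : ContMDiff (𝓡 d) 𝓘(ℝ, ℝ) ∞ f) : SmoothDensity (densityOf hd g f) := fun g' =>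
  contMDiff_exp_mul (exists_isRescaling g g').choose_spec.1 hf

/-- Conformal invariance upgrades the single scale in the definition to all scales, as `IsParallel`
requires. -/
theorem IsEinsteinScale.solves (hd : 4 ≤ d) (hσ : IsEinsteinScale σ) (g : c.metrics) :
    SolvesEinsteinEq g.1.inner (densIn g σ) := by
  obtain ⟨hs, -, g₀, h⟩ := hσ
  obtain ⟨φ, hφ⟩ := exists_isRescaling g₀ g
  rw [densIn_rescaling hφ]
  exact h.rescaling hd hφ (hs g₀)

/-! ### Parallel tractors and densities -/

/-- The tractor `(1/d) D σ` of a density of weight one. -/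
def tractorOf (hd : 4 ≤ d) (hσ : SmoothDensity σ) (p : M) : Tractor c 0 p :=
  ⟨fun g => slotsOf g.1 (densIn g σ) p, fun g g' φ h => by
    beta_reduce
    rw [densIn_rescaling h]
    exact slotsOf_rescaling hd h (hσ g) p⟩

/-- At weight one `d + 2w - 2 = d`, which cancels the factor `1/d` in the first two slots. -/
theorem slotsOf_eq_tractorD (hd : 4 ≤ d) (g : c.metrics) (σ : (p : M) → Density c 1 p) (p : M) :
    slotsOf g.1 (densIn g σ) p = (1 / (d : ℝ)) • tractorD g σ p := by
  have h4 : (4 : ℝ) ≤ d := by exact_mod_cast hd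
  have h1 : (d : ℝ) ≠ 0 := by linarith
  have h2 : (d : ℝ) + 2 * 1 - 2 = d := by ring
  refine Prod.ext ?_ (Prod.ext ?_ ?_)
  · simp [slotsOf, tractorD, h1]
  · simp only [slotsOf, tractorD, h2, Prod.smul_snd, Prod.smul_fst, smul_smul]
    rw [one_div_mul_cancel h1, one_smul]
  · simp only [slotsOf, tractorD, Prod.smul_snd, smul_eq_mul, one_mul]
    rw [bottom, Coord.bottomSlot, funIn_coordAt]
    rfl

theorem isParallelTractor_tractorOf (hd : 4 ≤ d) (hσ : IsEinsteinScale σ) :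
    IsParallelTractor (tractorOf hd hσ.1) := by
  refine ⟨fun g => ⟨hσ.1 g, smoothCovector_mvfderiv (hσ.1 g), contMDiff_bottom g.1 (hσ.1 g)⟩,
    fun h => ?_, fun g p v => tractorConnection_slotsOf hd (hσ.1 g) (hσ.solves hd g) p v⟩
  obtain ⟨g, -⟩ := hσ.2.2
  refine densIn_ne_zero hσ.2.1 g (funext fun p => ?_)
  exact congrArg (fun U : Tractor c 0 p => (U.1 g).1) (congrFun h p)

/-- The density `h(I, X)` of weight one: the top slot of a tractor. -/
def topSlot (U : (p : M) → Tractor c 0 p) (p : M) : Density c 1 p :=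
  ⟨fun g => ((U p).1 g).1, fun g g' φ h => by
    beta_reduce
    rw [(U p).2 g g' φ h, transform, zero_add]⟩

/-- `h(I, X)` has type of weight `0 + 1` rather than `1`, so the two densities are compared scale by
scale. -/
theorem densIn_topSlot (g : c.metrics) (U : (p : M) → Tractor c 0 p) (p : M) :
    densIn g (topSlot U) p = (tractorMetric (U p) (canonicalX c p)).1 g := by
  simp [densIn, topSlot, tractorMetric, tractorForm, canonicalX, cometric]

variable {U : (p : M) → Tractor c 0 p}

theorem smoothDensity_topSlot (hU : IsParallelTractor U) : SmoothDensity (topSlot U) :=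
  fun g => (hU.1 g).1

theorem slotsIn_eq_of_isParallelTractor (hd : 4 ≤ d) (hU : IsParallelTractor U) (g : c.metrics) :
    slotsIn g U = slotsOf g.1 (densIn g (topSlot U)) :=
  (eq_slotsOf_of_parallel hd (hU.1 g).1 (hU.2.2 g)).1

theorem tractorOf_topSlot (hd : 4 ≤ d) (hU : IsParallelTractor U) :
    tractorOf hd (smoothDensity_topSlot hU) = U := by
  funext p
  refine Subtype.ext (funext fun g => ?_)
  exact (congrFun (slotsIn_eq_of_isParallelTractor hd hU g) p).symm

theorem isEinsteinScale_topSlot (hd : 4 ≤ d) (hU : IsParallelTractor U) :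
    IsEinsteinScale (topSlot U) := by
  obtain ⟨g, hg⟩ := c.nonempty
  refine ⟨smoothDensity_topSlot hU, fun h => hU.2.1 ?_, ⟨g, hg⟩,
    (eq_slotsOf_of_parallel hd (hU.1 ⟨g, hg⟩).1 (hU.2.2 ⟨g, hg⟩)).2⟩
  -- The tractor is recovered from its top slot, so a vanishing top slot would make it zero.
  rw [← tractorOf_topSlot hd hU]
  funext p
  refine Subtype.ext (funext fun g' => ?_)
  have h1 : densIn g' (topSlot U) = fun _ => 0 := by rw [h]; rfl
  change slotsOf g'.1 (densIn g' (topSlot U)) p = 0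
  rw [slotsOf_eq_tractorD hd, tractorD, h1]
  have h2 : laplacian g'.1.inner (fun _ : M => (0 : ℝ)) p = 0 := by
    have h3 : funIn (d := d) p (fun _ : M => (0 : ℝ)) = fun _ => 0 := rfl
    simp [laplacian, h3, Coord.laplacian, Coord.metricTrace, Coord.hessian_eq]
  have h4 : mvfderiv (𝓡 d) (fun _ : M => (0 : ℝ)) p = 0 := by
    ext v
    simp [mvfderiv]
  rw [h2, h4]
  simp

variable (c) in
/-- Nontrivial solutions of the conformal-to-Einstein equation correspond to nonzero parallel
tractors. -/
def einsteinScaleEquiv (hd : 4 ≤ d) :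
    {σ : (p : M) → Density c 1 p // IsEinsteinScale σ} ≃
      {I : (p : M) → Tractor c 0 p // IsParallelTractor I} where
  toFun σ := ⟨tractorOf hd σ.2.1, isParallelTractor_tractorOf hd σ.2⟩
  invFun I := ⟨topSlot I.1, isEinsteinScale_topSlot hd I.2⟩
  -- The first slot of `slotsOf` is the density itself.
  left_inv _ := rfl
  right_inv I := Subtype.ext (tractorOf_topSlot hd I.2)

theorem isAlmostEinstein_iff (hd : 4 ≤ d) (g : c.metrics) :
    IsAlmostEinstein g.1 ↔ ∃ σ : (p : M) → Density c 1 p, IsEinsteinScale σ := by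
  constructor
  · rintro ⟨x, hx, hx0, hs⟩
    refine ⟨densityOf hd g x, smoothDensity_densityOf hd g hx, fun h => hx0 ?_, g, ?_⟩
    · rw [← densIn_densityOf hd g x, h]
      rfl
    · rwa [densIn_densityOf]
  · rintro ⟨σ, hσ⟩
    exact ⟨densIn g σ, hσ.1 g, densIn_ne_zero hσ.2.1 g, hσ.solves hd g⟩

/-! ### The Einstein metric -/

/-- Weight one: the factor `e^{-2φ}` from `σ⁻²` cancels `e^{2φ}` from the metric. One Einstein
constant therefore serves all scales. -/
theorem einsteinMetric_eq (g g' : c.metrics) (σ : (p : M) → Density c 1 p) :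
    einsteinMetric g σ = einsteinMetric g' σ := by
  obtain ⟨φ, hφ⟩ := exists_isRescaling g g'
  funext p
  have h1 : Real.exp (2 * φ p) = Real.exp (φ p) ^ 2 := by
    rw [sq, ← Real.exp_add, two_mul]
  have h2 := (Real.exp_pos (φ p)).ne'
  rw [einsteinMetric, einsteinMetric, densIn_rescaling hφ, hφ.2, smul_smul, h1]
  congr 1
  rw [mul_pow, mul_inv_rev, mul_assoc, inv_mul_cancel₀ (pow_ne_zero 2 h2), mul_one]

theorem IsEinsteinScale.exists_ricci_eq (hd : 4 ≤ d) [ConnectedSpace M] (hσ : IsEinsteinScale σ) :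
    ∃ l : ℝ, ∀ (g : c.metrics) (p : M), σ p ≠ 0 → ∀ u v : TangentSpace (𝓡 d) p,
      ricci (einsteinMetric g σ) p u v = l * einsteinMetric g σ p u v := by
  have hs := hσ.solves hd
  obtain ⟨hσ₁, -, g₀, -⟩ := hσ
  obtain ⟨p₀⟩ := (inferInstance : Nonempty M)
  refine ⟨- ((d : ℝ) - 1) * square g₀.1 (densIn g₀ σ) p₀, fun g p hp u v => ?_⟩
  rw [einsteinMetric_eq g g₀, square_eq_const hd (hσ₁ g₀) (hs g₀) p₀ p]
  exact ricci_inv_sq_smul hd (hσ₁ g₀) (hs g₀) (mt (density_eq_zero_iff g₀).2 hp) u v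

theorem IsEinsteinScale.isOpen_ne_zero (hσ : IsEinsteinScale σ) : IsOpen {p : M | σ p ≠ 0} := by
  obtain ⟨hσ₁, -, g, -⟩ := hσ
  simp only [ne_eq, density_eq_zero_iff g]
  exact isOpen_ne_fun (hσ₁ g).continuous continuous_const

theorem IsEinsteinScale.dense_ne_zero (hd : 4 ≤ d) [ConnectedSpace M] (hσ : IsEinsteinScale σ) :
    Dense {p : M | σ p ≠ 0} := by
  have hs := hσ.solves hd
  obtain ⟨hσ₁, h0, g, -⟩ := hσ
  simp only [ne_eq, density_eq_zero_iff g]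
  exact AlmostEinstein.dense_ne_zero hd (hσ₁ g) (hs g) (densIn_ne_zero h0 g)

end Manifold

end AlmostEinstein

end

theorem theorem4p1 {d : ℕ} (hd : 4 ≤ d) {M : Type*} [TopologicalSpace M] [T2Space M]
    [SecondCountableTopology M] [ConnectedSpace M]
    [ChartedSpace (AlmostEinstein.E d) M] [IsManifold (𝓡 d) ∞ M]
    (c : AlmostEinstein.ConformalStructure d M) :
    (∀ g ∈ c.metrics, AlmostEinstein.IsAlmostEinstein g ↔
      ∃ I : (p : M) → AlmostEinstein.Tractor c 0 p, AlmostEinstein.IsParallelTractor I) ∧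
    (∃ Φ : {σ : (p : M) → AlmostEinstein.Density c 1 p // AlmostEinstein.IsEinsteinScale σ} ≃
        {I : (p : M) → AlmostEinstein.Tractor c 0 p // AlmostEinstein.IsParallelTractor I},
      (∀ σ g p, AlmostEinstein.slotsIn g (Φ σ).1 p
        = (1 / (d : ℝ)) • AlmostEinstein.tractorD g σ.1 p) ∧
      (∀ I g p, AlmostEinstein.densIn g (Φ.symm I).1 p
        = (AlmostEinstein.tractorMetric (I.1 p) (AlmostEinstein.canonicalX c p)).1 g)) ∧
    (∀ σ : (p : M) → AlmostEinstein.Density c 1 p, AlmostEinstein.IsEinsteinScale σ →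
      IsOpen {p : M | σ p ≠ 0} ∧ Dense {p : M | σ p ≠ 0} ∧
      ∃ l : ℝ, ∀ (g : c.metrics) (p : M), σ p ≠ 0 →
        ∀ u v : TangentSpace (𝓡 d) p,
          AlmostEinstein.ricci (AlmostEinstein.einsteinMetric g σ) p u v
            = l * AlmostEinstein.einsteinMetric g σ p u v) := by
  refine ⟨fun g hg => ?_, ⟨AlmostEinstein.einsteinScaleEquiv c hd, fun σ g p => ?_,
    fun I g p => AlmostEinstein.densIn_topSlot g I.1 p⟩, fun σ hσ =>
    ⟨hσ.isOpen_ne_zero, hσ.dense_ne_zero hd, hσ.exists_ricci_eq hd⟩⟩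
  · rw [AlmostEinstein.isAlmostEinstein_iff hd ⟨g, hg⟩, ← nonempty_subtype, ← nonempty_subtype]
    exact (AlmostEinstein.einsteinScaleEquiv c hd).nonempty_congr
  · exact AlmostEinstein.slotsOf_eq_tractorD hd g σ.1 p
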